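/- All vector spaces and algebras are over $\mathbb C$; $\odot$ is the algebraic tensor product, $A'$ the algebraic dual of $A$, and $\iota$ denotes identity maps. An algebra $A$ (not necessarily unital) is non-degenerate if ($ab=0$ for all $b$) implies $a=0$ and ($ba=0$ for all $b$) implies $a=0$; $M(A)$ is its multiplier algebra. A homomorphism $\pi:A\to M(B)$ is non-degenerate if the linear spans $\pi(A)B$ and $B\,\pi(A)$ are equal to $B$; then $\pi\odot\iota$ and $\iota\odot\pi$ extend to multipliers, $M(A\odot C)\to M(B\odot C)$ and $M(C\odot A)\to M(C\odot B)$, for every non-degenerate algebra $C$. Let $(A,\Delta)$ be an algebraic quantum group: $A$ is a non-degenerate algebra, $\Delta:A\to M(A\odot A)$ is a non-degenerate homomorphism with $(\Delta\odot\iota)\Delta=(\iota\odot\Delta)\Delta$, the maps $a\otimes b\mapsto \Delta(a)(b\otimes1),\ \Delta(a)(1\otimes b),\ (b\otimes1)\Delta(a),\ (1\otimes b)\Delta(a)$ are bijections from $A\odot A$ to $A\odot A\subseteq M(A\odot A)$, and there is a non-zero linear functional on $A$ that is left invariant. Fix such a functional $\varphi$, so $\varphi\neq0$ and $(\iota\odot\varphi)\Delta(a)=\varphi(a)1$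 for all $a\in A$. For $a\in A$ let $a\varphi\in A'$ be $(a\varphi)(x)=\varphi(xa)$, and let $\hat A=\{a\varphi\mid a\in A\}\subseteq A'$, which is an algebra for the product $(\omega_1\omega_2)(x)=\omega_1\bigl((\iota\odot\omega_2)\Delta(x)\bigr)$. Elements of $A\odot\hat A$ are regarded as linear operators on $A$ through $(x\otimes\omega)(y)=\omega(y)x$. A corepresentation of $(A,\Delta)$ on a non-degenerate algebra $B$ is an element $V\in M(A\odot B)$ with $(\Delta\odot\iota)(V)=V_{13}V_{23}$; it is non-degenerate if $V$ is invertible in $M(A\odot B)$. For $\omega=a\varphi\in\hat A$, $(\omega\odot\iota)(V)$ is the left multiplier of $B$ given by $(a\varphi\odot\iota)(V)\,b=(\varphi\odot\iota)(V(a\otimes b))$, and $\pi_V(\omega)=(\omega\odot\iota)(V)$. **Proposition.** There is a unique $U\in M(A\odot\hat A)$ such that $[U(x\otimes\omega)](y)=(\iota\odot\omega)(\Delta(y)(x\otimes1))$ and $[(x\otimes\omega)U](y)=(\omega\odot\iota)((1\otimes x)\Delta(y))$ for all $x,y\in A$, $\omega\in\hat A$. For every non-degenerate algebra $B$: 1.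 for every non-degenerate corepresentation $V$ of $(A,\Delta)$ on $B$ there is a unique non-degenerate homomorphism $\theta:\hat A\to M(B)$ such that $(\iota\odot\theta)(U)=V$; 2. for every non-degenerate homomorphism $\theta:\hat A\to M(B)$, the element $(\iota\odot\theta)(U)$ is a non-degenerate corepresentation of $(A,\Delta)$ on $B$, and $\pi_{(\iota\odot\theta)(U)}=\theta$; 3. consequently $\theta\mapsto(\iota\odot\theta)(U)$ is a bijection from the non-degenerate homomorphisms $\hat A\to M(B)$ onto the non-degenerate corepresentations of $(A,\Delta)$ on $B$. -/

import Mathlib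

open scoped TensorProduct

set_option linter.unusedSectionVars false

namespace AQG

section Multipliers

/-- `A` is non-degenerate: `a b = 0` for all `b` implies `a = 0`, and `b a = 0` for all `b`
implies `a = 0`. -/
class NondegenerateAlgebra (A : Type*) [NonUnitalRing A] : Prop where
  left_faithful : ∀ a : A, (∀ b : A, a * b = 0) → a = 0
  right_faithful : ∀ a : A, (∀ b : A, b * a = 0) → a = 0

variable (A : Type*) [NonUnitalRing A] [Module ℂ A] [IsScalarTower ℂ A A] [SMulCommClass ℂ A A]

/-- The multiplier algebra: pairs `(L, R)` of a left and a right multiplier with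
`x (L y) = (R x) y`. The product is `(L₁ ∘ L₂, R₂ ∘ R₁)`. -/
def multiplierAlgebra : Subalgebra ℂ (Module.End ℂ A × (Module.End ℂ A)ᵐᵒᵖ) where
  carrier := {T | (∀ x y, T.1 (x * y) = T.1 x * y) ∧
    (∀ x y, T.2.unop (x * y) = x * T.2.unop y) ∧ ∀ x y, x * T.1 y = T.2.unop x * y}
  mul_mem' := by
    rintro S T ⟨h1, h2, h3⟩ ⟨k1, k2, k3⟩
    refine ⟨fun x y => ?_, fun x y => ?_, fun x y => ?_⟩
    · simp [k1, h1]
    · simp [k2, h2]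
    · simp [k3, h3]
  add_mem' := by
    rintro S T ⟨h1, h2, h3⟩ ⟨k1, k2, k3⟩
    refine ⟨fun x y => ?_, fun x y => ?_, fun x y => ?_⟩
    · simp [k1, h1, add_mul]
    · simp [k2, h2, mul_add]
    · simp [k3, h3, add_mul, mul_add]
  algebraMap_mem' := by
    intro c
    refine ⟨fun x y => ?_, fun x y => ?_, fun x y => ?_⟩ <;>
    simp [Prod.algebraMap_apply, MulOpposite.algebraMap_apply, Module.algebraMap_end_apply,
        smul_mul_assoc, mul_smul_comm]

/-- `M(A)`. -/
abbrev Multiplier : Type _ := ↥(multiplierAlgebra A)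

variable {A}

namespace Multiplier

/-- `T.left x` is `T x`. -/
def left (T : Multiplier A) : A →ₗ[ℂ] A := T.1.1

/-- `T.right x` is `x T`. -/
def right (T : Multiplier A) : A →ₗ[ℂ] A := T.1.2.unop

/-- The multiplier with the given left and right actions. -/
def mk (L R : A →ₗ[ℂ] A) (hL : ∀ x y, L (x * y) = L x * y) (hR : ∀ x y, R (x * y) = x * R y)
    (h : ∀ x y, x * L y = R x * y) : Multiplier A :=
  ⟨(L, MulOpposite.op R), hL, hR, h⟩

@[simp] lemma left_mk (L R : A →ₗ[ℂ] A) (hL hR h) : (mk L R hL hR h).left = L := rfl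
@[simp] lemma right_mk (L R : A →ₗ[ℂ] A) (hL hR h) : (mk L R hL hR h).right = R := rfl

lemma left_mul' (T : Multiplier A) (x y : A) : T.left (x * y) = T.left x * y := T.2.1 x y
lemma right_mul' (T : Multiplier A) (x y : A) : T.right (x * y) = x * T.right y := T.2.2.1 x y
lemma mul_left_eq (T : Multiplier A) (x y : A) : x * T.left y = T.right x * y := T.2.2.2 x y

@[simp] lemma mul_left_apply (S T : Multiplier A) (x : A) :
    (S * T).left x = S.left (T.left x) := rfl
@[simp] lemma mul_right_apply (S T : Multiplier A) (x : A) :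
    (S * T).right x = T.right (S.right x) := rfl
@[simp] lemma one_left : (1 : Multiplier A).left = LinearMap.id := rfl
@[simp] lemma one_right : (1 : Multiplier A).right = LinearMap.id := rfl
@[simp] lemma add_left (S T : Multiplier A) : (S + T).left = S.left + T.left := rfl
@[simp] lemma add_right (S T : Multiplier A) : (S + T).right = S.right + T.right := rfl
@[simp] lemma smul_left (c : ℂ) (T : Multiplier A) : (c • T).left = c • T.left := rfl
@[simp] lemma smul_right (c : ℂ) (T : Multiplier A) : (c • T).right = c • T.right := rfl
@[simp] lemma zero_left : (0 : Multiplier A).left = 0 := rfl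
@[simp] lemma zero_right : (0 : Multiplier A).right = 0 := rfl

lemma ext_both {S T : Multiplier A} (h : S.left = T.left) (h' : S.right = T.right) : S = T :=
  Subtype.ext (Prod.ext h (MulOpposite.unop_injective h'))

lemma ext_left [NondegenerateAlgebra A] {S T : Multiplier A}
    (h : ∀ x, S.left x = T.left x) : S = T := by
  refine ext_both (LinearMap.ext h) (LinearMap.ext fun x => ?_)
  refine sub_eq_zero.1 (NondegenerateAlgebra.left_faithful _ fun y => ?_)
  rw [sub_mul, ← mul_left_eq, ← mul_left_eq, h, sub_self]

lemma ext_right [NondegenerateAlgebra A] {S T : Multiplier A}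
    (h : ∀ x, S.right x = T.right x) : S = T := by
  refine ext_both (LinearMap.ext fun x => ?_) (LinearMap.ext h)
  refine sub_eq_zero.1 (NondegenerateAlgebra.right_faithful _ fun y => ?_)
  rw [mul_sub, mul_left_eq, mul_left_eq, h, sub_self]

/-- Over a non-degenerate algebra, compatibility of `L` and `R` is enough. -/
def ofCompat [NondegenerateAlgebra A] (L R : A →ₗ[ℂ] A) (h : ∀ x y, x * L y = R x * y) :
    Multiplier A :=
  mk L R
    (fun x y => sub_eq_zero.1 (NondegenerateAlgebra.right_faithful _ fun z => by
      rw [mul_sub, h, ← mul_assoc, ← mul_assoc, h, sub_self]))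
    (fun x y => sub_eq_zero.1 (NondegenerateAlgebra.left_faithful _ fun z => by
      rw [sub_mul, ← h, mul_assoc, mul_assoc, h, sub_self]))
    h

variable (A) in
/-- The canonical map of `A` into `M(A)`. -/
def embed : A →ₙₐ[ℂ] Multiplier A where
  toFun a := mk (LinearMap.mulLeft ℂ a) (LinearMap.mulRight ℂ a)
    (fun x y => by simp [mul_assoc]) (fun x y => by simp [mul_assoc])
    (fun x y => by simp [mul_assoc])
  map_smul' c a := ext_both (LinearMap.ext fun x => smul_mul_assoc c a x)
    (LinearMap.ext fun x => mul_smul_comm c x a)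
  map_zero' := ext_both (LinearMap.ext fun x => zero_mul x) (LinearMap.ext fun x => mul_zero x)
  map_add' a b := ext_both (LinearMap.ext fun x => add_mul a b x)
    (LinearMap.ext fun x => mul_add x a b)
  map_mul' a b := ext_both (LinearMap.ext fun x => mul_assoc a b x)
    (LinearMap.ext fun x => (mul_assoc x a b).symm)

@[simp] lemma embed_left (a x : A) : (embed A a).left x = a * x := rfl
@[simp] lemma embed_right (a x : A) : (embed A a).right x = x * a := rfl

lemma embed_injective [NondegenerateAlgebra A] : Function.Injective (embed A) := by
  intro a b h
  refine sub_eq_zero.1 (NondegenerateAlgebra.left_faithful _ fun y => ?_)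
  have := congrArg (fun T => Multiplier.left T y) h
  simp only [embed_left] at this
  rw [sub_mul, this, sub_self]

lemma tensor_induction₂ {A B C D : Type*} [AddCommMonoid A] [Module ℂ A] [AddCommMonoid B]
    [Module ℂ B] [AddCommMonoid C] [Module ℂ C] [AddCommMonoid D] [Module ℂ D]
    {p : A ⊗[ℂ] B → C ⊗[ℂ] D → Prop}
    (h : ∀ a b a' b', p (a ⊗ₜ b) (a' ⊗ₜ b')) (h0 : ∀ x, p 0 x) (h0' : ∀ x, p x 0)
    (hadd : ∀ x y z, p x z → p y z → p (x + y) z) (hadd' : ∀ x y z, p z x → p z y → p z (x + y))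
    (x y) : p x y := by
  induction x with
  | zero => exact h0 _
  | add x x' hx hx' => exact hadd _ _ _ hx hx'
  | tmul a b =>
    induction y with
    | zero => exact h0' _
    | add y y' hy hy' => exact hadd' _ _ _ hy hy'
    | tmul a' b' => exact h a b a' b'

variable {B : Type*} [NonUnitalRing B] [Module ℂ B] [IsScalarTower ℂ B B] [SMulCommClass ℂ B B]

/-- `S ⊗ T` as an element of `M(A ⊙ B)`. -/
def tmul (S : Multiplier A) (T : Multiplier B) : Multiplier (A ⊗[ℂ] B) :=
  mk (TensorProduct.map S.left T.left) (TensorProduct.map S.right T.right)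
    (tensor_induction₂ (fun a b a' b' => by simp [left_mul'])
      (by simp) (by simp) (by intro x y z h h'; simp [add_mul, h, h'])
      (by intro x y z h h'; simp [mul_add, h, h']))
    (tensor_induction₂ (fun a b a' b' => by simp [right_mul'])
      (by simp) (by simp) (by intro x y z h h'; simp [add_mul, h, h'])
      (by intro x y z h h'; simp [mul_add, h, h']))
    (tensor_induction₂ (fun a b a' b' => by simp [mul_left_eq])
      (by simp) (by simp) (by intro x y z h h'; simp [add_mul, h, h'])
      (by intro x y z h h'; simp [mul_add, h, h']))

@[simp] lemma tmul_left (S : Multiplier A) (T : Multiplier B) :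
    (tmul S T).left = TensorProduct.map S.left T.left := rfl
@[simp] lemma tmul_right (S : Multiplier A) (T : Multiplier B) :
    (tmul S T).right = TensorProduct.map S.right T.right := rfl

/-- Transport of multipliers along a multiplicative linear isomorphism. -/
def transport (e : A ≃ₗ[ℂ] B) (he : ∀ x y, e (x * y) = e x * e y) (T : Multiplier A) :
    Multiplier B :=
  have hs : ∀ x y, e.symm (x * y) = e.symm x * e.symm y := fun x y =>
    e.injective (by simp [he])
  mk (e.toLinearMap ∘ₗ T.left ∘ₗ e.symm.toLinearMap) (e.toLinearMap ∘ₗ T.right ∘ₗ e.symm.toLinearMap)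
    (fun x y => by simp [hs, he, left_mul']) (fun x y => by simp [hs, he, right_mul'])
    (fun x y => by
      have := congrArg e (T.mul_left_eq (e.symm x) (e.symm y))
      simpa [he] using this)

@[simp] lemma transport_left (e : A ≃ₗ[ℂ] B) (he) (T : Multiplier A) (x : B) :
    (transport e he T).left x = e (T.left (e.symm x)) := rfl
@[simp] lemma transport_right (e : A ≃ₗ[ℂ] B) (he) (T : Multiplier A) (x : B) :
    (transport e he T).right x = e (T.right (e.symm x)) := rfl

end Multiplier

end Multipliers

section TensorProducts

variable {A B C : Type*}
  [NonUnitalRing A] [Module ℂ A] [IsScalarTower ℂ A A] [SMulCommClass ℂ A A]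
  [NonUnitalRing B] [Module ℂ B] [IsScalarTower ℂ B B] [SMulCommClass ℂ B B]
  [NonUnitalRing C] [Module ℂ C] [IsScalarTower ℂ C C] [SMulCommClass ℂ C C]

lemma comm_mul (x y : A ⊗[ℂ] B) : TensorProduct.comm ℂ A B (x * y) =
    TensorProduct.comm ℂ A B x * TensorProduct.comm ℂ A B y := by
  revert x y
  exact Multiplier.tensor_induction₂ (fun a b a' b' => by simp)
      (by simp) (by simp) (by intro x y z h h'; simp [add_mul, h, h'])
      (by intro x y z h h'; simp [mul_add, h, h'])

lemma assoc_mul (x y : (A ⊗[ℂ] B) ⊗[ℂ] C) : TensorProduct.assoc ℂ A B C (x * y) =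
    TensorProduct.assoc ℂ A B C x * TensorProduct.assoc ℂ A B C y := by
  revert x y
  refine Multiplier.tensor_induction₂ (fun a b a' b' => ?_)
      (by simp) (by simp) (by intro x y z h h'; simp [add_mul, h, h'])
      (by intro x y z h h'; simp [mul_add, h, h'])
  revert a a'
  intro a a'
  refine Multiplier.tensor_induction₂
    (p := fun a a' => TensorProduct.assoc ℂ A B C ((a ⊗ₜ b) * (a' ⊗ₜ b')) =
      TensorProduct.assoc ℂ A B C (a ⊗ₜ b) * TensorProduct.assoc ℂ A B C (a' ⊗ₜ b'))
    (fun a b a' b' => by simp)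
      (by simp) (by simp) (by intro x y z h h'; simp only [TensorProduct.add_tmul, map_add, add_mul, h, h'])
      (by intro x y z h h'; simp only [TensorProduct.add_tmul, map_add, mul_add, h, h']) a a'

lemma leftComm_mul (x y : A ⊗[ℂ] (B ⊗[ℂ] C)) : TensorProduct.leftComm ℂ A B C (x * y) =
    TensorProduct.leftComm ℂ A B C x * TensorProduct.leftComm ℂ A B C y := by
  revert x y
  refine Multiplier.tensor_induction₂ (fun a b a' b' => ?_)
      (by simp) (by simp) (by intro x y z h h'; simp [add_mul, h, h'])
      (by intro x y z h h'; simp [mul_add, h, h'])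
  refine Multiplier.tensor_induction₂
    (p := fun b b' => TensorProduct.leftComm ℂ A B C ((a ⊗ₜ b) * (a' ⊗ₜ b')) =
      TensorProduct.leftComm ℂ A B C (a ⊗ₜ b) * TensorProduct.leftComm ℂ A B C (a' ⊗ₜ b'))
    (fun a b a' b' => by simp)
      (by simp) (by simp) (by intro x y z h h'; simp only [TensorProduct.tmul_add, map_add, add_mul, h, h'])
      (by intro x y z h h'; simp only [TensorProduct.tmul_add, map_add, mul_add, h, h']) b b'

lemma eq_zero_of_lTensor (x : A ⊗[ℂ] B) {ι : Type*} (f : ι → B →ₗ[ℂ] B)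
    (hf : ∀ b, (∀ i, f i b = 0) → b = 0) (hx : ∀ i, (f i).lTensor A x = 0) : x = 0 := by
  classical
  let bA := Module.Basis.ofVectorSpace ℂ A
  let e := TensorProduct.equivFinsuppOfBasisLeft (N := B) bA
  have key : ∀ (g : B →ₗ[ℂ] B) (y : A ⊗[ℂ] B) j, e (g.lTensor A y) j = g (e y j) := by
    intro g y j
    induction y with
    | zero => simp
    | add y z hy hz => simp [hy, hz]
    | tmul a b => simp [e]
  apply e.injective
  rw [map_zero]
  ext j
  exact hf _ fun i => by rw [← key, hx, map_zero]; rfl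

lemma eq_zero_of_rTensor (x : A ⊗[ℂ] B) {ι : Type*} (f : ι → A →ₗ[ℂ] A)
    (hf : ∀ b, (∀ i, f i b = 0) → b = 0) (hx : ∀ i, (f i).rTensor B x = 0) : x = 0 := by
  apply (TensorProduct.comm ℂ A B).injective
  rw [map_zero]
  refine eq_zero_of_lTensor _ f hf fun i => ?_
  rw [← LinearMap.comm_comp_rTensor_comp_comm_eq]
  simp [hx]

/-- The tensor product of non-degenerate algebras is non-degenerate. -/
instance [NondegenerateAlgebra A] [NondegenerateAlgebra B] :
    NondegenerateAlgebra (A ⊗[ℂ] B) where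
  left_faithful x hx := by
    refine eq_zero_of_lTensor x (fun b : B => LinearMap.mulRight ℂ b)
      (fun b hb => NondegenerateAlgebra.left_faithful b hb) fun b => ?_
    refine eq_zero_of_rTensor _ (fun a : A => LinearMap.mulRight ℂ a)
      (fun a ha => NondegenerateAlgebra.left_faithful a ha) fun a => ?_
    have : ∀ y : A ⊗[ℂ] B, (LinearMap.mulRight ℂ a).rTensor B
        ((LinearMap.mulRight ℂ b).lTensor A y) = y * (a ⊗ₜ b) := fun y => by
      induction y with
      | zero => simp
      | add y z hy hz => simp [hy, hz, add_mul]
      | tmul c d => simp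
    rw [this, hx]
  right_faithful x hx := by
    refine eq_zero_of_lTensor x (fun b : B => LinearMap.mulLeft ℂ b)
      (fun b hb => NondegenerateAlgebra.right_faithful b hb) fun b => ?_
    refine eq_zero_of_rTensor _ (fun a : A => LinearMap.mulLeft ℂ a)
      (fun a ha => NondegenerateAlgebra.right_faithful a ha) fun a => ?_
    have : ∀ y : A ⊗[ℂ] B, (LinearMap.mulLeft ℂ a).rTensor B
        ((LinearMap.mulLeft ℂ b).lTensor A y) = (a ⊗ₜ b) * y := fun y => by
      induction y with
      | zero => simp
      | add y z hy hz => simp [hy, hz, mul_add]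
      | tmul c d => simp
    rw [this, hx]

end TensorProducts

section Homomorphisms

variable (A B : Type*)
  [NonUnitalRing A] [Module ℂ A] [IsScalarTower ℂ A A] [SMulCommClass ℂ A A]
  [NonUnitalRing B] [Module ℂ B] [IsScalarTower ℂ B B] [SMulCommClass ℂ B B]

/-- Non-degenerate homomorphisms `π : A → M(B)`: multiplicative linear maps for which the vector
spaces `π(A) B` and `B π(A)` (linear spans of the products) are equal to `B`. -/
structure NondegHom where
  toHom : A →ₙₐ[ℂ] Multiplier B
  span_left : Submodule.span ℂ {x : B | ∃ a b, x = (toHom a).left b} = ⊤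
  span_right : Submodule.span ℂ {x : B | ∃ a b, x = (toHom a).right b} = ⊤

instance : CoeFun (NondegHom A B) (fun _ => A → Multiplier B) := ⟨fun π => π.toHom⟩

variable {A B}

namespace NondegHom

/-- `d ↦ π(d) e` as a linear map. -/
def actLeft (π : NondegHom A B) (e : B) : A →ₗ[ℂ] B where
  toFun d := (π d).left e
  map_add' x y := by simp
  map_smul' c x := by simp

/-- `d ↦ e π(d)` as a linear map. -/
def actRight (π : NondegHom A B) (e : B) : A →ₗ[ℂ] B where
  toFun d := (π d).right e
  map_add' x y := by simp
  map_smul' c x := by simp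

@[simp] lemma actLeft_apply (π : NondegHom A B) (e : B) (d : A) :
    π.actLeft e d = (π d).left e := rfl
@[simp] lemma actRight_apply (π : NondegHom A B) (e : B) (d : A) :
    π.actRight e d = (π d).right e := rfl

variable (π : NondegHom A B)
variable (C : Type*) [NonUnitalRing C] [Module ℂ C] [IsScalarTower ℂ C C] [SMulCommClass ℂ C C]

/-- `(d ⊗ c) ⊗ e ↦ π(d) e ⊗ c`. -/
def mulMap : (A ⊗[ℂ] C) ⊗[ℂ] B →ₗ[ℂ] B ⊗[ℂ] C :=
  TensorProduct.lift (LinearMap.mk₂ ℂ (fun x e => (π.actLeft e).rTensor C x)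
    (by simp) (by simp)
    (by
      intro x e e'
      have : π.actLeft (e + e') = π.actLeft e + π.actLeft e' := by ext; simp
      simp [this, LinearMap.rTensor_add])
    (by
      intro c x e
      have : π.actLeft (c • e) = c • π.actLeft e := by ext; simp
      simp [this, LinearMap.rTensor_smul]))

/-- `(d ⊗ c) ⊗ e ↦ e π(d) ⊗ c`. -/
def mulMap' : (A ⊗[ℂ] C) ⊗[ℂ] B →ₗ[ℂ] B ⊗[ℂ] C :=
  TensorProduct.lift (LinearMap.mk₂ ℂ (fun x e => (π.actRight e).rTensor C x)
    (by simp) (by simp)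
    (by
      intro x e e'
      have : π.actRight (e + e') = π.actRight e + π.actRight e' := by ext; simp
      simp [this, LinearMap.rTensor_add])
    (by
      intro c x e
      have : π.actRight (c • e) = c • π.actRight e := by ext; simp
      simp [this, LinearMap.rTensor_smul]))

@[simp] lemma mulMap_tmul (x : A ⊗[ℂ] C) (e : B) :
    π.mulMap C (x ⊗ₜ e) = (π.actLeft e).rTensor C x := rfl
@[simp] lemma mulMap'_tmul (x : A ⊗[ℂ] C) (e : B) :
    π.mulMap' C (x ⊗ₜ e) = (π.actRight e).rTensor C x := rfl

lemma mulMap_surjective : Function.Surjective (π.mulMap C) := by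
  rw [← LinearMap.range_eq_top, eq_top_iff, ← TensorProduct.span_tmul_eq_top, Submodule.span_le]
  rintro _ ⟨b, c, rfl⟩
  have hb : b ∈ (⊤ : Submodule ℂ B) := trivial
  rw [← π.span_left] at hb
  induction hb using Submodule.span_induction with
  | mem x hx =>
    obtain ⟨a, e, rfl⟩ := hx
    exact ⟨(a ⊗ₜ c) ⊗ₜ e, by simp⟩
  | zero => simp
  | add x y _ _ hx hy => rw [TensorProduct.add_tmul]; exact Submodule.add_mem _ hx hy
  | smul t x _ hx => rw [← TensorProduct.smul_tmul']; exact Submodule.smul_mem _ _ hx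

lemma mulMap'_surjective : Function.Surjective (π.mulMap' C) := by
  rw [← LinearMap.range_eq_top, eq_top_iff, ← TensorProduct.span_tmul_eq_top, Submodule.span_le]
  rintro _ ⟨b, c, rfl⟩
  have hb : b ∈ (⊤ : Submodule ℂ B) := trivial
  rw [← π.span_right] at hb
  induction hb using Submodule.span_induction with
  | mem x hx =>
    obtain ⟨a, e, rfl⟩ := hx
    exact ⟨(a ⊗ₜ c) ⊗ₜ e, by simp⟩
  | zero => simp
  | add x y _ _ hx hy => rw [TensorProduct.add_tmul]; exact Submodule.add_mem _ hx hy
  | smul t x _ hx => rw [← TensorProduct.smul_tmul']; exact Submodule.smul_mem _ _ hx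

variable {C}

lemma mul_actRight_actLeft (V : Multiplier (A ⊗[ℂ] C)) (e f : B) (x y : A ⊗[ℂ] C) :
    (π.actRight e).rTensor C y * (π.actLeft f).rTensor C (V.left x) =
      (π.actRight e).rTensor C (V.right y) * (π.actLeft f).rTensor C x := by
  have key : ∀ y x : A ⊗[ℂ] C, (π.actRight e).rTensor C y * (π.actLeft f).rTensor C x =
      ((LinearMap.mulLeft ℂ e ∘ₗ π.actLeft f).rTensor C (y * x)) :=
    Multiplier.tensor_induction₂
      (by intro a c a' c'; simp [← Multiplier.mul_left_eq])
      (by simp) (by simp) (by intro x y z h h'; simp_all [add_mul])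
      (by intro x y z h h'; simp_all [mul_add])
  rw [key, key, V.mul_left_eq]

lemma eq_zero_of_mulMap' [NondegenerateAlgebra B] [NondegenerateAlgebra C] (w : B ⊗[ℂ] C)
    (h : ∀ e y, (π.actRight e).rTensor C y * w = 0) : w = 0 := by
  refine NondegenerateAlgebra.right_faithful w fun z => ?_
  obtain ⟨z, rfl⟩ := π.mulMap'_surjective C z
  induction z with
  | zero => simp
  | add x y hx hy => simp [add_mul, hx, hy]
  | tmul y e => simpa using h e y

lemma eq_zero_of_mulMap [NondegenerateAlgebra B] [NondegenerateAlgebra C] (w : B ⊗[ℂ] C)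
    (h : ∀ e y, w * (π.actLeft e).rTensor C y = 0) : w = 0 := by
  refine NondegenerateAlgebra.left_faithful w fun z => ?_
  obtain ⟨z, rfl⟩ := π.mulMap_surjective C z
  induction z with
  | zero => simp
  | add x y hx hy => simp [mul_add, hx, hy]
  | tmul y e => simpa using h e y

variable [NondegenerateAlgebra B] [NondegenerateAlgebra C]

lemma exists_left (V : Multiplier (A ⊗[ℂ] C)) : ∃ L : B ⊗[ℂ] C →ₗ[ℂ] B ⊗[ℂ] C,
    ∀ e x, L ((π.actLeft e).rTensor C x) = (π.actLeft e).rTensor C (V.left x) := by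
  obtain ⟨s, hs⟩ := (π.mulMap C).exists_rightInverse_of_surjective
    (LinearMap.range_eq_top.2 (π.mulMap_surjective C))
  have hker : ∀ z, π.mulMap C z = 0 → π.mulMap C (V.left.rTensor B z) = 0 := by
    intro z hz
    refine π.eq_zero_of_mulMap' _ fun e y => ?_
    have : ∀ z, (π.actRight e).rTensor C y * π.mulMap C (V.left.rTensor B z) =
        (π.actRight e).rTensor C (V.right y) * π.mulMap C z := by
      intro z
      induction z with
      | zero => simp
      | add x y hx hy => simp [mul_add, hx, hy]
      | tmul x f => simp [mul_actRight_actLeft]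
    rw [this, hz, mul_zero]
  refine ⟨π.mulMap C ∘ₗ V.left.rTensor B ∘ₗ s, fun e x => ?_⟩
  have h1 := hker (s (π.mulMap C (x ⊗ₜ e)) - x ⊗ₜ e) (by
    rw [map_sub, sub_eq_zero]; exact LinearMap.congr_fun hs _)
  rw [map_sub, map_sub, sub_eq_zero] at h1
  simpa using h1

lemma exists_right (V : Multiplier (A ⊗[ℂ] C)) : ∃ R : B ⊗[ℂ] C →ₗ[ℂ] B ⊗[ℂ] C,
    ∀ e x, R ((π.actRight e).rTensor C x) = (π.actRight e).rTensor C (V.right x) := by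
  obtain ⟨s, hs⟩ := (π.mulMap' C).exists_rightInverse_of_surjective
    (LinearMap.range_eq_top.2 (π.mulMap'_surjective C))
  have hker : ∀ z, π.mulMap' C z = 0 → π.mulMap' C (V.right.rTensor B z) = 0 := by
    intro z hz
    refine π.eq_zero_of_mulMap _ fun e y => ?_
    have : ∀ z, π.mulMap' C (V.right.rTensor B z) * (π.actLeft e).rTensor C y =
        π.mulMap' C z * (π.actLeft e).rTensor C (V.left y) := by
      intro z
      induction z with
      | zero => simp
      | add x y hx hy => simp [add_mul, hx, hy]
      | tmul x f => simp [mul_actRight_actLeft]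
    rw [this, hz, zero_mul]
  refine ⟨π.mulMap' C ∘ₗ V.right.rTensor B ∘ₗ s, fun e x => ?_⟩
  have h1 := hker (s (π.mulMap' C (x ⊗ₜ e)) - x ⊗ₜ e) (by
    rw [map_sub, sub_eq_zero]; exact LinearMap.congr_fun hs _)
  rw [map_sub, map_sub, sub_eq_zero] at h1
  simpa using h1

/-- For every `V ∈ M(A ⊙ C)` there is exactly one multiplier `T = (π ⊙ ι)(V)` of `B ⊙ C` with
`T (π(d) e ⊗ c) = (π ⊙ ι)(V (d ⊗ c)) (e ⊗ 1)` and
`(e π(d) ⊗ c) T = (e ⊗ 1) (π ⊙ ι)((d ⊗ c) V)`. -/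
theorem existsUnique_amplify (V : Multiplier (A ⊗[ℂ] C)) : ∃! T : Multiplier (B ⊗[ℂ] C),
    (∀ e x, T.left ((π.actLeft e).rTensor C x) = (π.actLeft e).rTensor C (V.left x)) ∧
    (∀ e x, T.right ((π.actRight e).rTensor C x) = (π.actRight e).rTensor C (V.right x)) := by
  obtain ⟨L, hL⟩ := π.exists_left V
  obtain ⟨R, hR⟩ := π.exists_right V
  refine ⟨Multiplier.ofCompat L R fun x y => ?_, ⟨hL, hR⟩, fun T hT => Multiplier.ext_left fun x => ?_⟩
  · obtain ⟨x, rfl⟩ := π.mulMap'_surjective C x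
    obtain ⟨y, rfl⟩ := π.mulMap_surjective C y
    revert x y
    refine Multiplier.tensor_induction₂ ?_ ?_ ?_ ?_ ?_
    · intro x e y f
      simp [hL, hR, mul_actRight_actLeft]
    · simp
    · simp
    · intro x y z h h'; simp [add_mul, h, h']
    · intro x y z h h'; simp [mul_add, h, h']
  · obtain ⟨x, rfl⟩ := π.mulMap_surjective C x
    change _ = L _
    induction x with
    | zero => simp
    | add x y hx hy => simp [hx, hy]
    | tmul y e => simp [hT.1, hL]

variable (C) in
/-- The extension of `π ⊙ ι` to multipliers, `M(A ⊙ C) → M(B ⊙ C)`. -/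
noncomputable def amplify (V : Multiplier (A ⊗[ℂ] C)) : Multiplier (B ⊗[ℂ] C) :=
  (π.existsUnique_amplify V).choose

lemma amplify_left (V : Multiplier (A ⊗[ℂ] C)) (e x) :
    (π.amplify C V).left ((π.actLeft e).rTensor C x) = (π.actLeft e).rTensor C (V.left x) :=
  (π.existsUnique_amplify V).choose_spec.1.1 e x

lemma amplify_right (V : Multiplier (A ⊗[ℂ] C)) (e x) :
    (π.amplify C V).right ((π.actRight e).rTensor C x) = (π.actRight e).rTensor C (V.right x) :=
  (π.existsUnique_amplify V).choose_spec.1.2 e x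

variable (C) in
/-- The extension of `ι ⊙ π` to multipliers, `M(C ⊙ A) → M(C ⊙ B)`, that is `χ (π ⊙ ι) χ` with
the flip `χ`. -/
noncomputable def coamplify (V : Multiplier (C ⊗[ℂ] A)) : Multiplier (C ⊗[ℂ] B) :=
  (π.amplify C (V.transport (TensorProduct.comm ℂ C A) comm_mul)).transport
    (TensorProduct.comm ℂ B C) comm_mul

/-- On `A ⊙ C` the extension is the usual `π ⊙ ι`. -/
lemma amplify_embed_tmul (a : A) (c : C) :
    π.amplify C (Multiplier.embed (A ⊗[ℂ] C) (a ⊗ₜ c)) = Multiplier.tmul (π a) (Multiplier.embed C c) := by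
  refine Multiplier.ext_left fun x => ?_
  obtain ⟨x, rfl⟩ := π.mulMap_surjective C x
  induction x with
  | zero => simp
  | add x y hx hy => simp only [map_add, hx, hy]
  | tmul y e =>
    simp only [mulMap_tmul, amplify_left]
    induction y with
    | zero => simp
    | add x y hx hy => simp only [map_add, hx, hy]
    | tmul d c' => simp

end NondegHom

end Homomorphisms


section QuantumGroups

open Multiplier

/-- `(ι ⊙ ω)` on `A ⊙ B`. -/
noncomputable def sliceSnd {A B : Type*} [AddCommGroup A] [Module ℂ A] [AddCommGroup B] [Module ℂ B]
    (ω : B →ₗ[ℂ] ℂ) : A ⊗[ℂ] B →ₗ[ℂ] A :=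
  (TensorProduct.rid ℂ A).toLinearMap ∘ₗ ω.lTensor A

/-- `(ω ⊙ ι)` on `A ⊙ B`. -/
noncomputable def sliceFst {A B : Type*} [AddCommGroup A] [Module ℂ A] [AddCommGroup B] [Module ℂ B]
    (ω : A →ₗ[ℂ] ℂ) : A ⊗[ℂ] B →ₗ[ℂ] B :=
  (TensorProduct.lid ℂ B).toLinearMap ∘ₗ ω.rTensor B

@[simp] lemma sliceSnd_tmul {A B : Type*} [AddCommGroup A] [Module ℂ A] [AddCommGroup B]
    [Module ℂ B] (ω : B →ₗ[ℂ] ℂ) (a : A) (b : B) : sliceSnd ω (a ⊗ₜ[ℂ] b) = ω b • a := by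
  simp [sliceSnd]

@[simp] lemma sliceFst_tmul {A B : Type*} [AddCommGroup A] [Module ℂ A] [AddCommGroup B]
    [Module ℂ B] (ω : A →ₗ[ℂ] ℂ) (a : A) (b : B) : sliceFst ω (a ⊗ₜ[ℂ] b) = ω a • b := by
  simp [sliceFst]

variable (A : Type*)
  [NonUnitalRing A] [Module ℂ A] [IsScalarTower ℂ A A] [SMulCommClass ℂ A A]
  [NondegenerateAlgebra A]

/-- A regular multiplier Hopf algebra structure on the non-degenerate algebra `A`: a coassociative
non-degenerate homomorphism `Δ : A → M(A ⊙ A)` such that the maps `a ⊗ b ↦ Δ(a)(b ⊗ 1)`,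
`Δ(a)(1 ⊗ b)`, `(b ⊗ 1)Δ(a)`, `(1 ⊗ b)Δ(a)` are bijections from `A ⊙ A` to `A ⊙ A ⊆ M(A ⊙ A)`. -/
structure RegularMultiplierHopf where
  Δ : NondegHom A (A ⊗[ℂ] A)
  coassoc : ∀ a, (Δ.amplify A (Δ a)).transport (TensorProduct.assoc ℂ A A A) assoc_mul =
    Δ.coamplify A (Δ a)
  T₁ : A ⊗[ℂ] A ≃ₗ[ℂ] A ⊗[ℂ] A
  T₂ : A ⊗[ℂ] A ≃ₗ[ℂ] A ⊗[ℂ] A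
  T₃ : A ⊗[ℂ] A ≃ₗ[ℂ] A ⊗[ℂ] A
  T₄ : A ⊗[ℂ] A ≃ₗ[ℂ] A ⊗[ℂ] A
  T₁_spec : ∀ a b, embed (A ⊗[ℂ] A) (T₁ (a ⊗ₜ b)) = Δ a * tmul (embed A b) 1
  T₂_spec : ∀ a b, embed (A ⊗[ℂ] A) (T₂ (a ⊗ₜ b)) = Δ a * tmul 1 (embed A b)
  T₃_spec : ∀ a b, embed (A ⊗[ℂ] A) (T₃ (a ⊗ₜ b)) = tmul (embed A b) 1 * Δ a
  T₄_spec : ∀ a b, embed (A ⊗[ℂ] A) (T₄ (a ⊗ₜ b)) = tmul 1 (embed A b) * Δ a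

variable {A}

namespace RegularMultiplierHopf

variable (H : RegularMultiplierHopf A)

lemma T₁_mul (a b : A) (z : A ⊗[ℂ] A) :
    H.T₁ (a ⊗ₜ b) * z = (H.Δ a).left ((LinearMap.mulLeft ℂ b).rTensor A z) := by
  have := congrArg (fun T => Multiplier.left T z) (H.T₁_spec a b)
  exact this

lemma T₂_mul (a b : A) (z : A ⊗[ℂ] A) :
    H.T₂ (a ⊗ₜ b) * z = (H.Δ a).left ((LinearMap.mulLeft ℂ b).lTensor A z) := by
  have := congrArg (fun T => Multiplier.left T z) (H.T₂_spec a b)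
  exact this

lemma T₃_mul (a b : A) (z : A ⊗[ℂ] A) :
    H.T₃ (a ⊗ₜ b) * z = (LinearMap.mulLeft ℂ b).rTensor A ((H.Δ a).left z) := by
  have := congrArg (fun T => Multiplier.left T z) (H.T₃_spec a b)
  exact this

lemma T₄_mul (a b : A) (z : A ⊗[ℂ] A) :
    H.T₄ (a ⊗ₜ b) * z = (LinearMap.mulLeft ℂ b).lTensor A ((H.Δ a).left z) := by
  have := congrArg (fun T => Multiplier.left T z) (H.T₄_spec a b)
  exact this

lemma mul_T₁ (a b : A) (z : A ⊗[ℂ] A) :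
    z * H.T₁ (a ⊗ₜ b) = (LinearMap.mulRight ℂ b).rTensor A ((H.Δ a).right z) := by
  have := congrArg (fun T => Multiplier.right T z) (H.T₁_spec a b)
  exact this

lemma mul_T₂ (a b : A) (z : A ⊗[ℂ] A) :
    z * H.T₂ (a ⊗ₜ b) = (LinearMap.mulRight ℂ b).lTensor A ((H.Δ a).right z) := by
  have := congrArg (fun T => Multiplier.right T z) (H.T₂_spec a b)
  exact this

lemma mul_T₃ (a b : A) (z : A ⊗[ℂ] A) :
    z * H.T₃ (a ⊗ₜ b) = (H.Δ a).right ((LinearMap.mulRight ℂ b).rTensor A z) := by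
  have := congrArg (fun T => Multiplier.right T z) (H.T₃_spec a b)
  exact this

lemma mul_T₄ (a b : A) (z : A ⊗[ℂ] A) :
    z * H.T₄ (a ⊗ₜ b) = (H.Δ a).right ((LinearMap.mulRight ℂ b).lTensor A z) := by
  have := congrArg (fun T => Multiplier.right T z) (H.T₄_spec a b)
  exact this

lemma ext_mul {x y : A ⊗[ℂ] A} (h : ∀ z, x * z = y * z) : x = y :=
  sub_eq_zero.1 (NondegenerateAlgebra.left_faithful _ fun z => by rw [sub_mul, h, sub_self])

lemma tmul_mul_assoc_fst (x z : A ⊗[ℂ] A) (c : A) :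
    (LinearMap.mulRight ℂ c).rTensor A x * z = x * (LinearMap.mulLeft ℂ c).rTensor A z := by
  revert x z
  exact tensor_induction₂ (by intro a b a' b'; simp [mul_assoc]) (by simp) (by simp)
    (by intro x y z h h'; simp [add_mul, h, h']) (by intro x y z h h'; simp [mul_add, h, h'])

lemma tmul_mul_assoc_snd (x z : A ⊗[ℂ] A) (c : A) :
    (LinearMap.mulRight ℂ c).lTensor A x * z = x * (LinearMap.mulLeft ℂ c).lTensor A z := by
  revert x z
  exact tensor_induction₂ (by intro a b a' b'; simp [mul_assoc]) (by simp) (by simp)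
    (by intro x y z h h'; simp [add_mul, h, h']) (by intro x y z h h'; simp [mul_add, h, h'])

lemma mulLeft_rTensor_mul (x z : A ⊗[ℂ] A) (c : A) :
    (LinearMap.mulLeft ℂ c).rTensor A x * z = (LinearMap.mulLeft ℂ c).rTensor A (x * z) := by
  revert x z
  exact tensor_induction₂ (by intro a b a' b'; simp [mul_assoc]) (by simp) (by simp)
    (by intro x y z h h'; simp [add_mul, h, h']) (by intro x y z h h'; simp [mul_add, h, h'])

lemma mulLeft_lTensor_mul (x z : A ⊗[ℂ] A) (c : A) :
    (LinearMap.mulLeft ℂ c).lTensor A x * z = (LinearMap.mulLeft ℂ c).lTensor A (x * z) := by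
  revert x z
  exact tensor_induction₂ (by intro a b a' b'; simp [mul_assoc]) (by simp) (by simp)
    (by intro x y z h h'; simp [add_mul, h, h']) (by intro x y z h h'; simp [mul_add, h, h'])

lemma rTensor_lTensor (f g : A →ₗ[ℂ] A) (z : A ⊗[ℂ] A) :
    f.rTensor A (g.lTensor A z) = g.lTensor A (f.rTensor A z) := by
  induction z with
  | zero => simp
  | add x y hx hy => simp [hx, hy]
  | tmul a b => simp

/-- `(c ⊗ 1)(Δ(a)(b ⊗ 1)) = ((c ⊗ 1)Δ(a))(b ⊗ 1)`. -/
lemma T₃_T₁ (a b c : A) : (LinearMap.mulRight ℂ b).rTensor A (H.T₃ (a ⊗ₜ c)) =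
    (LinearMap.mulLeft ℂ c).rTensor A (H.T₁ (a ⊗ₜ b)) :=
  ext_mul fun z => by rw [tmul_mul_assoc_fst, T₃_mul, mulLeft_rTensor_mul, T₁_mul]

/-- `(1 ⊗ c)(Δ(a)(b ⊗ 1)) = ((1 ⊗ c)Δ(a))(b ⊗ 1)`. -/
lemma T₄_T₁ (a b c : A) : (LinearMap.mulRight ℂ b).rTensor A (H.T₄ (a ⊗ₜ c)) =
    (LinearMap.mulLeft ℂ c).lTensor A (H.T₁ (a ⊗ₜ b)) :=
  ext_mul fun z => by rw [tmul_mul_assoc_fst, T₄_mul, mulLeft_lTensor_mul, T₁_mul]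

/-- `(c ⊗ 1)(Δ(a)(1 ⊗ b)) = ((c ⊗ 1)Δ(a))(1 ⊗ b)`. -/
lemma T₃_T₂ (a b c : A) : (LinearMap.mulRight ℂ b).lTensor A (H.T₃ (a ⊗ₜ c)) =
    (LinearMap.mulLeft ℂ c).rTensor A (H.T₂ (a ⊗ₜ b)) :=
  ext_mul fun z => by rw [tmul_mul_assoc_snd, T₃_mul, mulLeft_rTensor_mul, T₂_mul]

/-- `(Δ(a)(1 ⊗ c))(b ⊗ 1) = (Δ(a)(b ⊗ 1))(1 ⊗ c)`. -/
lemma T₂_T₁ (a b c : A) : (LinearMap.mulRight ℂ b).rTensor A (H.T₂ (a ⊗ₜ c)) =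
    (LinearMap.mulRight ℂ c).lTensor A (H.T₁ (a ⊗ₜ b)) :=
  ext_mul fun z => by
    rw [tmul_mul_assoc_fst, T₂_mul, tmul_mul_assoc_snd, T₁_mul, rTensor_lTensor]

lemma T₁_mul_left (a a' b : A) : (H.Δ a).left (H.T₁ (a' ⊗ₜ b)) = H.T₁ ((a * a') ⊗ₜ b) :=
  ext_mul fun z => by rw [← left_mul', T₁_mul, T₁_mul, map_mul, mul_left_apply]

lemma sliceSnd_mulRight_rTensor (ω : A →ₗ[ℂ] ℂ) (b : A) (z : A ⊗[ℂ] A) :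
    sliceSnd ω ((LinearMap.mulRight ℂ b).rTensor A z) = sliceSnd ω z * b := by
  induction z with
  | zero => simp
  | add x y hx hy => simp [hx, hy, add_mul]
  | tmul a b => simp [smul_mul_assoc]

lemma sliceSnd_mulLeft_rTensor (ω : A →ₗ[ℂ] ℂ) (b : A) (z : A ⊗[ℂ] A) :
    sliceSnd ω ((LinearMap.mulLeft ℂ b).rTensor A z) = b * sliceSnd ω z := by
  induction z with
  | zero => simp
  | add x y hx hy => simp [hx, hy, mul_add]
  | tmul a b => simp [mul_smul_comm]

lemma sliceSnd_lTensor (ω : A →ₗ[ℂ] ℂ) (f : A →ₗ[ℂ] A) (z : A ⊗[ℂ] A) :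
    sliceSnd ω (f.lTensor A z) = sliceSnd (ω ∘ₗ f) z := by
  induction z with
  | zero => simp
  | add x y hx hy => simp [hx, hy]
  | tmul a b => simp

lemma sliceFst_rTensor {B : Type*} [AddCommGroup B] [Module ℂ B] (ω : A →ₗ[ℂ] ℂ) (f : A →ₗ[ℂ] A)
    (z : A ⊗[ℂ] B) : sliceFst ω (f.rTensor B z) = sliceFst (ω ∘ₗ f) z := by
  induction z with
  | zero => simp
  | add x y hx hy => simp [hx, hy]
  | tmul a b => simp

lemma sliceFst_lTensor {B C : Type*} [AddCommGroup B] [Module ℂ B] [AddCommGroup C] [Module ℂ C]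
    (ω : A →ₗ[ℂ] ℂ) (f : B →ₗ[ℂ] C)
    (z : A ⊗[ℂ] B) : sliceFst ω (f.lTensor A z) = f (sliceFst ω z) := by
  induction z with
  | zero => simp
  | add x y hx hy => simp [hx, hy]
  | tmul a b => simp

/-- `(ι ⊙ ω)Δ(a) ∈ M(A)`: the multiplier with `[(ι ⊙ ω)Δ(a)] b = (ι ⊙ ω)(Δ(a)(b ⊗ 1))` and
`b [(ι ⊙ ω)Δ(a)] = (ι ⊙ ω)((b ⊗ 1)Δ(a))`. -/
noncomputable def sliceΔ (ω : A →ₗ[ℂ] ℂ) (a : A) : Multiplier A :=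
  ofCompat (sliceSnd ω ∘ₗ H.T₁.toLinearMap ∘ₗ TensorProduct.mk ℂ A A a)
    (sliceSnd ω ∘ₗ H.T₃.toLinearMap ∘ₗ TensorProduct.mk ℂ A A a)
    (fun c b => by
      simp only [LinearMap.comp_apply, TensorProduct.mk_apply, LinearEquiv.coe_coe]
      rw [← sliceSnd_mulLeft_rTensor, ← T₃_T₁, sliceSnd_mulRight_rTensor])

@[simp] lemma sliceΔ_left (ω : A →ₗ[ℂ] ℂ) (a b : A) :
    (H.sliceΔ ω a).left b = sliceSnd ω (H.T₁ (a ⊗ₜ b)) := rfl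

@[simp] lemma sliceΔ_right (ω : A →ₗ[ℂ] ℂ) (a b : A) :
    (H.sliceΔ ω a).right b = sliceSnd ω (H.T₃ (a ⊗ₜ b)) := rfl

end RegularMultiplierHopf

/-- A left Haar functional: a non-zero left invariant linear functional on `A`. A regular multiplier
Hopf algebra that has one is an algebraic quantum group. -/
structure LeftHaar (H : RegularMultiplierHopf A) where
  φ : A →ₗ[ℂ] ℂ
  ne_zero : φ ≠ 0
  invariant : ∀ a, H.sliceΔ φ a = φ a • 1

namespace LeftHaar

variable {H : RegularMultiplierHopf A} (h : LeftHaar H)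

/-- `a ↦ a φ`, where `(a φ)(x) = φ(x a)`. -/
def toDual : A →ₗ[ℂ] Module.Dual ℂ A where
  toFun a := h.φ ∘ₗ LinearMap.mulRight ℂ a
  map_add' a b := by ext; simp [mul_add]
  map_smul' c a := by ext; simp [mul_smul_comm]

@[simp] lemma toDual_apply (a x : A) : h.toDual a x = h.φ (x * a) := rfl

/-- The space `Â = {a φ | a ∈ A} ⊆ A'`. -/
def Dual : Type _ := ↥(LinearMap.range h.toDual)

noncomputable instance : AddCommGroup h.Dual := inferInstanceAs (AddCommGroup (LinearMap.range h.toDual))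
noncomputable instance : Module ℂ h.Dual := inferInstanceAs (Module ℂ (LinearMap.range h.toDual))

/-- The functional on `A` underlying an element of `Â`. -/
def Dual.functional : h.Dual →ₗ[ℂ] Module.Dual ℂ A := (LinearMap.range h.toDual).subtype

variable {h}

lemma Dual.functional_injective : Function.Injective (Dual.functional h) :=
  Subtype.val_injective

variable (h) in
/-- The element `a φ` of `Â`. -/
def dualMk : A →ₗ[ℂ] h.Dual := h.toDual.rangeRestrict

@[simp] lemma functional_dualMk (a : A) : Dual.functional h (h.dualMk a) = h.toDual a := rfl

lemma dualMk_surjective : Function.Surjective h.dualMk := h.toDual.surjective_rangeRestrict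

/-- For `ω ∈ Â` the multipliers `(ι ⊙ ω)Δ(x)` belong to `A`. -/
lemma exists_act (ω : h.Dual) : ∃ f : A →ₗ[ℂ] A,
    ∀ x, embed A (f x) = H.sliceΔ (Dual.functional h ω) x := by
  obtain ⟨a, rfl⟩ := dualMk_surjective ω
  refine ⟨sliceSnd h.φ ∘ₗ H.T₂.toLinearMap ∘ₗ (TensorProduct.mk ℂ A A).flip a, fun x => ?_⟩
  refine ext_left fun b => ?_
  simp only [LinearMap.comp_apply, LinearMap.flip_apply, TensorProduct.mk_apply,
    LinearEquiv.coe_coe, embed_left, RegularMultiplierHopf.sliceΔ_left, functional_dualMk]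
  rw [← RegularMultiplierHopf.sliceSnd_mulRight_rTensor, RegularMultiplierHopf.T₂_T₁,
    RegularMultiplierHopf.sliceSnd_lTensor]
  rfl

/-- The element `(ι ⊙ ω)Δ(x)` of `A`, for `ω ∈ Â`. -/
noncomputable def act (ω : h.Dual) : A →ₗ[ℂ] A := (exists_act ω).choose

lemma embed_act (ω : h.Dual) (x : A) : embed A (act ω x) = H.sliceΔ (Dual.functional h ω) x :=
  (exists_act ω).choose_spec x

lemma act_mul (ω : h.Dual) (x b : A) :
    act ω x * b = sliceSnd (Dual.functional h ω) (H.T₁ (x ⊗ₜ b)) :=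
  congrArg (fun T => Multiplier.left T b) (embed_act ω x)

lemma mul_act (ω : h.Dual) (x b : A) :
    b * act ω x = sliceSnd (Dual.functional h ω) (H.T₃ (x ⊗ₜ b)) :=
  congrArg (fun T => Multiplier.right T b) (embed_act ω x)

lemma act_dualMk (a x : A) : act (h.dualMk a) x = sliceSnd h.φ (H.T₂ (x ⊗ₜ a)) := by
  refine embed_injective (ext_left fun b => ?_)
  rw [embed_left, act_mul, embed_left, ← RegularMultiplierHopf.sliceSnd_mulRight_rTensor,
    RegularMultiplierHopf.T₂_T₁, RegularMultiplierHopf.sliceSnd_lTensor]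
  rfl

lemma φ_sliceSnd_T₁ (p q : A) : h.φ (sliceSnd h.φ (H.T₁ (p ⊗ₜ q))) = h.φ p * h.φ q := by
  have := congrArg (fun T => h.φ (Multiplier.left T q)) (h.invariant p)
  simpa using this

lemma φ_act_mul (a₁ a₂ x : A) : h.φ (act (h.dualMk a₂) x * a₁) =
    h.φ (x * sliceSnd h.φ (H.T₁.symm (a₁ ⊗ₜ a₂))) := by
  have h1 : ∀ z, h.φ (sliceSnd h.φ ((H.Δ x).left (H.T₁ z))) = h.φ (x * sliceSnd h.φ z) := by
    intro z
    induction z with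
    | zero => simp
    | add x y hx hy => simp [hx, hy, mul_add]
    | tmul p q =>
      rw [RegularMultiplierHopf.T₁_mul_left, φ_sliceSnd_T₁]
      simp [mul_smul_comm, mul_comm]
  rw [← h1, LinearEquiv.apply_symm_apply, act_dualMk,
    ← RegularMultiplierHopf.sliceSnd_mulRight_rTensor]
  congr 2
  refine RegularMultiplierHopf.ext_mul fun z => ?_
  rw [RegularMultiplierHopf.tmul_mul_assoc_fst, RegularMultiplierHopf.T₂_mul, ← left_mul']
  congr 1
  induction z with
  | zero => simp
  | add x y hx hy => simp [hx, hy, mul_add]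
  | tmul p q => simp

/-- The product of `Â`: `(ω₁ ω₂)(x) = ω₁((ι ⊙ ω₂)Δ(x))`. -/
noncomputable def dualMul (ω₁ ω₂ : h.Dual) : h.Dual :=
  ⟨Dual.functional h ω₁ ∘ₗ act ω₂, by
    obtain ⟨a₁, rfl⟩ := dualMk_surjective ω₁
    obtain ⟨a₂, rfl⟩ := dualMk_surjective ω₂
    exact ⟨sliceSnd h.φ (H.T₁.symm (a₁ ⊗ₜ a₂)), LinearMap.ext fun x => (φ_act_mul a₁ a₂ x).symm⟩⟩

noncomputable instance : Mul h.Dual := ⟨dualMul⟩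

lemma mul_apply (ω₁ ω₂ : h.Dual) (x : A) :
    Dual.functional h (ω₁ * ω₂) x = Dual.functional h ω₁ (act ω₂ x) := rfl

lemma act_unique (ω : h.Dual) (x c : A)
    (hc : ∀ b, b * c = sliceSnd (Dual.functional h ω) (H.T₃ (x ⊗ₜ b))) : act ω x = c :=
  embed_injective (ext_right fun b => by rw [embed_right, mul_act, embed_right, hc])

lemma sliceSnd_add (ω ω' : A →ₗ[ℂ] ℂ) (z : A ⊗[ℂ] A) :
    sliceSnd (ω + ω') z = sliceSnd ω z + sliceSnd ω' z := by
  simp [sliceSnd, LinearMap.lTensor_add]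

lemma sliceSnd_smul (c : ℂ) (ω : A →ₗ[ℂ] ℂ) (z : A ⊗[ℂ] A) :
    sliceSnd (c • ω) z = c • sliceSnd ω z := by
  simp [sliceSnd, LinearMap.lTensor_smul]

lemma act_add (ω ω' : h.Dual) (x : A) : act (ω + ω') x = act ω x + act ω' x :=
  act_unique _ _ _ fun b => by rw [mul_add, mul_act, mul_act, map_add, sliceSnd_add]

lemma act_smul (c : ℂ) (ω : h.Dual) (x : A) : act (c • ω) x = c • act ω x :=
  act_unique _ _ _ fun b => by rw [mul_smul_comm, mul_act, map_smul, sliceSnd_smul]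

/-- `(b ⊗ 1 ⊗ 1)(Δ ⊙ ι)(Δ(x)(1 ⊗ a)) = (ι ⊙ Δ)((b ⊗ 1)Δ(x))(1 ⊗ 1 ⊗ a)`. -/
lemma coassoc_elements (H : RegularMultiplierHopf A) (x a b : A) :
    TensorProduct.assoc ℂ A A A
      ((H.T₃.toLinearMap ∘ₗ (TensorProduct.mk ℂ A A).flip b).rTensor A (H.T₂ (x ⊗ₜ a))) =
    (H.T₂.toLinearMap ∘ₗ (TensorProduct.mk ℂ A A).flip a).lTensor A (H.T₃ (x ⊗ₜ b)) := by
  refine embed_injective (Eq.trans (b := tmul (embed A b) 1 * H.Δ.coamplify A (H.Δ x) *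
    tmul 1 (tmul 1 (embed A a))) (ext_left fun w => ?_) (ext_right fun w => ?_))
  · obtain ⟨w, rfl⟩ := (TensorProduct.assoc ℂ A A A).surjective w
    rw [← H.coassoc, embed_left, ← assoc_mul]
    have hX : ∀ e (y z : A ⊗[ℂ] A),
        (H.T₃.toLinearMap ∘ₗ (TensorProduct.mk ℂ A A).flip b).rTensor A y *
          (H.Δ.actLeft e).rTensor A z =
        ((LinearMap.mulLeft ℂ b).rTensor A).rTensor A ((H.Δ.actLeft e).rTensor A (y * z)) := by
      intro e
      refine tensor_induction₂ (fun p q d c => ?_) (by simp) (by simp)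
        (by intro x y z h h'; simp [add_mul, h, h']) (by intro x y z h h'; simp [mul_add, h, h'])
      simp [RegularMultiplierHopf.T₃_mul]
    have h1 : ∀ w : (A ⊗[ℂ] A) ⊗[ℂ] A, (TensorProduct.assoc ℂ A A A).symm
        ((tmul 1 (tmul 1 (embed A a))).left (TensorProduct.assoc ℂ A A A w)) =
        (LinearMap.mulLeft ℂ a).lTensor (A ⊗[ℂ] A) w := by
      intro w
      induction w with
      | zero => simp
      | add x y hx hy => simp only [map_add, hx, hy]
      | tmul u v =>
        induction u with
        | zero => simp
        | add x y hx hy => simp only [TensorProduct.add_tmul, map_add, hx, hy]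
        | tmul u u' => simp
    have h2 : ∀ w : (A ⊗[ℂ] A) ⊗[ℂ] A,
        ((tmul (embed A b) (1 : Multiplier (A ⊗[ℂ] A))).left (TensorProduct.assoc ℂ A A A w)) =
        TensorProduct.assoc ℂ A A A (((LinearMap.mulLeft ℂ b).rTensor A).rTensor A w) := by
      intro w
      induction w with
      | zero => simp
      | add x y hx hy => simp only [map_add, hx, hy]
      | tmul u v =>
        induction u with
        | zero => simp
        | add x y hx hy => simp only [TensorProduct.add_tmul, map_add, hx, hy]
        | tmul u u' => simp
    have h3 : ∀ (f : A →ₗ[ℂ] A ⊗[ℂ] A) (z : A ⊗[ℂ] A),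
        (LinearMap.mulLeft ℂ a).lTensor (A ⊗[ℂ] A) (f.rTensor A z) =
        f.rTensor A ((LinearMap.mulLeft ℂ a).lTensor A z) := by
      intro f z
      induction z with
      | zero => simp
      | add x y hx hy => simp only [map_add, hx, hy]
      | tmul u v => simp
    rw [mul_left_apply, mul_left_apply, transport_left, h1, h2]
    congr 1
    obtain ⟨w, rfl⟩ := H.Δ.mulMap_surjective A w
    induction w with
    | zero => simp
    | add x y hx hy => simp only [map_add, mul_add, hx, hy]
    | tmul z e =>
      rw [NondegHom.mulMap_tmul, hX, h3, NondegHom.amplify_left, RegularMultiplierHopf.T₂_mul]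
  · have hco : ∀ e z, (H.Δ.coamplify A (H.Δ x)).right ((H.Δ.actRight e).lTensor A z) =
        (H.Δ.actRight e).lTensor A ((H.Δ x).right z) := by
      intro e z
      have hc : ∀ y : A ⊗[ℂ] A, (TensorProduct.comm ℂ (A ⊗[ℂ] A) A).symm
          ((H.Δ.actRight e).lTensor A y) =
          (H.Δ.actRight e).rTensor A (TensorProduct.comm ℂ A A y) := by
        intro y
        induction y with
        | zero => simp
        | add x y hx hy => simp only [map_add, hx, hy]
        | tmul u v => simp
      rw [NondegHom.coamplify, transport_right, hc, NondegHom.amplify_right, transport_right,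
        LinearEquiv.symm_apply_apply, ← hc, LinearEquiv.apply_symm_apply]
    have hY : ∀ e (z y : A ⊗[ℂ] A),
        (H.Δ.actRight e).lTensor A z *
          (H.T₂.toLinearMap ∘ₗ (TensorProduct.mk ℂ A A).flip a).lTensor A y =
        ((LinearMap.mulRight ℂ a).lTensor A).lTensor A ((H.Δ.actRight e).lTensor A (z * y)) := by
      intro e
      refine tensor_induction₂ (fun p q d c => ?_) (by simp) (by simp)
        (by intro x y z h h'; simp [add_mul, h, h']) (by intro x y z h h'; simp [mul_add, h, h'])
      simp [RegularMultiplierHopf.mul_T₂]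
    have hsurj : ∀ (p : A ⊗[ℂ] (A ⊗[ℂ] A) → Prop), p 0 → (∀ x y, p x → p y → p (x + y)) →
        (∀ e z, p ((H.Δ.actRight e).lTensor A z)) → ∀ w, p w := by
      intro p h0 hadd hp w
      obtain ⟨v, rfl⟩ := (TensorProduct.comm ℂ (A ⊗[ℂ] A) A).surjective w
      obtain ⟨v, rfl⟩ := H.Δ.mulMap'_surjective A v
      induction v with
      | zero => simpa using h0
      | add x y hx hy => simpa only [map_add] using hadd _ _ hx hy
      | tmul z e =>
        have hc : ∀ y : A ⊗[ℂ] A, TensorProduct.comm ℂ (A ⊗[ℂ] A) A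
            ((H.Δ.actRight e).rTensor A y) =
            (H.Δ.actRight e).lTensor A (TensorProduct.comm ℂ A A y) := by
          intro y
          induction y with
          | zero => simp
          | add x y hx hy => simp only [map_add, hx, hy]
          | tmul u v => simp
        rw [NondegHom.mulMap'_tmul, hc]
        exact hp _ _
    have h3 : ∀ (f : A →ₗ[ℂ] A ⊗[ℂ] A) (z : A ⊗[ℂ] A),
        (LinearMap.mulRight ℂ b).rTensor (A ⊗[ℂ] A) (f.lTensor A z) =
        f.lTensor A ((LinearMap.mulRight ℂ b).rTensor A z) := by
      intro f z
      induction z with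
      | zero => simp
      | add x y hx hy => simp only [map_add, hx, hy]
      | tmul u v => simp
    have h4 : (tmul (embed A b) (1 : Multiplier (A ⊗[ℂ] A))).right =
        (LinearMap.mulRight ℂ b).rTensor (A ⊗[ℂ] A) := rfl
    have h5 : (tmul (1 : Multiplier A) (tmul (1 : Multiplier A) (embed A a))).right =
        ((LinearMap.mulRight ℂ a).lTensor A).lTensor A := rfl
    rw [embed_right, mul_right_apply, mul_right_apply, h4, h5]
    revert w
    refine hsurj _ (by simp) (fun x y hx hy => by simp only [map_add, add_mul, hx, hy])
      fun e z => ?_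
    rw [h3, hco, hY, RegularMultiplierHopf.mul_T₃]

lemma act_dualMul (ω₁ ω₂ : h.Dual) (x : A) : act (ω₁ * ω₂) x = act ω₁ (act ω₂ x) := by
  symm
  refine (act_unique _ _ _ fun b => ?_).symm
  obtain ⟨a, rfl⟩ := dualMk_surjective ω₂
  rw [mul_act, act_dualMk]
  have h1 : ∀ z, sliceSnd (Dual.functional h ω₁) (H.T₃ (sliceSnd h.φ z ⊗ₜ b)) =
      sliceSnd (Dual.functional h ω₁) ((sliceSnd h.φ).lTensor A (TensorProduct.assoc ℂ A A A
      ((H.T₃.toLinearMap ∘ₗ (TensorProduct.mk ℂ A A).flip b).rTensor A z))) := by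
    intro z
    induction z with
    | zero => simp
    | add x y hx hy => simp [hx, hy, TensorProduct.add_tmul]
    | tmul p q =>
      simp only [sliceSnd_tmul, LinearMap.rTensor_tmul, LinearMap.comp_apply,
        LinearMap.flip_apply, TensorProduct.mk_apply, LinearEquiv.coe_coe]
      rw [← TensorProduct.smul_tmul', map_smul, map_smul]
      generalize H.T₃ (p ⊗ₜ b) = w
      induction w with
      | zero => simp
      | add x y hx hy => simp_all [TensorProduct.add_tmul]
      | tmul u v =>
        simp only [TensorProduct.assoc_tmul, LinearMap.lTensor_tmul, sliceSnd_tmul, map_smul,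
          TensorProduct.tmul_smul]
  have h2 : ∀ z, sliceSnd (Dual.functional h ω₁) ((sliceSnd h.φ).lTensor A
      ((H.T₂.toLinearMap ∘ₗ (TensorProduct.mk ℂ A A).flip a).lTensor A z)) =
      sliceSnd (Dual.functional h (ω₁ * h.dualMk a)) z := by
    intro z
    induction z with
    | zero => simp
    | add x y hx hy => simp only [map_add, hx, hy]
    | tmul p q =>
      simp [mul_apply, act_dualMk]
  rw [h1, coassoc_elements, h2]

noncomputable instance : NonUnitalRing h.Dual :=
  { (inferInstance : AddCommGroup h.Dual) with
    mul := (· * ·)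
    left_distrib := fun a b c => Dual.functional_injective (LinearMap.ext fun x => by
      simp only [map_add, LinearMap.add_apply, mul_apply, act_add])
    right_distrib := fun a b c => Dual.functional_injective (LinearMap.ext fun x => by
      simp only [map_add, LinearMap.add_apply, mul_apply])
    zero_mul := fun a => Dual.functional_injective (LinearMap.ext fun x => by
      simp only [map_zero, LinearMap.zero_apply, mul_apply])
    mul_zero := fun a => Dual.functional_injective (LinearMap.ext fun x => by
      rw [mul_apply, show act (0 : h.Dual) x = 0 from by simpa using act_smul 0 (0 : h.Dual) x]
      simp)
    mul_assoc := fun a b c => Dual.functional_injective (LinearMap.ext fun x => by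
      simp only [mul_apply, act_dualMul]) }

instance : IsScalarTower ℂ h.Dual h.Dual :=
  ⟨fun c a b => Dual.functional_injective (LinearMap.ext fun x => by
    simp only [smul_eq_mul, map_smul, LinearMap.smul_apply, mul_apply])⟩

instance : SMulCommClass ℂ h.Dual h.Dual :=
  ⟨fun c a b => Dual.functional_injective (LinearMap.ext fun x => by
    simp only [smul_eq_mul, map_smul, LinearMap.smul_apply, mul_apply, act_smul])⟩

end LeftHaar


section Corepresentations

variable {A B : Type*}
  [NonUnitalRing A] [Module ℂ A] [IsScalarTower ℂ A A] [SMulCommClass ℂ A A]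
  [NondegenerateAlgebra A]
  [NonUnitalRing B] [Module ℂ B] [IsScalarTower ℂ B B] [SMulCommClass ℂ B B]

/-- `V₂₃ = 1 ⊗ V`. -/
def leg23 (V : Multiplier (A ⊗[ℂ] B)) : Multiplier (A ⊗[ℂ] (A ⊗[ℂ] B)) :=
  Multiplier.tmul 1 V

/-- `V₁₃`, obtained from `V₂₃` by exchanging the first two factors. -/
def leg13 (V : Multiplier (A ⊗[ℂ] B)) : Multiplier (A ⊗[ℂ] (A ⊗[ℂ] B)) :=
  (leg23 V).transport (TensorProduct.leftComm ℂ A A B) leftComm_mul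

/-- `V ∈ M(A ⊙ B)` is a corepresentation of `(A, Δ)` on `B`: `(Δ ⊙ ι)(V) = V₁₃ V₂₃`. -/
def IsCorepresentation [NondegenerateAlgebra B] (H : RegularMultiplierHopf A)
    (V : Multiplier (A ⊗[ℂ] B)) : Prop :=
  (H.Δ.amplify B V).transport (TensorProduct.assoc ℂ A A B) assoc_mul = leg13 V * leg23 V

/-- A corepresentation is non-degenerate if it is invertible in `M(A ⊙ B)`. -/
def IsNondegenerateCorepresentation [NondegenerateAlgebra B] (H : RegularMultiplierHopf A)
    (V : Multiplier (A ⊗[ℂ] B)) : Prop :=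
  IsCorepresentation H V ∧ IsUnit V

variable {H : RegularMultiplierHopf A} (h : LeftHaar H)

/-- Evaluation `A ⊙ Â → A`, `x ⊗ ω ↦ ω(y) x`, through which `A ⊙ Â` is a space of linear operators
on `A`. -/
noncomputable def evalAt (y : A) : A ⊗[ℂ] h.Dual →ₗ[ℂ] A :=
  sliceSnd (LinearMap.applyₗ y ∘ₗ LeftHaar.Dual.functional h)

/-- The defining property of the universal corepresentation `U ∈ M(A ⊙ Â)`:
`[U(x ⊗ ω)](y) = (ι ⊙ ω)(Δ(y)(x ⊗ 1))` and `[(x ⊗ ω)U](y) = (ω ⊙ ι)((1 ⊗ x)Δ(y))`. -/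
def IsUniversalCorepresentation (U : Multiplier (A ⊗[ℂ] h.Dual)) : Prop :=
  (∀ (x y : A) (ω : h.Dual), evalAt h y (U.left (x ⊗ₜ ω)) =
    sliceSnd (LeftHaar.Dual.functional h ω) (H.T₁ (y ⊗ₜ x))) ∧
  (∀ (x y : A) (ω : h.Dual), evalAt h y (U.right (x ⊗ₜ ω)) =
    sliceFst (LeftHaar.Dual.functional h ω) (H.T₄ (y ⊗ₜ x)))

lemma exists_left_unit (h : LeftHaar H) (a : A) : ∃ e : A, e * a = a := by
  by_contra hcon
  have hmem : a ∉ LinearMap.range (LinearMap.mulRight ℂ a) := by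
    rintro ⟨e, he⟩
    exact hcon ⟨e, he⟩
  obtain ⟨ω, hωa, hω⟩ := Submodule.exists_le_ker_of_notMem hmem
  obtain ⟨d, hd⟩ : ∃ d, h.φ d ≠ 0 := by
    by_contra hall
    push Not at hall
    exact h.ne_zero (LinearMap.ext hall)
  have hω' : ω ∘ₗ LinearMap.mulRight ℂ a = 0 :=
    LinearMap.ext fun e => hω ⟨e, rfl⟩
  have hm : sliceFst ω (H.T₁ (d ⊗ₜ a)) = 0 := by
    refine NondegenerateAlgebra.right_faithful _ fun e => ?_
    have h1 : e * sliceFst ω (H.T₁ (d ⊗ₜ a)) =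
        sliceFst ω ((LinearMap.mulLeft ℂ e).lTensor A (H.T₁ (d ⊗ₜ a))) := by
      rw [RegularMultiplierHopf.sliceFst_lTensor]; rfl
    rw [h1, ← RegularMultiplierHopf.T₄_T₁, RegularMultiplierHopf.sliceFst_rTensor, hω']
    simp [sliceFst]
  have h2 : ∀ z : A ⊗[ℂ] A, h.φ (sliceFst ω z) = ω (sliceSnd h.φ z) := by
    intro z
    induction z with
    | zero => simp
    | add x y hx hy => simp [hx, hy]
    | tmul p q => simp [mul_comm]
  have h3 : sliceSnd h.φ (H.T₁ (d ⊗ₜ a)) = h.φ d • a :=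
    congrArg (fun T => Multiplier.left T a) (h.invariant d)
  have h4 := h2 (H.T₁ (d ⊗ₜ a))
  rw [hm, h3, map_zero, map_smul, smul_eq_mul] at h4
  exact (mul_ne_zero hd hωa) h4.symm

/-- `(a, x) ↦ (φ ⊙ ι)(V (a ⊗ x))`. -/
noncomputable def sliceAux (V : Multiplier (A ⊗[ℂ] B)) : A →ₗ[ℂ] B →ₗ[ℂ] B :=
  LinearMap.mk₂ ℂ (fun a x => sliceFst h.φ (V.left (a ⊗ₜ x)))
    (by intro a a' x; simp [TensorProduct.add_tmul])
    (by intro c a x; rw [← TensorProduct.smul_tmul']; simp)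
    (by intro a x x'; simp [TensorProduct.tmul_add])
    (by intro c a x; simp)

@[simp] lemma sliceAux_apply (V : Multiplier (A ⊗[ℂ] B)) (a : A) (x : B) :
    sliceAux h V a x = sliceFst h.φ (V.left (a ⊗ₜ x)) := rfl

lemma sliceAux_ker [NondegenerateAlgebra B] (V : Multiplier (A ⊗[ℂ] B)) :
    LinearMap.ker h.dualMk ≤ LinearMap.ker (sliceAux h V) := by
  intro a ha
  rw [LinearMap.mem_ker] at ha ⊢
  replace ha : h.toDual a = 0 := congrArg (LeftHaar.Dual.functional h) ha
  ext x
  obtain ⟨e, he⟩ := exists_left_unit h a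
  have h0 : ∀ z : A ⊗[ℂ] B, sliceFst h.φ ((LinearMap.mulRight ℂ a).rTensor B z) = 0 := by
    intro z
    rw [RegularMultiplierHopf.sliceFst_rTensor]
    have : h.φ ∘ₗ LinearMap.mulRight ℂ a = 0 := ha
    simp [this, sliceFst]
  have h1 : V.left (a ⊗ₜ x) = (LinearMap.mulRight ℂ a).rTensor B (V.left (e ⊗ₜ x)) := by
    refine sub_eq_zero.1 (NondegenerateAlgebra.right_faithful _ fun w => ?_)
    have h2 : ∀ w z : A ⊗[ℂ] B, w * (LinearMap.mulRight ℂ a).rTensor B z =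
        (LinearMap.mulRight ℂ a).rTensor B (w * z) :=
      Multiplier.tensor_induction₂ (by intro a b a' b'; simp [mul_assoc]) (by simp) (by simp)
        (by intro x y z h h'; simp [add_mul, h, h']) (by intro x y z h h'; simp [mul_add, h, h'])
    rw [mul_sub, h2, V.mul_left_eq, V.mul_left_eq, ← h2]
    simp [he]
  rw [sliceAux_apply, h1, h0]
  rfl

/-- For `ω ∈ Â`, the left multiplier `(ω ⊙ ι)(V)` of `B`; it is determined by
`(a φ ⊙ ι)(V) x = (φ ⊙ ι)(V (a ⊗ x))`. -/
noncomputable def slice [NondegenerateAlgebra B] (V : Multiplier (A ⊗[ℂ] B)) :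
    h.Dual →ₗ[ℂ] (B →ₗ[ℂ] B) :=
  (LinearMap.ker h.dualMk).liftQ (sliceAux h V) (sliceAux_ker h V) ∘ₗ
    (h.dualMk.quotKerEquivOfSurjective LeftHaar.dualMk_surjective).symm.toLinearMap

lemma slice_dualMk [NondegenerateAlgebra B] (V : Multiplier (A ⊗[ℂ] B)) (a : A) (x : B) :
    slice h V (h.dualMk a) x = sliceFst h.φ (V.left (a ⊗ₜ x)) := by
  have : (h.dualMk.quotKerEquivOfSurjective LeftHaar.dualMk_surjective).symm (h.dualMk a) =
      Submodule.Quotient.mk a :=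
    (LinearEquiv.symm_apply_eq _).2 rfl
  rw [slice, LinearMap.comp_apply, LinearEquiv.coe_coe, this]
  rfl

/-- `π = π_V`, that is `π(ω) = (ω ⊙ ι)(V)` for all `ω ∈ Â`, where `M(B)` acts on `B` by
left multipliers. -/
def IsInducedHom [NondegenerateAlgebra B] (V : Multiplier (A ⊗[ℂ] B))
    (π : h.Dual →ₙₐ[ℂ] Multiplier B) : Prop :=
  ∀ ω, (π ω).left = slice h V ω

end Corepresentations

end QuantumGroups

end AQG

/-!
The proof has two parts: the construction of `U`, which needs the duality theory of algebraic
quantum groups, and the correspondence, which is a computation with `U`.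

For `ω = aφ` the left action of `U` is explicit. If `x ⊗ a = ∑ Δ(pᵢ)(qᵢ ⊗ 1)`, left invariance of
`φ` gives `(ι ⊙ ω)(Δ(y)(x ⊗ 1)) = ∑ φ(y pᵢ) qᵢ`, so `U(x ⊗ aφ) = ∑ qᵢ ⊗ pᵢφ`. For the right action
the same argument applies to functionals `ψ(c ·)` with `ψ` right invariant and the Galois map
`a ⊗ b ↦ (1 ⊗ b)Δ(a)`. Hence `U` exists, and is invertible because the Galois maps are, as soon as
`a ↦ φ(· a)` and `c ↦ ψ(c ·)` are injective with the same image `Â`.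

These facts are proved for `CoveredCoproduct`, a multiplier-free form of the data that is stable
under reversing product and coproduct (`CoveredCoproduct.mirror`), so that each statement about left
invariant functionals has a version for right invariant ones. The coassociativity relation
`Δ((ι ⊙ ω)Δ(p)) = (ι ⊙ (ι ⊙ ω)Δ)Δ(p)` yields the counit (`exists_counit`), the faithfulness of `φ`
(`IsLeftInvariant.faithful`), the antipode `S` (`IsLeftInvariant.exists_antipode`) and the right
invariance of `ψ = φ ∘ S` (`IsLeftInvariant.comp_antipode`). The convolution products of functionals
`ψ(b ·)` and `φ(· a)` span `{φ(· a)}` by the properties of `S`, and span `{ψ(c ·)}` by the mirrored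
argument; thus the two spaces coincide (`IsLeftInvariant.exists_rightInvariant`).

For a non-degenerate homomorphism `θ`, the corepresentation identity for `(ι ⊙ θ)(U)` follows from
the one for `U` (`evalAt_leg13_leg23`), invertibility from that of `U`, and `π_{(ι ⊙ θ)(U)} = θ`
from `(φ ⊙ ι)(U(a ⊗ ω)) = (aφ)ω` (`sliceFst_universalLeft`); the last identity also shows that `θ` is
determined by `(ι ⊙ θ)(U)`. Conversely, for a corepresentation `V`, applying `ι ⊙ φ ⊙ ι` to
`(Δ ⊙ ι)(V) = V₁₃V₂₃` gives `V(x ⊗ π_V(ω)b) = (ι ⊙ π_V(·)b)(U(x ⊗ ω))`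
(`IsCorepresentation.left_slice`). This is `(ι ⊙ π_V)(U) = V`, and one more application of `φ` makes
`π_V` multiplicative. That `π_V(ω)` is a two-sided multiplier is where both descriptions
`ω = φ(· a) = ψ(c ·)` are used (`mul_slice`).
-/

namespace AQG

/-! ### Slices of tensors -/

section Slices

variable {M N P Q : Type*} [AddCommGroup M] [Module ℂ M] [AddCommGroup N] [Module ℂ N]
  [AddCommGroup P] [Module ℂ P] [AddCommGroup Q] [Module ℂ Q]

lemma sliceSnd_lTensor (ω : P →ₗ[ℂ] ℂ) (f : N →ₗ[ℂ] P) (z : M ⊗[ℂ] N) :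
    sliceSnd ω (f.lTensor M z) = sliceSnd (ω ∘ₗ f) z := by
  induction z with
  | zero => simp
  | add x y hx hy => simp [hx, hy]
  | tmul a b => simp

lemma sliceSnd_rTensor (ω : N →ₗ[ℂ] ℂ) (f : M →ₗ[ℂ] P) (z : M ⊗[ℂ] N) :
    sliceSnd ω (f.rTensor N z) = f (sliceSnd ω z) := by
  induction z with
  | zero => simp
  | add x y hx hy => simp [hx, hy]
  | tmul a b => simp

lemma sliceFst_rTensor (ω : P →ₗ[ℂ] ℂ) (f : M →ₗ[ℂ] P) (z : M ⊗[ℂ] N) :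
    sliceFst ω (f.rTensor N z) = sliceFst (ω ∘ₗ f) z := by
  induction z with
  | zero => simp
  | add x y hx hy => simp [hx, hy]
  | tmul a b => simp

lemma sliceFst_lTensor (ω : M →ₗ[ℂ] ℂ) (f : N →ₗ[ℂ] P) (z : M ⊗[ℂ] N) :
    sliceFst ω (f.lTensor M z) = f (sliceFst ω z) := by
  induction z with
  | zero => simp
  | add x y hx hy => simp [hx, hy]
  | tmul a b => simp

@[simp] lemma sliceFst_comm (ω : N →ₗ[ℂ] ℂ) (z : M ⊗[ℂ] N) :
    sliceFst ω (TensorProduct.comm ℂ M N z) = sliceSnd ω z := by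
  induction z with
  | zero => simp
  | add x y hx hy => simp [hx, hy]
  | tmul a b => simp

@[simp] lemma sliceSnd_comm (ω : M →ₗ[ℂ] ℂ) (z : M ⊗[ℂ] N) :
    sliceSnd ω (TensorProduct.comm ℂ M N z) = sliceFst ω z := by
  induction z with
  | zero => simp
  | add x y hx hy => simp [hx, hy]
  | tmul a b => simp

lemma apply_sliceFst (ω : M →ₗ[ℂ] ℂ) (χ : N →ₗ[ℂ] ℂ) (z : M ⊗[ℂ] N) :
    χ (sliceFst ω z) = ω (sliceSnd χ z) := by
  induction z with
  | zero => simp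
  | add x y hx hy => simp [hx, hy]
  | tmul a b => simp [mul_comm]

lemma comm_rTensor (f : M →ₗ[ℂ] P) (z : M ⊗[ℂ] N) :
    TensorProduct.comm ℂ P N (f.rTensor N z) = f.lTensor N (TensorProduct.comm ℂ M N z) := by
  induction z with
  | zero => simp
  | add x y hx hy => simp [hx, hy]
  | tmul a b => simp

lemma comm_lTensor (f : N →ₗ[ℂ] P) (z : M ⊗[ℂ] N) :
    TensorProduct.comm ℂ M P (f.lTensor M z) = f.rTensor M (TensorProduct.comm ℂ M N z) := by
  induction z with
  | zero => simp
  | add x y hx hy => simp [hx, hy]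
  | tmul a b => simp

lemma rTensor_lTensor_comm (f : M →ₗ[ℂ] P) (g : N →ₗ[ℂ] Q) (z : M ⊗[ℂ] N) :
    f.rTensor Q (g.lTensor M z) = g.lTensor P (f.rTensor N z) := by
  induction z with
  | zero => simp
  | add x y hx hy => simp [hx, hy]
  | tmul a b => simp

lemma lTensor_sliceSnd_assoc (ω : P →ₗ[ℂ] ℂ) (z : (M ⊗[ℂ] N) ⊗[ℂ] P) :
    (sliceSnd ω).lTensor M (TensorProduct.assoc ℂ M N P z) = sliceSnd ω z := by
  induction z with
  | zero => simp
  | add x y hx hy => simp [hx, hy]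
  | tmul a c =>
    induction a with
    | zero => simp
    | add x y hx hy => simp [TensorProduct.add_tmul, hx, hy]
    | tmul a b => simp [TensorProduct.smul_tmul']

lemma sliceSnd_surjective {ω : N →ₗ[ℂ] ℂ} (h : ω ≠ 0) :
    Function.Surjective (sliceSnd (A := M) ω) := by
  obtain ⟨x, hx⟩ : ∃ x, ω x ≠ 0 := DFunLike.ne_iff.1 h
  exact fun a => ⟨a ⊗ₜ ((ω x)⁻¹ • x), by simp [hx]⟩

lemma sliceFst_surjective {ω : M →ₗ[ℂ] ℂ} (h : ω ≠ 0) :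
    Function.Surjective (sliceFst (B := N) ω) := fun a => by
  obtain ⟨z, hz⟩ := sliceSnd_surjective (M := N) h a
  exact ⟨TensorProduct.comm ℂ N M z, by simpa using hz⟩

/-- A tensor on which a separating family of maps of the second leg vanishes is zero. -/
lemma eq_zero_of_lTensor_eq_zero {ι : Type*} (f : ι → N →ₗ[ℂ] P)
    (hf : ∀ b, (∀ i, f i b = 0) → b = 0) (z : M ⊗[ℂ] N) (hz : ∀ i, (f i).lTensor M z = 0) :
    z = 0 := by
  obtain ⟨b, rfl⟩ := TensorProduct.eq_repr_basis_left (Module.Basis.ofVectorSpace ℂ M) z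
  have hb : ∀ i, b.mapRange (f i) (map_zero _) = 0 := by
    intro i
    refine (TensorProduct.sum_tmul_basis_left_eq_zero
      (Module.Basis.ofVectorSpace ℂ M) (b.mapRange (f i) (map_zero _)) ?_)
    rw [← hz i, Finsupp.sum_mapRange_index (by simp), Finsupp.sum, Finsupp.sum, map_sum]
    simp
  have : b = 0 := Finsupp.ext fun k => hf _ fun i => by
    simpa using DFunLike.congr_fun (hb i) k
  simp [this]

lemma eq_zero_of_rTensor_eq_zero {ι : Type*} (f : ι → M →ₗ[ℂ] P)
    (hf : ∀ b, (∀ i, f i b = 0) → b = 0) (z : M ⊗[ℂ] N) (hz : ∀ i, (f i).rTensor N z = 0) :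
    z = 0 := by
  refine (TensorProduct.comm ℂ M N).injective ?_
  rw [map_zero]
  refine eq_zero_of_lTensor_eq_zero f hf _ fun i => ?_
  rw [← comm_rTensor, hz, map_zero]

end Slices

/-! ### Covered coproducts -/

/-- The algebraic data of a regular multiplier Hopf algebra, expressed without multipliers: a
non-degenerate product `mul` on `A`, the four Galois maps
`a ⊗ b ↦ Δ(a)(b ⊗ 1), Δ(a)(1 ⊗ b), (b ⊗ 1)Δ(a), (1 ⊗ b)Δ(a)`, and the actions
`DL a z = Δ(a) z`, `DR a z = z Δ(a)` of `Δ(a)` on `A ⊙ A`. The product is a field rather than an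
instance so that passing to the opposite product and coproduct keeps the underlying type. -/
structure CoveredCoproduct (A : Type*) [AddCommGroup A] [Module ℂ A] where
  mul : A →ₗ[ℂ] A →ₗ[ℂ] A
  assoc : ∀ a b c, mul (mul a b) c = mul a (mul b c)
  left_faithful : ∀ a, (∀ b, mul a b = 0) → a = 0
  right_faithful : ∀ a, (∀ b, mul b a = 0) → a = 0
  T₁ : A ⊗[ℂ] A ≃ₗ[ℂ] A ⊗[ℂ] A
  T₂ : A ⊗[ℂ] A ≃ₗ[ℂ] A ⊗[ℂ] A
  T₃ : A ⊗[ℂ] A ≃ₗ[ℂ] A ⊗[ℂ] A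
  T₄ : A ⊗[ℂ] A ≃ₗ[ℂ] A ⊗[ℂ] A
  DL : A → A ⊗[ℂ] A →ₗ[ℂ] A ⊗[ℂ] A
  DR : A → A ⊗[ℂ] A →ₗ[ℂ] A ⊗[ℂ] A
  DL_T₁ : ∀ a p q, DL a (T₁ (p ⊗ₜ q)) = T₁ (mul a p ⊗ₜ q)
  DL_T₂ : ∀ a p q, DL a (T₂ (p ⊗ₜ q)) = T₂ (mul a p ⊗ₜ q)
  DR_T₃ : ∀ a p q, DR a (T₃ (p ⊗ₜ q)) = T₃ (mul p a ⊗ₜ q)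
  DR_T₄ : ∀ a p q, DR a (T₄ (p ⊗ₜ q)) = T₄ (mul p a ⊗ₜ q)
  DL_tmul₁ : ∀ a x y, DL a (x ⊗ₜ y) = (mul.flip y).lTensor A (T₁ (a ⊗ₜ x))
  DL_tmul₂ : ∀ a x y, DL a (x ⊗ₜ y) = (mul.flip x).rTensor A (T₂ (a ⊗ₜ y))
  DR_tmul₃ : ∀ a x y, DR a (x ⊗ₜ y) = (mul y).lTensor A (T₃ (a ⊗ₜ x))
  DR_tmul₄ : ∀ a x y, DR a (x ⊗ₜ y) = (mul x).rTensor A (T₄ (a ⊗ₜ y))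
  T₃_T₁ : ∀ a b c, (mul.flip b).rTensor A (T₃ (a ⊗ₜ c)) = (mul c).rTensor A (T₁ (a ⊗ₜ b))
  T₄_T₁ : ∀ a b c, (mul.flip b).rTensor A (T₄ (a ⊗ₜ c)) = (mul c).lTensor A (T₁ (a ⊗ₜ b))
  T₃_T₂ : ∀ a b c, (mul.flip b).lTensor A (T₃ (a ⊗ₜ c)) = (mul c).rTensor A (T₂ (a ⊗ₜ b))
  T₄_T₂ : ∀ a b c, (mul.flip b).lTensor A (T₄ (a ⊗ₜ c)) = (mul c).lTensor A (T₂ (a ⊗ₜ b))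
  coassoc : ∀ x a b, TensorProduct.assoc ℂ A A A
      ((T₃.toLinearMap ∘ₗ (TensorProduct.mk ℂ A A).flip b).rTensor A (T₂ (x ⊗ₜ a))) =
    (T₂.toLinearMap ∘ₗ (TensorProduct.mk ℂ A A).flip a).lTensor A (T₃ (x ⊗ₜ b))

namespace CoveredCoproduct

variable {A : Type*} [AddCommGroup A] [Module ℂ A] (G : CoveredCoproduct A)

/-- The same data for the opposite product and the opposite coproduct. Up to the flip of `A ⊙ A`
this exchanges `T₁` with `T₄`, `T₂` with `T₃`, and `DL` with `DR`. -/
def mirror : CoveredCoproduct A where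
  mul := G.mul.flip
  assoc a b c := by simp [G.assoc]
  left_faithful := G.right_faithful
  right_faithful := G.left_faithful
  T₁ := G.T₄.trans (TensorProduct.comm ℂ A A)
  T₂ := G.T₃.trans (TensorProduct.comm ℂ A A)
  T₃ := G.T₂.trans (TensorProduct.comm ℂ A A)
  T₄ := G.T₁.trans (TensorProduct.comm ℂ A A)
  DL a := (TensorProduct.comm ℂ A A).toLinearMap ∘ₗ G.DR a ∘ₗ
    (TensorProduct.comm ℂ A A).toLinearMap
  DR a := (TensorProduct.comm ℂ A A).toLinearMap ∘ₗ G.DL a ∘ₗ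
    (TensorProduct.comm ℂ A A).toLinearMap
  DL_T₁ a p q := by simp [G.DR_T₄]
  DL_T₂ a p q := by simp [G.DR_T₃]
  DR_T₃ a p q := by simp [G.DL_T₂]
  DR_T₄ a p q := by simp [G.DL_T₁]
  DL_tmul₁ a x y := by simp [G.DR_tmul₄, comm_rTensor]
  DL_tmul₂ a x y := by simp [G.DR_tmul₃, comm_lTensor]
  DR_tmul₃ a x y := by simp [G.DL_tmul₂, comm_rTensor]
  DR_tmul₄ a x y := by simp [G.DL_tmul₁, comm_lTensor]
  T₃_T₁ a b c := by simp [← comm_lTensor, G.T₄_T₂]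
  T₄_T₁ a b c := by simp [← comm_lTensor, ← comm_rTensor, G.T₄_T₁]
  T₃_T₂ a b c := by simp [← comm_lTensor, ← comm_rTensor, G.T₃_T₂]
  T₄_T₂ a b c := by simp [← comm_rTensor, G.T₃_T₁]
  coassoc x a b := by
    -- Coassociativity is read from right to left: `rev` reverses the three legs.
    have rev : ∀ w : (A ⊗[ℂ] A) ⊗[ℂ] A,
        TensorProduct.assoc ℂ A A A (TensorProduct.comm ℂ A (A ⊗[ℂ] A)
          ((TensorProduct.comm ℂ A A).toLinearMap.lTensor A (TensorProduct.assoc ℂ A A A w))) =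
        (TensorProduct.comm ℂ A A).toLinearMap.lTensor A (TensorProduct.comm ℂ (A ⊗[ℂ] A) A w) := by
      intro w
      induction w with
      | zero => simp
      | add x y hx hy => simp only [map_add, hx, hy]
      | tmul u c =>
        induction u with
        | zero => simp
        | add x y hx hy => simp only [TensorProduct.add_tmul, map_add, hx, hy]
        | tmul u v => simp
    have h := rev ((G.T₃.toLinearMap ∘ₗ (TensorProduct.mk ℂ A A).flip a).rTensor A
      (G.T₂ (x ⊗ₜ b)))
    rw [G.coassoc, comm_rTensor, ← LinearMap.lTensor_comp_apply, ← LinearMap.lTensor_comp_apply,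
      comm_lTensor] at h
    exact h

@[simp] lemma mirror_mul (a b : A) : G.mirror.mul a b = G.mul b a := rfl
lemma mirror_T₁ (z : A ⊗[ℂ] A) : G.mirror.T₁ z = TensorProduct.comm ℂ A A (G.T₄ z) := rfl
lemma mirror_T₂ (z : A ⊗[ℂ] A) : G.mirror.T₂ z = TensorProduct.comm ℂ A A (G.T₃ z) := rfl
lemma mirror_T₃ (z : A ⊗[ℂ] A) : G.mirror.T₃ z = TensorProduct.comm ℂ A A (G.T₂ z) := rfl
lemma mirror_T₄ (z : A ⊗[ℂ] A) : G.mirror.T₄ z = TensorProduct.comm ℂ A A (G.T₁ z) := rfl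

end CoveredCoproduct

/-! ### Invariant functionals and the counit -/

namespace CoveredCoproduct

variable {A : Type*} [AddCommGroup A] [Module ℂ A] (G : CoveredCoproduct A)

/-- Left invariance, `(ι ⊙ φ)Δ(a) = φ(a) 1`, read off from both multiplications of the first leg. -/
structure IsLeftInvariant (φ : A →ₗ[ℂ] ℂ) : Prop where
  ne_zero : φ ≠ 0
  T₁ : ∀ a b, sliceSnd φ (G.T₁ (a ⊗ₜ b)) = φ a • b
  T₃ : ∀ a b, sliceSnd φ (G.T₃ (a ⊗ₜ b)) = φ a • b

/-- Right invariance, `(ψ ⊙ ι)Δ(a) = ψ(a) 1`. -/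
def IsRightInvariant (ψ : A →ₗ[ℂ] ℂ) : Prop := G.mirror.IsLeftInvariant ψ

variable {G} in
lemma IsRightInvariant.ne_zero {ψ : A →ₗ[ℂ] ℂ} (h : G.IsRightInvariant ψ) : ψ ≠ 0 :=
  IsLeftInvariant.ne_zero h

variable {G} in
lemma IsRightInvariant.T₄ {ψ : A →ₗ[ℂ] ℂ} (h : G.IsRightInvariant ψ) (a b : A) :
    sliceFst ψ (G.T₄ (a ⊗ₜ b)) = ψ a • b := by
  simpa [mirror_T₁] using IsLeftInvariant.T₁ h a b

variable {G} in
lemma IsRightInvariant.T₂ {ψ : A →ₗ[ℂ] ℂ} (h : G.IsRightInvariant ψ) (a b : A) :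
    sliceFst ψ (G.T₂ (a ⊗ₜ b)) = ψ a • b := by
  simpa [mirror_T₃] using IsLeftInvariant.T₃ h a b

lemma T₃_T₄ (a b c : A) : (G.mul b).lTensor A (G.T₃ (a ⊗ₜ c)) =
    (G.mul c).rTensor A (G.T₄ (a ⊗ₜ b)) := by
  rw [← G.DR_tmul₃, ← G.DR_tmul₄]

/-- `Δ(a) T₁(w) = T₁((a ⊗ 1) w)`. -/
lemma DL_T₁_apply (a : A) (w : A ⊗[ℂ] A) : G.DL a (G.T₁ w) = G.T₁ ((G.mul a).rTensor A w) := by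
  induction w with
  | zero => simp
  | add x y hx hy => simp only [map_add, hx, hy]
  | tmul p q => simp [G.DL_T₁]

lemma DL_T₂_apply (a : A) (w : A ⊗[ℂ] A) : G.DL a (G.T₂ w) = G.T₂ ((G.mul a).rTensor A w) := by
  induction w with
  | zero => simp
  | add x y hx hy => simp only [map_add, hx, hy]
  | tmul p q => simp [G.DL_T₂]

lemma DR_T₃_apply (a : A) (w : A ⊗[ℂ] A) :
    G.DR a (G.T₃ w) = G.T₃ ((G.mul.flip a).rTensor A w) := by
  induction w with
  | zero => simp
  | add x y hx hy => simp only [map_add, hx, hy]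
  | tmul p q => simp [G.DR_T₃]

variable {G} in
lemma IsLeftInvariant.T₁_apply {φ : A →ₗ[ℂ] ℂ} (h : G.IsLeftInvariant φ) (w : A ⊗[ℂ] A) :
    sliceSnd φ (G.T₁ w) = sliceFst φ w := by
  induction w with
  | zero => simp
  | add x y hx hy => simp only [map_add, hx, hy]
  | tmul p q => simp [h.T₁]

variable {G} in
lemma IsLeftInvariant.T₃_apply {φ : A →ₗ[ℂ] ℂ} (h : G.IsLeftInvariant φ) (w : A ⊗[ℂ] A) :
    sliceSnd φ (G.T₃ w) = sliceFst φ w := by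
  induction w with
  | zero => simp
  | add x y hx hy => simp only [map_add, hx, hy]
  | tmul p q => simp [h.T₃]

variable {G} in
lemma IsRightInvariant.T₂_apply {ψ : A →ₗ[ℂ] ℂ} (h : G.IsRightInvariant ψ) (w : A ⊗[ℂ] A) :
    sliceFst ψ (G.T₂ w) = sliceFst ψ w := by
  induction w with
  | zero => simp
  | add x y hx hy => simp only [map_add, hx, hy]
  | tmul p q => simp [h.T₂]

/-- `(b ⊗ 1 ⊗ a)Δ⁽²⁾(x)`. -/
lemma coassoc₃₄ (x a b : A) : TensorProduct.assoc ℂ A A A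
      ((G.T₃.toLinearMap ∘ₗ (TensorProduct.mk ℂ A A).flip b).rTensor A (G.T₄ (x ⊗ₜ a))) =
    (G.T₄.toLinearMap ∘ₗ (TensorProduct.mk ℂ A A).flip a).lTensor A (G.T₃ (x ⊗ₜ b)) := by
  have hR : ∀ (f : A →ₗ[ℂ] A) (w : (A ⊗[ℂ] A) ⊗[ℂ] A),
      (f.lTensor A).lTensor A (TensorProduct.assoc ℂ A A A w) =
        TensorProduct.assoc ℂ A A A (f.lTensor (A ⊗[ℂ] A) w) := by
    intro f w
    induction w with
    | zero => simp
    | add x y hx hy => simp only [map_add, hx, hy]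
    | tmul u c =>
      induction u with
      | zero => simp
      | add x y hx hy => simp only [TensorProduct.add_tmul, map_add, hx, hy]
      | tmul u v => simp
  rw [← sub_eq_zero]
  refine eq_zero_of_lTensor_eq_zero (fun d : A => (G.mul.flip d).lTensor A)
    (fun z hz => eq_zero_of_lTensor_eq_zero (fun d : A => G.mul.flip d)
      (fun b hb => G.left_faithful b hb) z hz) _ fun d => ?_
  have hc : ∀ c, (G.mul.flip d).lTensor A ∘ₗ G.T₄.toLinearMap ∘ₗ
      (TensorProduct.mk ℂ A A).flip c = (G.mul c).lTensor A ∘ₗ G.T₂.toLinearMap ∘ₗ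
      (TensorProduct.mk ℂ A A).flip d := by
    intro c
    ext y
    simp [G.T₄_T₂]
  rw [map_sub, sub_eq_zero, hR, ← rTensor_lTensor_comm, G.T₄_T₂, rTensor_lTensor_comm, ← hR,
    G.coassoc, ← LinearMap.lTensor_comp_apply, ← LinearMap.lTensor_comp_apply, hc]

/-- `(1 ⊗ 1 ⊗ a)Δ⁽²⁾(x)(b ⊗ 1 ⊗ 1)`. -/
lemma coassoc₁₄ (x a b : A) : TensorProduct.assoc ℂ A A A
      ((G.T₁.toLinearMap ∘ₗ (TensorProduct.mk ℂ A A).flip b).rTensor A (G.T₄ (x ⊗ₜ a))) =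
    (G.T₄.toLinearMap ∘ₗ (TensorProduct.mk ℂ A A).flip a).lTensor A (G.T₁ (x ⊗ₜ b)) := by
  have hR : ∀ (f : A →ₗ[ℂ] A) (w : (A ⊗[ℂ] A) ⊗[ℂ] A),
      f.rTensor (A ⊗[ℂ] A) (TensorProduct.assoc ℂ A A A w) =
        TensorProduct.assoc ℂ A A A ((f.rTensor A).rTensor A w) := by
    intro f w
    induction w with
    | zero => simp
    | add x y hx hy => simp only [map_add, hx, hy]
    | tmul u c =>
      induction u with
      | zero => simp
      | add x y hx hy => simp only [TensorProduct.add_tmul, map_add, hx, hy]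
      | tmul u v => simp
  rw [← sub_eq_zero]
  refine eq_zero_of_rTensor_eq_zero (fun d : A => G.mul d)
    (fun b hb => G.right_faithful b hb) _ fun d => ?_
  have hc : ∀ c, (G.mul d).rTensor A ∘ₗ G.T₁.toLinearMap ∘ₗ
      (TensorProduct.mk ℂ A A).flip c = (G.mul.flip c).rTensor A ∘ₗ G.T₃.toLinearMap ∘ₗ
      (TensorProduct.mk ℂ A A).flip d := by
    intro c
    ext y
    simp [G.T₃_T₁]
  rw [map_sub, sub_eq_zero, hR, ← LinearMap.rTensor_comp_apply, hc, LinearMap.rTensor_comp_apply,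
    ← hR, G.coassoc₃₄, rTensor_lTensor_comm, G.T₃_T₁, rTensor_lTensor_comm]

/-- `(ι ⊙ φ)(Δ(x)(1 ⊗ b))`. -/
noncomputable def convL (φ : A →ₗ[ℂ] ℂ) (b : A) : A →ₗ[ℂ] A :=
  sliceSnd φ ∘ₗ G.T₂.toLinearMap ∘ₗ (TensorProduct.mk ℂ A A).flip b

/-- `(ι ⊙ φ)((1 ⊗ b)Δ(x))`. -/
noncomputable def convL' (φ : A →ₗ[ℂ] ℂ) (b : A) : A →ₗ[ℂ] A :=
  sliceSnd φ ∘ₗ G.T₄.toLinearMap ∘ₗ (TensorProduct.mk ℂ A A).flip b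

variable (φ : A →ₗ[ℂ] ℂ)

@[simp] lemma convL_apply (b x : A) : G.convL φ b x = sliceSnd φ (G.T₂ (x ⊗ₜ b)) := rfl
@[simp] lemma convL'_apply (b x : A) : G.convL' φ b x = sliceSnd φ (G.T₄ (x ⊗ₜ b)) := rfl

/-- `(q ⊗ 1)Δ((ι ⊙ ω)Δ(p)) = (ι ⊙ (ι ⊙ ω)Δ)((q ⊗ 1)Δ(p))` for `ω = φ(· b)`. -/
lemma T₃_convL (b p q : A) :
    G.T₃ (G.convL φ b p ⊗ₜ q) = (G.convL φ b).lTensor A (G.T₃ (p ⊗ₜ q)) := by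
  have h := congrArg ((sliceSnd φ).lTensor A) (G.coassoc p b q)
  rw [lTensor_sliceSnd_assoc, sliceSnd_rTensor, ← LinearMap.lTensor_comp_apply] at h
  exact h

/-- `(q ⊗ 1)Δ((ι ⊙ ω)Δ(p)) = (ι ⊙ (ι ⊙ ω)Δ)((q ⊗ 1)Δ(p))` for `ω = φ(b ·)`. -/
lemma T₃_convL' (b p q : A) :
    G.T₃ (G.convL' φ b p ⊗ₜ q) = (G.convL' φ b).lTensor A (G.T₃ (p ⊗ₜ q)) := by
  have h := congrArg ((sliceSnd φ).lTensor A) (G.coassoc₃₄ p b q)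
  rw [lTensor_sliceSnd_assoc, sliceSnd_rTensor, ← LinearMap.lTensor_comp_apply] at h
  exact h

lemma T₃_symm_lTensor (f : A →ₗ[ℂ] A)
    (hf : ∀ p q, G.T₃ (f p ⊗ₜ q) = f.lTensor A (G.T₃ (p ⊗ₜ q))) (z : A ⊗[ℂ] A) :
    G.T₃.symm (f.lTensor A z) = f.rTensor A (G.T₃.symm z) := by
  rw [LinearEquiv.symm_apply_eq]
  obtain ⟨w, rfl⟩ := G.T₃.surjective z
  rw [LinearEquiv.symm_apply_apply]
  induction w with
  | zero => simp
  | add x y hx hy => simp only [map_add, hx, hy]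
  | tmul p q => simp [hf]

/-- The product `p ⊗ q ↦ q p`. -/
noncomputable def mulOp : A ⊗[ℂ] A →ₗ[ℂ] A := TensorProduct.lift G.mul.flip

@[simp] lemma mulOp_tmul (p q : A) : G.mulOp (p ⊗ₜ q) = G.mul q p := rfl

lemma mulOp_convL (b : A) (w : A ⊗[ℂ] A) : G.mulOp ((G.convL φ b).rTensor A w) =
    sliceSnd (φ ∘ₗ G.mul.flip b) (G.T₃ w) := by
  induction w with
  | zero => simp
  | add x y hx hy => simp only [map_add, hx, hy]
  | tmul p q =>
    rw [LinearMap.rTensor_tmul, mulOp_tmul, convL_apply, ← sliceSnd_rTensor, ← G.T₃_T₂,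
      sliceSnd_lTensor]

lemma mulOp_convL' (b : A) (w : A ⊗[ℂ] A) : G.mulOp ((G.convL' φ b).rTensor A w) =
    sliceSnd (φ ∘ₗ G.mul b) (G.T₃ w) := by
  induction w with
  | zero => simp
  | add x y hx hy => simp only [map_add, hx, hy]
  | tmul p q =>
    rw [LinearMap.rTensor_tmul, mulOp_tmul, convL'_apply, ← sliceSnd_rTensor, ← G.T₃_T₄,
      sliceSnd_lTensor]

/-- `a ⊗ b ↦ (ι ⊙ φ)(Δ(a)(1 ⊗ b))` is onto `A`. -/
lemma convL_induction {φ : A →ₗ[ℂ] ℂ} (hφ : φ ≠ 0) {p : A → Prop}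
    (h : ∀ a b, p (G.convL φ b a)) (h0 : p 0) (hadd : ∀ x y, p x → p y → p (x + y)) (u : A) :
    p u := by
  obtain ⟨z, rfl⟩ := sliceSnd_surjective hφ u
  obtain ⟨w, rfl⟩ := G.T₂.surjective z
  induction w with
  | zero => simpa using h0
  | add x y hx hy => simpa only [map_add] using hadd _ _ hx hy
  | tmul a b => exact h a b

/-- The counit `ε`. Since `T₃⁻¹` commutes with `(ι ⊙ ω)Δ` on one leg, composing it with the product
sends `x ⊗ (ι ⊙ ω)Δ(p)` to `ω(p) x`, so `ε((ι ⊙ ω)Δ(p)) = ω(p)` is well defined. -/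
lemma exists_counit {φ : A →ₗ[ℂ] ℂ} (hφ : φ ≠ 0) : ∃ ε : A →ₗ[ℂ] ℂ,
    (∀ x u, G.mulOp (G.T₃.symm (x ⊗ₜ u)) = ε u • x) ∧
    (∀ b p, ε (G.convL φ b p) = φ (G.mul p b)) ∧
    (∀ b p, ε (G.convL' φ b p) = φ (G.mul b p)) ∧
    (∀ a c, sliceSnd ε (G.T₃ (a ⊗ₜ c)) = G.mul c a) := by
  obtain ⟨x₀, hx₀⟩ : ∃ x, φ x ≠ 0 := DFunLike.ne_iff.1 hφ
  have hL : ∀ x b p, G.mulOp (G.T₃.symm (x ⊗ₜ G.convL φ b p)) = φ (G.mul p b) • x := by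
    intro x b p
    rw [← LinearMap.lTensor_tmul, G.T₃_symm_lTensor _ (G.T₃_convL φ b), mulOp_convL,
      LinearEquiv.apply_symm_apply, sliceSnd_tmul]
    rfl
  have hL' : ∀ x b p, G.mulOp (G.T₃.symm (x ⊗ₜ G.convL' φ b p)) = φ (G.mul b p) • x := by
    intro x b p
    rw [← LinearMap.lTensor_tmul, G.T₃_symm_lTensor _ (G.T₃_convL' φ b), mulOp_convL',
      LinearEquiv.apply_symm_apply, sliceSnd_tmul]
    rfl
  let ε : A →ₗ[ℂ] ℂ := (φ x₀)⁻¹ • φ ∘ₗ G.mulOp ∘ₗ G.T₃.symm.toLinearMap ∘ₗ TensorProduct.mk ℂ A A x₀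
  have hε : ∀ u (t : ℂ), (∀ x, G.mulOp (G.T₃.symm (x ⊗ₜ u)) = t • x) → ε u = t := by
    intro u t ht
    simp [ε, ht, hx₀, mul_comm]
  have h1 : ∀ b p, ε (G.convL φ b p) = φ (G.mul p b) := fun b p => hε _ _ fun x => hL x b p
  refine ⟨ε, fun x u => ?_, h1, fun b p => hε _ _ fun x => hL' x b p, fun a c => ?_⟩
  · refine G.convL_induction hφ (p := fun u => G.mulOp (G.T₃.symm (x ⊗ₜ u)) = ε u • x)
      (fun a b => by rw [hL, h1]) (by simp) (fun u v hu hv => ?_) u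
    simp only [TensorProduct.tmul_add, map_add, hu, hv, add_smul]
  · refine G.convL_induction hφ (p := fun a => sliceSnd ε (G.T₃ (a ⊗ₜ c)) = G.mul c a)
      (fun a b => ?_) (by simp) (fun u v hu hv => ?_) a
    · have : ε ∘ₗ G.convL φ b = φ ∘ₗ G.mul.flip b := LinearMap.ext fun p => h1 b p
      rw [T₃_convL, sliceSnd_lTensor, this, ← sliceSnd_lTensor, G.T₃_T₂,
        sliceSnd_rTensor, convL_apply]
    · simp only [TensorProduct.add_tmul, map_add, hu, hv]

end CoveredCoproduct

/-! ### Faithfulness of invariant functionals -/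

/-- A tensor whose second leg is annihilated by a family of functionals has its second leg in their
common kernel. -/
lemma mem_range_lTensor_subtype {M N ι : Type*} [AddCommGroup M] [Module ℂ M] [AddCommGroup N]
    [Module ℂ N] (f : ι → N →ₗ[ℂ] ℂ) (K : Submodule ℂ N) (hK : ∀ n, (∀ i, f i n = 0) → n ∈ K)
    (w : M ⊗[ℂ] N) (hw : ∀ i, sliceSnd (f i) w = 0) :
    w ∈ LinearMap.range (K.subtype.lTensor M) := by
  let e := Module.Basis.ofVectorSpace ℂ M
  obtain ⟨b, rfl⟩ := TensorProduct.eq_repr_basis_left e w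
  have hb : ∀ i, b.mapRange (f i) (map_zero _) = 0 := by
    intro i
    refine linearIndependent_iff.1 e.linearIndependent _ ?_
    rw [← hw i, Finsupp.linearCombination_apply, Finsupp.sum_mapRange_index (by simp),
      Finsupp.sum, Finsupp.sum, map_sum]
    simp
  refine Submodule.sum_mem _ fun k _ => ?_
  have hk : b k ∈ K := hK _ fun i => by simpa using DFunLike.congr_fun (hb i) k
  exact ⟨e k ⊗ₜ ⟨b k, hk⟩, by simp⟩

namespace CoveredCoproduct

variable {A : Type*} [AddCommGroup A] [Module ℂ A] {G : CoveredCoproduct A} {φ : A →ₗ[ℂ] ℂ}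

lemma IsLeftInvariant.mul_convL' (h : G.IsLeftInvariant φ) (x a b : A) :
    G.mul x (G.convL' φ b a) = sliceFst (φ ∘ₗ G.mul.flip a) (G.T₃.symm (x ⊗ₜ b)) := by
  rw [convL'_apply, ← sliceSnd_rTensor, ← G.DR_tmul₄, ← sliceFst_rTensor, ← h.T₃_apply,
    ← G.DR_T₃_apply, LinearEquiv.apply_symm_apply]

/-- Left invariant functionals are faithful: if `φ(b a) = 0` for all `b` then `a = 0`. The set `K`
of all such `a` is stable under the Galois map `T₃` and its inverse, and this forces the counit to
vanish on `K`. -/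
theorem IsLeftInvariant.faithful (h : G.IsLeftInvariant φ) (a : A)
    (ha : ∀ b, φ (G.mul b a) = 0) : a = 0 := by
  obtain ⟨ε, hε, -, hεL', hεT⟩ := G.exists_counit h.ne_zero
  obtain ⟨x₀, hx₀⟩ : ∃ x, φ x ≠ 0 := DFunLike.ne_iff.1 h.ne_zero
  let K : Submodule ℂ A := ⨅ b, LinearMap.ker (φ ∘ₗ G.mul b)
  have hK : ∀ s, s ∈ K ↔ ∀ b, φ (G.mul b s) = 0 := by simp [K, Submodule.mem_iInf]
  -- `(ι ⊙ φ)((1 ⊗ b)Δ(s)) = 0` for `s ∈ K`; this places `T₃ (s ⊗ c)` in `A ⊙ K`.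
  have hL' : ∀ s ∈ K, ∀ b, G.convL' φ b s = 0 := fun s hs b => by
    refine G.right_faithful _ fun x => ?_
    have : φ ∘ₗ G.mul.flip s = 0 := LinearMap.ext ((hK s).1 hs)
    rw [h.mul_convL', this]
    simp [sliceFst]
  -- `T₃⁻¹(x₀ ⊗ s)` lies in `K ⊙ A`, so applying the product and then `φ` gives `0 = ε(s) φ(x₀)`.
  have hεK : ∀ s ∈ K, ε s = 0 := by
    intro s hs
    have hw : ∀ b, sliceFst (φ ∘ₗ G.mul b) (G.T₃.symm (x₀ ⊗ₜ s)) = 0 := fun b => by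
      have : φ ∘ₗ G.mul b = ε ∘ₗ G.convL' φ b := LinearMap.ext fun p => (hεL' b p).symm
      rw [this, ← sliceFst_rTensor, ← G.T₃_symm_lTensor _ (G.T₃_convL' φ b), LinearMap.lTensor_tmul,
        hL' s hs]
      simp
    obtain ⟨v, hv⟩ := mem_range_lTensor_subtype (fun b => φ ∘ₗ G.mul b) K
      (fun n hn => (hK n).2 hn) (TensorProduct.comm ℂ A A (G.T₃.symm (x₀ ⊗ₜ s)))
      (fun b => by simpa using hw b)
    have h0 : ∀ v : A ⊗[ℂ] K,
        φ (G.mulOp (TensorProduct.comm ℂ A A (K.subtype.lTensor A v))) = 0 := by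
      intro v
      induction v with
      | zero => simp
      | add x y hx hy => simp only [map_add, hx, hy, add_zero]
      | tmul q p => simpa using (hK p).1 p.2 q
    have h1 := h0 v
    rw [hv, TensorProduct.comm_comm, hε, map_smul, smul_eq_mul] at h1
    exact (mul_eq_zero.1 h1).resolve_right hx₀
  have haK : a ∈ K := (hK a).2 ha
  refine G.right_faithful _ fun c => ?_
  obtain ⟨v, hv⟩ := mem_range_lTensor_subtype (fun b => φ ∘ₗ G.mul b) K
    (fun n hn => (hK n).2 hn) (G.T₃ (a ⊗ₜ c)) (fun b => by
      rw [← G.mulOp_convL', LinearMap.rTensor_tmul, hL' a haK]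
      simp)
  have h0 : ε ∘ₗ K.subtype = 0 := LinearMap.ext fun s => hεK s s.2
  rw [← hεT, ← hv, sliceSnd_lTensor, h0]
  simp [sliceSnd]

/-! ### The antipode -/

/-- The antipode. It is determined by `S((ι ⊙ φ)(Δ(a)(1 ⊗ b))) = (ι ⊙ φ)((1 ⊗ a)Δ(b))`, and it
satisfies `x S(u) = (ε ⊙ ι)(T₃⁻¹(x ⊗ u))`, which shows that the first formula is consistent. -/
theorem IsLeftInvariant.exists_antipode (h : G.IsLeftInvariant φ) : ∃ S : A →ₗ[ℂ] A,
    (∀ a b, S (G.convL φ b a) = G.convL' φ a b) ∧ Function.Surjective S ∧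
    ∀ a b, S (G.mul a b) = G.mul (S b) (S a) := by
  obtain ⟨ε, hε, hεL, -, -⟩ := G.exists_counit h.ne_zero
  obtain ⟨x₀, hx₀⟩ : ∃ x, φ x ≠ 0 := DFunLike.ne_iff.1 h.ne_zero
  let P : A ⊗[ℂ] A →ₗ[ℂ] A := sliceSnd φ ∘ₗ G.T₂.toLinearMap
  let N : A ⊗[ℂ] A →ₗ[ℂ] A := sliceSnd φ ∘ₗ G.T₄.toLinearMap ∘ₗ
    (TensorProduct.comm ℂ A A).toLinearMap
  have hP : Function.Surjective P := (sliceSnd_surjective h.ne_zero).comp G.T₂.surjective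
  have hN : Function.Surjective N := (sliceSnd_surjective h.ne_zero).comp
    (G.T₄.surjective.comp (TensorProduct.comm ℂ A A).surjective)
  have key : ∀ x w, G.mul x (N w) = sliceFst ε (G.T₃.symm (x ⊗ₜ P w)) := by
    intro x w
    induction w with
    | zero => simp
    | add u v hu hv => simp only [map_add, TensorProduct.tmul_add, hu, hv]
    | tmul a b =>
      have h1 : ε ∘ₗ G.convL φ b = φ ∘ₗ G.mul.flip b := LinearMap.ext fun p => hεL b p
      have h2 : G.T₃.symm (x ⊗ₜ P (a ⊗ₜ b)) =
          (G.convL φ b).rTensor A (G.T₃.symm (x ⊗ₜ a)) := by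
        rw [← G.T₃_symm_lTensor _ (G.T₃_convL φ b)]
        rfl
      rw [h2, sliceFst_rTensor, h1, ← h.mul_convL']
      rfl
  obtain ⟨s, hs⟩ := P.exists_rightInverse_of_surjective (LinearMap.range_eq_top.2 hP)
  have hS : ∀ x u, G.mul x (N (s u)) = sliceFst ε (G.T₃.symm (x ⊗ₜ u)) := by
    intro x u
    rw [key]
    have : P (s u) = u := LinearMap.congr_fun hs u
    rw [this]
  have hSP : ∀ w, N (s (P w)) = N w := fun w => by
    rw [← sub_eq_zero]
    refine G.right_faithful _ fun x => ?_
    rw [map_sub, hS, key, sub_self]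
  -- `Y a (T₃⁻¹(x ⊗ b)) = T₃⁻¹(x ⊗ a b)`
  let Y : A → A ⊗[ℂ] A →ₗ[ℂ] A ⊗[ℂ] A := fun a => TensorProduct.lift (LinearMap.mk₂ ℂ
    (fun p q => (G.mul.flip p).rTensor A (G.T₃.symm (q ⊗ₜ a)))
    (fun p p' q => by simp [LinearMap.rTensor_add])
    (fun c p q => by simp [LinearMap.rTensor_smul])
    (fun p q q' => by simp [TensorProduct.add_tmul])
    (fun c p q => by simp [← TensorProduct.smul_tmul']))
  have hYt : ∀ a p q, Y a (p ⊗ₜ q) = (G.mul.flip p).rTensor A (G.T₃.symm (q ⊗ₜ a)) :=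
    fun _ _ _ => rfl
  have hY : ∀ a x b, Y a (G.T₃.symm (x ⊗ₜ b)) = G.T₃.symm (x ⊗ₜ G.mul a b) := by
    intro a x b
    rw [LinearEquiv.eq_symm_apply]
    have : ∀ w, G.T₃ (Y a w) = (G.mul a).lTensor A (G.T₃ w) := by
      intro w
      induction w with
      | zero => simp
      | add u v hu hv => simp only [map_add, hu, hv]
      | tmul p q => rw [hYt, ← G.DR_T₃_apply, LinearEquiv.apply_symm_apply, G.DR_tmul₃]
    rw [this, LinearEquiv.apply_symm_apply, LinearMap.lTensor_tmul]
  have hεm : ∀ a b, ε (G.mul a b) = ε a * ε b := by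
    intro a b
    have hYm : ∀ w, G.mulOp (Y a w) = ε a • G.mulOp w := by
      intro w
      induction w with
      | zero => simp
      | add u v hu hv => simp only [map_add, hu, hv, smul_add]
      | tmul p q =>
        have h1 : ∀ z, G.mulOp ((G.mul.flip p).rTensor A z) = G.mul (G.mulOp z) p := by
          intro z
          induction z with
          | zero => simp
          | add u v hu hv => simp only [map_add, LinearMap.add_apply, hu, hv]
          | tmul u v => simp [G.assoc]
        rw [hYt, h1, hε, mulOp_tmul, map_smul, LinearMap.smul_apply]
    have h1 := hYm (G.T₃.symm (x₀ ⊗ₜ b))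
    rw [hY, hε, hε, smul_smul] at h1
    have h2 := congrArg φ h1
    simpa [hx₀] using h2
  refine ⟨N ∘ₗ s, fun a b => hSP (a ⊗ₜ b), fun u => ?_, fun a b => ?_⟩
  · obtain ⟨w, rfl⟩ := hN u
    exact ⟨P w, hSP w⟩
  have hεY : ∀ w, sliceFst ε (Y a w) = sliceFst ε (G.T₃.symm (sliceFst ε w ⊗ₜ a)) := by
    intro w
    induction w with
    | zero => simp
    | add u v hu hv => simp only [map_add, TensorProduct.add_tmul, hu, hv]
    | tmul p q =>
      have : ε ∘ₗ G.mul.flip p = ε p • ε := LinearMap.ext fun z => by simp [hεm, mul_comm]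
      rw [hYt, sliceFst_rTensor, this, sliceFst_tmul, ← TensorProduct.smul_tmul']
      simp [sliceFst, LinearMap.rTensor_smul]
  rw [← sub_eq_zero]
  refine G.right_faithful _ fun x => ?_
  simp only [LinearMap.comp_apply]
  rw [map_sub, sub_eq_zero, hS, ← hY, hεY, ← G.assoc, hS, hS]

/-- `Δ((ι ⊙ φ)(Δ(c)(1 ⊗ b)))(1 ⊗ d) = ∑ (ι ⊙ φ)(Δ(c)(1 ⊗ eᵢ)) ⊗ fᵢ` if `d ⊗ b = ∑ Δ(eᵢ)(fᵢ ⊗ 1)`. -/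
lemma IsLeftInvariant.T₂_convL (h : G.IsLeftInvariant φ) (b c d : A) :
    G.T₂ (G.convL φ b c ⊗ₜ d) = (sliceSnd φ ∘ₗ G.T₂.toLinearMap ∘ₗ
      TensorProduct.mk ℂ A A c).rTensor A (G.T₁.symm (d ⊗ₜ b)) := by
  set w := G.T₁.symm (d ⊗ₜ b) with hw
  rw [← sub_eq_zero]
  refine eq_zero_of_rTensor_eq_zero (fun q : A => G.mul q)
    (fun b hb => G.right_faithful b hb) _ fun q => ?_
  rw [map_sub, sub_eq_zero, ← G.T₃_T₂, G.T₃_convL]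
  have h1 : ∀ s, G.mul (G.convL φ b s) d = sliceFst (φ ∘ₗ G.mul s) w := by
    intro s
    rw [convL_apply, ← LinearMap.flip_apply, ← sliceSnd_rTensor, ← G.DL_tmul₂, ← sliceFst_rTensor,
      ← h.T₁_apply, ← G.DL_T₁_apply, hw, LinearEquiv.apply_symm_apply]
  let Θ : A →ₗ[ℂ] A ⊗[ℂ] A →ₗ[ℂ] A := LinearMap.mk₂ ℂ (fun s v => sliceFst (φ ∘ₗ G.mul s) v)
    (fun s s' v => by simp [LinearMap.comp_add, sliceFst, LinearMap.rTensor_add])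
    (fun c s v => by simp [LinearMap.comp_smul, sliceFst, LinearMap.rTensor_smul])
    (fun s v v' => by simp) (fun c s v => by simp)
  have hΘ : ∀ s v, Θ s v = sliceFst (φ ∘ₗ G.mul s) v := fun _ _ => rfl
  have h2 : ∀ z, (G.mul.flip d).lTensor A ((G.convL φ b).lTensor A z) =
      (Θ.flip w).lTensor A z := by
    intro z
    induction z with
    | zero => simp
    | add u v hu hv => simp only [map_add, hu, hv]
    | tmul r s => simp only [LinearMap.lTensor_tmul, LinearMap.flip_apply, h1, hΘ]
  rw [h2]
  clear h2 h1 hw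
  clear_value w
  induction w with
  | zero => simp
  | add u v hu hv => simp only [map_add, LinearMap.lTensor_add, LinearMap.add_apply, hu, hv]
  | tmul e f =>
    have h3 : G.mul q (sliceSnd φ (G.T₂ (c ⊗ₜ e))) =
        sliceSnd (φ ∘ₗ G.mul.flip e) (G.T₃ (c ⊗ₜ q)) := by
      rw [← sliceSnd_rTensor, ← G.T₃_T₂, sliceSnd_lTensor]
    simp only [LinearMap.rTensor_tmul, LinearMap.comp_apply, TensorProduct.mk_apply,
      LinearEquiv.coe_coe, h3]
    generalize G.T₃ (c ⊗ₜ q) = z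
    induction z with
    | zero => simp
    | add u v hu hv => simp only [map_add, TensorProduct.add_tmul, hu, hv]
    | tmul r s => simp [hΘ, TensorProduct.smul_tmul]

/-- For every `c`, the functional `y ↦ (φ ⊙ φ)((1 ⊗ c)Δ(y))` is left invariant. -/
lemma IsLeftInvariant.slice_T₄ (h : G.IsLeftInvariant φ) (c e f : A) :
    sliceSnd (φ ∘ₗ G.convL' φ c) (G.T₁ (e ⊗ₜ f)) = φ (G.convL' φ c e) • f := by
  have h1 := congrArg (fun z => sliceSnd φ ((sliceSnd φ).lTensor A z)) (G.coassoc₁₄ e c f)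
  simp only [lTensor_sliceSnd_assoc, sliceSnd_rTensor, ← LinearMap.lTensor_comp_apply] at h1
  rw [sliceSnd_lTensor] at h1
  refine h1.symm.trans ?_
  simp [h.T₁]

/-- If `S` is the antipode, then `φ ∘ S` is right invariant. With `a = (ι ⊙ φ)(Δ(c)(1 ⊗ b))` and
`d ⊗ b = ∑ Δ(eᵢ)(fᵢ ⊗ 1)`, the element `(φS ⊙ ι)(Δ(a)(1 ⊗ d))` is `∑ χ(eᵢ) fᵢ`, where
`χ(y) = (φ ⊙ φ)((1 ⊗ c)Δ(y))` satisfies `χ(b) = φ(S(a))`; left invariance of `χ` turns the sum into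
`χ(b) d`. -/
lemma IsLeftInvariant.comp_antipode (h : G.IsLeftInvariant φ) {S : A →ₗ[ℂ] A}
    (hS : ∀ a b, S (G.convL φ b a) = G.convL' φ a b) (hsurj : Function.Surjective S) :
    G.IsRightInvariant (φ ∘ₗ S) := by
  have hT₂ : ∀ a d, sliceFst (φ ∘ₗ S) (G.T₂ (a ⊗ₜ d)) = (φ ∘ₗ S) a • d := by
    intro a d
    refine G.convL_induction h.ne_zero
      (p := fun a => sliceFst (φ ∘ₗ S) (G.T₂ (a ⊗ₜ d)) = (φ ∘ₗ S) a • d) (fun c b => ?_) (by simp)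
      (fun u v hu hv => by simp only [TensorProduct.add_tmul, map_add, hu, hv, add_smul]) a
    have h1 : (φ ∘ₗ S) ∘ₗ (sliceSnd φ ∘ₗ G.T₂.toLinearMap ∘ₗ TensorProduct.mk ℂ A A c) =
        φ ∘ₗ G.convL' φ c := LinearMap.ext fun e => congrArg φ (hS c e)
    have h2 : ∀ w, sliceSnd (φ ∘ₗ G.convL' φ c) (G.T₁ w) = sliceFst (φ ∘ₗ G.convL' φ c) w := by
      intro w
      induction w with
      | zero => simp
      | add u v hu hv => simp only [map_add, hu, hv]
      | tmul e f => rw [h.slice_T₄, sliceFst_tmul]; rfl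
    rw [h.T₂_convL, sliceFst_rTensor, h1, ← h2, LinearEquiv.apply_symm_apply, sliceSnd_tmul,
      LinearMap.comp_apply, LinearMap.comp_apply, hS]
  refine ⟨fun h0 => ?_, fun a b => ?_, fun a b => ?_⟩
  · refine h.ne_zero (LinearMap.ext fun x => ?_)
    obtain ⟨y, rfl⟩ := hsurj x
    exact LinearMap.congr_fun h0 y
  · rw [mirror_T₁, sliceSnd_comm, ← sub_eq_zero]
    refine G.left_faithful _ fun c => ?_
    rw [← LinearMap.flip_apply, map_sub, ← sliceFst_lTensor, G.T₄_T₂, sliceFst_lTensor, hT₂]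
    simp
  · rw [mirror_T₃, sliceSnd_comm, hT₂]

end CoveredCoproduct

/-! ### The functionals `φ(· a)` and `ψ(c ·)` -/

namespace CoveredCoproduct

variable {A : Type*} [AddCommGroup A] [Module ℂ A] {G : CoveredCoproduct A} {φ ψ : A →ₗ[ℂ] ℂ}

/-- The functionals `φ(· a)` and `ψ(· a')` built from a left and a right invariant functional
agree when `a` and `a'` come from the same `z = Δ(p)(q ⊗ 1) = Δ(p')(1 ⊗ q')`: both are slices of
`y ↦ (ψ ⊙ φ)(Δ(y) z)`. -/
lemma IsLeftInvariant.apply_mul_slice (h : G.IsLeftInvariant φ) (h' : G.IsRightInvariant ψ)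
    (z : A ⊗[ℂ] A) (y : A) : φ (G.mul y (sliceSnd ψ (G.T₁.symm z))) =
      ψ (G.mul y (sliceSnd φ (G.T₂.symm z))) := by
  rw [← sliceSnd_rTensor ψ (G.mul y), ← sliceSnd_rTensor φ (G.mul y), ← apply_sliceFst φ ψ,
    ← apply_sliceFst ψ φ, ← h.T₁_apply, ← h'.T₂_apply, ← G.DL_T₁_apply, ← G.DL_T₂_apply,
    LinearEquiv.apply_symm_apply, LinearEquiv.apply_symm_apply, apply_sliceFst]

lemma IsLeftInvariant.exists_right_of_left (h : G.IsLeftInvariant φ) (h' : G.IsRightInvariant ψ)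
    (a : A) : ∃ a', ∀ y, φ (G.mul y a) = ψ (G.mul y a') := by
  obtain ⟨w, rfl⟩ := sliceSnd_surjective h'.ne_zero a
  refine ⟨sliceSnd φ (G.T₂.symm (G.T₁ w)), fun y => ?_⟩
  rw [← h.apply_mul_slice h' (G.T₁ w), LinearEquiv.symm_apply_apply]

lemma IsLeftInvariant.exists_left_of_right (h : G.IsLeftInvariant φ) (h' : G.IsRightInvariant ψ)
    (a' : A) : ∃ a, ∀ y, φ (G.mul y a) = ψ (G.mul y a') := by
  obtain ⟨w, rfl⟩ := sliceSnd_surjective h.ne_zero a'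
  refine ⟨sliceSnd ψ (G.T₁.symm (G.T₂ w)), fun y => ?_⟩
  rw [h.apply_mul_slice h' (G.T₂ w), LinearEquiv.symm_apply_apply]

/-- `(φS(b ·) ⊙ φ(· a))Δ = φ(· b')` with `b' = (φ ⊙ ι)(Δ(a)(S(b) ⊗ 1))`. -/
lemma apply_antipode_mul_convL {S : A →ₗ[ℂ] A}
    (hS : ∀ a b, S (G.convL φ b a) = G.convL' φ a b)
    (hmul : ∀ a b, S (G.mul a b) = G.mul (S b) (S a)) (a b y : A) :
    φ (S (G.mul b (G.convL φ a y))) = φ (G.mul y (sliceFst φ (G.T₁ (a ⊗ₜ S b)))) := by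
  rw [hmul, hS, convL'_apply, ← LinearMap.flip_apply, ← sliceSnd_rTensor, G.T₄_T₁,
    ← sliceFst_lTensor, apply_sliceFst]

/-- There is a right invariant functional `ψ` and a linear bijection `σ` of `A` with
`φ(y σ(c)) = ψ(c y)`, so that `{φ(· a)} = {ψ(c ·)}`. Here `ψ = φ ∘ S`; both sets of functionals are
spanned by the convolution products of `ψ(b ·)` and `φ(· a)`. -/
theorem IsLeftInvariant.exists_rightInvariant (h : G.IsLeftInvariant φ) :
    ∃ (ψ : A →ₗ[ℂ] ℂ) (σ : A ≃ₗ[ℂ] A), G.IsRightInvariant ψ ∧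
      ∀ c y, φ (G.mul y (σ c)) = ψ (G.mul c y) := by
  obtain ⟨S, hS, hSs, hSm⟩ := h.exists_antipode
  have hψ := h.comp_antipode hS hSs
  set ψ := φ ∘ₗ S with hψS
  obtain ⟨S', hS', hSs', hSm'⟩ := IsLeftInvariant.exists_antipode hψ
  have hφ'' := IsLeftInvariant.comp_antipode hψ hS' hSs'
  set φ' := ψ ∘ₗ S' with hφS'
  have hφ' : G.IsLeftInvariant φ' :=
    ⟨hφ''.ne_zero, fun a b => by simpa [mirror_T₁, mirror_T₄] using IsLeftInvariant.T₁ hφ'' a b,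
      fun a b => by simpa [mirror_T₂, mirror_T₃] using IsLeftInvariant.T₃ hφ'' a b⟩
  -- Both sides are `(ψ(b ·) ⊙ φ(· a))Δ(y)`.
  have key : ∀ a a' b, (∀ y, φ (G.mul y a) = φ' (G.mul y a')) → ∀ y,
      φ (G.mul y (sliceFst φ (G.T₁ (a ⊗ₜ S b)))) =
        ψ (G.mul (sliceSnd ψ (G.T₄ (b ⊗ₜ S' a'))) y) := by
    intro a a' b haa y
    have h1 := apply_antipode_mul_convL hS hSm a b y
    have h2 := apply_antipode_mul_convL hS' hSm' b a' y
    have h3 : φ ∘ₗ G.mul.flip a = φ' ∘ₗ G.mul.flip a' := LinearMap.ext haa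
    rw [mirror_T₁, sliceFst_comm, mirror_mul, mirror_mul] at h2
    rw [← h1, ← h2]
    change ψ _ = φ' _
    rw [convL_apply, ← sliceSnd_rTensor, ← G.T₃_T₂, sliceSnd_lTensor, h3, convL_apply, mirror_T₂,
      sliceSnd_comm, ← apply_sliceFst]
    rfl
  have hto : ∀ a, ∃ c, ∀ y, φ (G.mul y a) = ψ (G.mul c y) := by
    intro a
    obtain ⟨z, rfl⟩ := sliceFst_surjective h.ne_zero a
    obtain ⟨w, rfl⟩ := G.T₁.surjective z
    induction w with
    | zero => exact ⟨0, by simp⟩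
    | add u v hu hv =>
      obtain ⟨c, hc⟩ := hu
      obtain ⟨d, hd⟩ := hv
      exact ⟨c + d, fun y => by simp only [map_add, LinearMap.add_apply, hc, hd]⟩
    | tmul a b =>
      obtain ⟨b, rfl⟩ := hSs b
      obtain ⟨a₁, ha₁⟩ := h.exists_right_of_left hψ a
      obtain ⟨a', ha'⟩ := hφ'.exists_left_of_right hψ a₁
      exact ⟨_, key a a' b fun y => by rw [ha₁, ha']⟩
  have hfrom : ∀ c, ∃ a, ∀ y, φ (G.mul y a) = ψ (G.mul c y) := by
    intro c
    obtain ⟨z, rfl⟩ := sliceSnd_surjective hψ.ne_zero c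
    obtain ⟨w, rfl⟩ := G.T₄.surjective z
    induction w with
    | zero => exact ⟨0, by simp⟩
    | add u v hu hv =>
      obtain ⟨c, hc⟩ := hu
      obtain ⟨d, hd⟩ := hv
      exact ⟨c + d, fun y => by simp only [map_add, LinearMap.add_apply, hc, hd]⟩
    | tmul b a' =>
      obtain ⟨a', rfl⟩ := hSs' a'
      obtain ⟨a₁, ha₁⟩ := hφ'.exists_right_of_left hψ a'
      obtain ⟨a, ha⟩ := h.exists_left_of_right hψ a₁
      exact ⟨_, key a a' b fun y => by rw [ha, ha₁]⟩
  have hinj : ∀ a a', (∀ y, φ (G.mul y a) = φ (G.mul y a')) → a = a' := fun a a' haa =>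
    sub_eq_zero.1 (h.faithful _ fun b => by rw [map_sub, map_sub, haa, sub_self])
  choose f hf using hfrom
  let σ : A →ₗ[ℂ] A :=
    { toFun := f
      map_add' := fun c d => hinj _ _ fun y => by simp [hf]
      map_smul' := fun t c => hinj _ _ fun y => by simp [hf] }
  refine ⟨ψ, LinearEquiv.ofBijective σ ⟨fun c d hcd => ?_, fun a => ?_⟩, hψ, hf⟩
  · refine sub_eq_zero.1 (IsLeftInvariant.faithful hψ _ fun y => ?_)
    rw [mirror_mul, map_sub, LinearMap.sub_apply, map_sub, ← hf, ← hf, sub_eq_zero]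
    exact congrArg (fun a => φ (G.mul y a)) hcd
  · obtain ⟨c, hc⟩ := hto a
    exact ⟨c, hinj _ _ fun y => by rw [hc]; exact hf c y⟩

/-- Every element has a right local unit. -/
lemma IsRightInvariant.exists_right_unit (h : G.IsRightInvariant ψ) (c : A) :
    ∃ f, G.mul c f = c := by
  by_contra hcon
  have hmem : c ∉ LinearMap.range (G.mul c) := by
    rintro ⟨e, he⟩
    exact hcon ⟨e, he⟩
  obtain ⟨ω, hωc, hω⟩ := Submodule.exists_le_ker_of_notMem hmem
  obtain ⟨d, hd⟩ : ∃ d, ψ d ≠ 0 := DFunLike.ne_iff.1 h.ne_zero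
  have hω' : ω ∘ₗ G.mul c = 0 := LinearMap.ext fun e => hω ⟨e, rfl⟩
  have hm : sliceSnd ω (G.T₄ (d ⊗ₜ c)) = 0 := by
    refine G.left_faithful _ fun e => ?_
    rw [← LinearMap.flip_apply, ← sliceSnd_rTensor, G.T₄_T₁, sliceSnd_lTensor, hω']
    simp [sliceSnd]
  have h1 := apply_sliceFst ψ ω (G.T₄ (d ⊗ₜ c))
  rw [hm, h.T₄, map_zero, map_smul, smul_eq_mul] at h1
  exact mul_ne_zero hd hωc h1

end CoveredCoproduct

/-! ### The Galois maps of an algebraic quantum group -/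

open Multiplier

section

variable {A B : Type*}
  [NonUnitalRing A] [Module ℂ A] [IsScalarTower ℂ A A] [SMulCommClass ℂ A A]
  [NonUnitalRing B] [Module ℂ B] [IsScalarTower ℂ B B] [SMulCommClass ℂ B B]

lemma tmul_mul_eq_map (a : A) (b : B) (z : A ⊗[ℂ] B) : (a ⊗ₜ b) * z =
    (LinearMap.mulLeft ℂ b).lTensor A ((LinearMap.mulLeft ℂ a).rTensor B z) := by
  induction z with
  | zero => simp
  | add u v hu hv => simp only [mul_add, map_add, hu, hv]
  | tmul u v => simp

lemma mul_tmul_eq_map (a : A) (b : B) (z : A ⊗[ℂ] B) : z * (a ⊗ₜ b) =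
    (LinearMap.mulRight ℂ b).lTensor A ((LinearMap.mulRight ℂ a).rTensor B z) := by
  induction z with
  | zero => simp
  | add u v hu hv => simp only [add_mul, map_add, hu, hv]
  | tmul u v => simp

end

namespace RegularMultiplierHopf

variable {A : Type*}
  [NonUnitalRing A] [Module ℂ A] [IsScalarTower ℂ A A] [SMulCommClass ℂ A A]
  [NondegenerateAlgebra A] (H : RegularMultiplierHopf A)

lemma ext_mul_left {x y : A ⊗[ℂ] A} (h : ∀ z, z * x = z * y) : x = y :=
  sub_eq_zero.1 (NondegenerateAlgebra.right_faithful _ fun z => by rw [mul_sub, h, sub_self])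

/-- The data of `(A, Δ)` in terms of the Galois maps. -/
def covered : CoveredCoproduct A where
  mul := LinearMap.mul ℂ A
  assoc := mul_assoc
  left_faithful := NondegenerateAlgebra.left_faithful
  right_faithful := NondegenerateAlgebra.right_faithful
  T₁ := H.T₁
  T₂ := H.T₂
  T₃ := H.T₃
  T₄ := H.T₄
  DL a := (H.Δ a).left
  DR a := (H.Δ a).right
  DL_T₁ := H.T₁_mul_left
  DL_T₂ a p q := ext_mul fun z => by
    rw [← left_mul', T₂_mul, T₂_mul, LinearMap.mul_apply', map_mul, mul_left_apply]
  DR_T₃ a p q := ext_mul_left fun z => by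
    rw [← right_mul', mul_T₃, mul_T₃, LinearMap.mul_apply', map_mul, mul_right_apply]
  DR_T₄ a p q := ext_mul_left fun z => by
    rw [← right_mul', mul_T₄, mul_T₄, LinearMap.mul_apply', map_mul, mul_right_apply]
  DL_tmul₁ a x y := ext_mul fun z => by
    have h := tmul_mul_assoc_snd (H.T₁ (a ⊗ₜ x)) z y
    rw [T₁_mul, rTensor_lTensor, ← tmul_mul_eq_map] at h
    rw [← left_mul']
    exact h.symm
  DL_tmul₂ a x y := ext_mul fun z => by
    have h := tmul_mul_assoc_fst (H.T₂ (a ⊗ₜ y)) z x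
    rw [T₂_mul, ← tmul_mul_eq_map] at h
    rw [← left_mul']
    exact h.symm
  DR_tmul₃ a x y := ext_mul_left fun z => by
    have h := tmul_mul_assoc_snd z (H.T₃ (a ⊗ₜ x)) y
    rw [mul_T₃, rTensor_lTensor, ← mul_tmul_eq_map] at h
    rw [← right_mul']
    exact h
  DR_tmul₄ a x y := ext_mul_left fun z => by
    have h := tmul_mul_assoc_fst z (H.T₄ (a ⊗ₜ y)) x
    rw [mul_T₄, ← mul_tmul_eq_map] at h
    rw [← right_mul']
    exact h
  T₃_T₁ := H.T₃_T₁
  T₄_T₁ := H.T₄_T₁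
  T₃_T₂ := H.T₃_T₂
  T₄_T₂ a b c := ext_mul fun z => by
    have h1 := tmul_mul_assoc_snd (H.T₄ (a ⊗ₜ c)) z b
    have h2 := mulLeft_lTensor_mul (H.T₂ (a ⊗ₜ b)) z c
    rw [T₄_mul] at h1
    rw [T₂_mul] at h2
    exact h1.trans h2.symm
  coassoc x a b := LeftHaar.coassoc_elements H x a b

lemma covered_mul (a b : A) : H.covered.mul a b = a * b := rfl
lemma covered_T₁ : H.covered.T₁ = H.T₁ := rfl
lemma covered_T₄ : H.covered.T₄ = H.T₄ := rfl

end RegularMultiplierHopf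

namespace LeftHaar

variable {A : Type*}
  [NonUnitalRing A] [Module ℂ A] [IsScalarTower ℂ A A] [SMulCommClass ℂ A A]
  [NondegenerateAlgebra A] {H : RegularMultiplierHopf A} (h : LeftHaar H)

lemma isLeftInvariant : H.covered.IsLeftInvariant h.φ where
  ne_zero := h.ne_zero
  T₁ a b := congrArg (fun T => Multiplier.left T b) (h.invariant a)
  T₃ a b := congrArg (fun T => Multiplier.right T b) (h.invariant a)

lemma dualMk_injective : Function.Injective h.dualMk := by
  intro a a' haa
  refine sub_eq_zero.1 (h.isLeftInvariant.faithful _ fun b => ?_)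
  have := LinearMap.congr_fun (congrArg (Dual.functional h) haa) b
  simpa [RegularMultiplierHopf.covered_mul, mul_sub, sub_eq_zero] using this

/-- The linear bijection `a ↦ φ(· a)` of `A` onto `Â`. -/
noncomputable def dualEquiv : A ≃ₗ[ℂ] h.Dual :=
  LinearEquiv.ofBijective h.dualMk ⟨h.dualMk_injective, dualMk_surjective⟩

@[simp] lemma dualEquiv_apply (a : A) : h.dualEquiv a = h.dualMk a := rfl

/-- `Â` consists of the functionals `ψ(c ·)` for a right invariant functional `ψ`. -/
lemma exists_right : ∃ (ψ : A →ₗ[ℂ] ℂ) (κ : A ≃ₗ[ℂ] h.Dual), H.covered.IsRightInvariant ψ ∧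
    ∀ c y, Dual.functional h (κ c) y = ψ (c * y) := by
  obtain ⟨ψ, σ, hψ, hσ⟩ := h.isLeftInvariant.exists_rightInvariant
  exact ⟨ψ, σ.trans h.dualEquiv, hψ, hσ⟩

/-- A right invariant functional on `A`. -/
noncomputable def ψ : A →ₗ[ℂ] ℂ := h.exists_right.choose

/-- The linear bijection `c ↦ ψ(c ·)` of `A` onto `Â`. -/
noncomputable def dualEquivRight : A ≃ₗ[ℂ] h.Dual := h.exists_right.choose_spec.choose

lemma isRightInvariant : H.covered.IsRightInvariant h.ψ :=
  h.exists_right.choose_spec.choose_spec.1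

@[simp] lemma functional_dualEquivRight (c y : A) :
    Dual.functional h (h.dualEquivRight c) y = h.ψ (c * y) :=
  h.exists_right.choose_spec.choose_spec.2 c y

lemma exists_right_unit (h : LeftHaar H) (c : A) : ∃ f, c * f = c :=
  h.isRightInvariant.exists_right_unit c

end LeftHaar

/-! ### The universal corepresentation -/

/-- A multiplier that acts bijectively from both sides is invertible. -/
lemma Multiplier.isUnit_of_bijective {A : Type*} [NonUnitalRing A] [Module ℂ A]
    [IsScalarTower ℂ A A] [SMulCommClass ℂ A A] (T : Multiplier A) (L R : A ≃ₗ[ℂ] A)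
    (hL : ∀ x, T.left x = L x) (hR : ∀ x, T.right x = R x) : IsUnit T := by
  let S : Multiplier A := Multiplier.mk L.symm.toLinearMap R.symm.toLinearMap
    (fun x y => L.injective (by
      simp only [LinearEquiv.coe_coe, LinearEquiv.apply_symm_apply]
      rw [← hL, left_mul', hL, LinearEquiv.apply_symm_apply]))
    (fun x y => R.injective (by
      simp only [LinearEquiv.coe_coe, LinearEquiv.apply_symm_apply]
      rw [← hR, right_mul', hR, LinearEquiv.apply_symm_apply]))
    (fun x y => by
      have := T.mul_left_eq (R.symm x) (L.symm y)
      rw [hL, hR, LinearEquiv.apply_symm_apply, LinearEquiv.apply_symm_apply] at this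
      exact this.symm)
  have h1 : T * S = 1 := ext_both (LinearMap.ext fun x => by simp [S, hL])
    (LinearMap.ext fun x => by simp [S, hR])
  have h2 : S * T = 1 := ext_both (LinearMap.ext fun x => by simp [S, hL])
    (LinearMap.ext fun x => by simp [S, hR])
  exact ⟨⟨T, S, h1, h2⟩, rfl⟩

section

variable {A : Type*}
  [NonUnitalRing A] [Module ℂ A] [IsScalarTower ℂ A A] [SMulCommClass ℂ A A]
  [NondegenerateAlgebra A] {H : RegularMultiplierHopf A} (h : LeftHaar H)

open LeftHaar

namespace LeftHaar

variable {h} in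
/-- The functionals in `Â` separate the points of `A`. -/
lemma eq_of_functional_eq {u v : A}
    (huv : ∀ ω : h.Dual, Dual.functional h ω u = Dual.functional h ω v) : u = v := by
  refine sub_eq_zero.1 (CoveredCoproduct.IsLeftInvariant.faithful h.isRightInvariant _ fun b => ?_)
  obtain ⟨a, ha⟩ := h.isLeftInvariant.exists_left_of_right h.isRightInvariant b
  rw [CoveredCoproduct.mirror_mul, ← ha]
  have := huv (h.dualMk a)
  simpa [RegularMultiplierHopf.covered_mul, sub_mul, sub_eq_zero] using this

/-- The element `(ω ⊙ ι)Δ(y)` of `A`, for `ω ∈ Â`. -/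
noncomputable def ract (ω : h.Dual) (y : A) : A := sliceFst h.φ (H.T₁ (y ⊗ₜ h.dualEquiv.symm ω))

lemma ract_dualMk (a y : A) : h.ract (h.dualMk a) y = sliceFst h.φ (H.T₁ (y ⊗ₜ a)) := by
  rw [ract, ← dualEquiv_apply, LinearEquiv.symm_apply_apply]

lemma mul_ract (ω : h.Dual) (x y : A) :
    x * h.ract ω y = sliceFst (Dual.functional h ω) (H.T₄ (y ⊗ₜ x)) := by
  obtain ⟨a, rfl⟩ := dualMk_surjective ω
  rw [ract_dualMk, functional_dualMk, ← LinearMap.mulLeft_apply (R := ℂ), ← sliceFst_lTensor,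
    ← H.T₄_T₁, sliceFst_rTensor]
  rfl

/-- `(ω ω')(y) = ω'((ω ⊙ ι)Δ(y))`. -/
lemma functional_ract (ω ω' : h.Dual) (y : A) :
    Dual.functional h ω' (h.ract ω y) = Dual.functional h (ω * ω') y := by
  obtain ⟨a, rfl⟩ := dualMk_surjective ω
  rw [ract_dualMk, apply_sliceFst, ← act_mul, mul_apply]
  rfl

lemma ract_mul (ω ω' : h.Dual) (y : A) : h.ract (ω * ω') y = h.ract ω' (h.ract ω y) :=
  eq_of_functional_eq fun χ => by
    rw [functional_ract, functional_ract, functional_ract, mul_assoc]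

lemma act_ract (ω ω' : h.Dual) (y : A) : act ω' (h.ract ω y) = h.ract ω (act ω' y) :=
  eq_of_functional_eq fun χ => by
    rw [← mul_apply, functional_ract, functional_ract, ← mul_apply, mul_assoc]

end LeftHaar

@[simp] lemma evalAt_tmul (x y : A) (ω : h.Dual) :
    evalAt h y (x ⊗ₜ ω) = Dual.functional h ω y • x := by
  simp [evalAt]

variable {h} in
lemma evalAt_ext {M : Type*} [AddCommGroup M] [Module ℂ M] {z z' : M ⊗[ℂ] h.Dual}
    (hz : ∀ y, sliceSnd (LinearMap.applyₗ y ∘ₗ Dual.functional h) z =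
      sliceSnd (LinearMap.applyₗ y ∘ₗ Dual.functional h) z') : z = z' := by
  rw [← sub_eq_zero]
  refine eq_zero_of_lTensor_eq_zero (fun y => LinearMap.applyₗ y ∘ₗ Dual.functional h)
    (fun ω hω => Dual.functional_injective (LinearMap.ext fun y => by simpa using hω y)) _
    fun y => (TensorProduct.rid ℂ M).injective ?_
  rw [map_zero, map_sub, map_sub]
  exact sub_eq_zero.2 (hz y)

lemma evalAt_mul_tmul (z : A ⊗[ℂ] h.Dual) (x y : A) (ω : h.Dual) :
    evalAt h y (z * (x ⊗ₜ ω)) = evalAt h (act ω y) z * x := by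
  induction z with
  | zero => simp
  | add u v hu hv => simp only [add_mul, map_add, hu, hv]
  | tmul u v => simp [LeftHaar.mul_apply, smul_mul_assoc]

lemma evalAt_tmul_mul (z : A ⊗[ℂ] h.Dual) (x y : A) (ω : h.Dual) :
    evalAt h y ((x ⊗ₜ ω) * z) = x * evalAt h (h.ract ω y) z := by
  induction z with
  | zero => simp
  | add u v hu hv => simp only [mul_add, map_add, hu, hv]
  | tmul u v => simp [functional_ract, mul_smul_comm]

/-- The left action `x ⊗ a φ ↦ ∑ qᵢ ⊗ pᵢ φ` of the universal corepresentation, where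
`x ⊗ a = ∑ Δ(pᵢ)(qᵢ ⊗ 1)`. -/
noncomputable def universalLeft : A ⊗[ℂ] h.Dual ≃ₗ[ℂ] A ⊗[ℂ] h.Dual :=
  (LinearEquiv.lTensor A h.dualEquiv.symm).trans <| H.T₁.symm.trans <|
    (TensorProduct.comm ℂ A A).trans <| LinearEquiv.lTensor A h.dualEquiv

/-- The right action `x ⊗ ψ(c ·) ↦ ∑ qᵢ ⊗ ψ(pᵢ ·)` of the universal corepresentation, where
`c ⊗ x = ∑ (1 ⊗ qᵢ)Δ(pᵢ)`. -/
noncomputable def universalRight : A ⊗[ℂ] h.Dual ≃ₗ[ℂ] A ⊗[ℂ] h.Dual :=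
  (LinearEquiv.lTensor A h.dualEquivRight.symm).trans <| (TensorProduct.comm ℂ A A).trans <|
    H.T₄.symm.trans <| (TensorProduct.comm ℂ A A).trans <| LinearEquiv.lTensor A h.dualEquivRight

lemma universalLeft_tmul (x a : A) : universalLeft h (x ⊗ₜ h.dualMk a) =
    h.dualMk.lTensor A (TensorProduct.comm ℂ A A (H.T₁.symm (x ⊗ₜ a))) := by
  simp only [universalLeft, LinearEquiv.trans_apply, LinearEquiv.lTensor_tmul, ← dualEquiv_apply,
    LinearEquiv.symm_apply_apply]
  rfl

lemma universalRight_tmul (x c : A) : universalRight h (x ⊗ₜ h.dualEquivRight c) =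
    h.dualEquivRight.toLinearMap.lTensor A (TensorProduct.comm ℂ A A (H.T₄.symm (c ⊗ₜ x))) := by
  simp only [universalRight, LinearEquiv.trans_apply, LinearEquiv.lTensor_tmul,
    LinearEquiv.symm_apply_apply, TensorProduct.comm_tmul]
  rfl

lemma evalAt_universalLeft (x y : A) (ω : h.Dual) :
    evalAt h y (universalLeft h (x ⊗ₜ ω)) = act ω y * x := by
  obtain ⟨a, rfl⟩ := dualMk_surjective ω
  have h1 := h.isLeftInvariant.T₁_apply
    ((LinearMap.mulLeft ℂ y).rTensor A (H.T₁.symm (x ⊗ₜ a)))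
  have h2 : H.T₁ ((LinearMap.mulLeft ℂ y).rTensor A (H.T₁.symm (x ⊗ₜ a))) =
      (LinearMap.mulRight ℂ a).lTensor A (H.T₁ (y ⊗ₜ x)) := by
    have := H.covered.DL_T₁_apply y (H.T₁.symm (x ⊗ₜ a))
    rw [RegularMultiplierHopf.covered_T₁, LinearEquiv.apply_symm_apply, H.covered.DL_tmul₁] at this
    exact this.symm
  rw [RegularMultiplierHopf.covered_T₁, h2, sliceSnd_lTensor] at h1
  rw [act_mul, universalLeft_tmul, evalAt, sliceSnd_lTensor, sliceSnd_comm]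
  refine Eq.trans ?_ h1.symm
  rw [sliceFst_rTensor]
  rfl

lemma evalAt_universalRight (x y : A) (ω : h.Dual) :
    evalAt h y (universalRight h (x ⊗ₜ ω)) = x * h.ract ω y := by
  obtain ⟨c, rfl⟩ := h.dualEquivRight.surjective ω
  have h1 := CoveredCoproduct.IsLeftInvariant.T₁_apply h.isRightInvariant
    ((LinearMap.mulRight ℂ y).rTensor A (H.T₄.symm (c ⊗ₜ x)))
  have h2 : H.T₄ ((LinearMap.mulRight ℂ y).rTensor A (H.T₄.symm (c ⊗ₜ x))) =
      (LinearMap.mulLeft ℂ c).rTensor A (H.T₄ (y ⊗ₜ x)) := by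
    have := H.covered.mirror.DL_T₁_apply y (H.T₄.symm (c ⊗ₜ x))
    replace this := congrArg (TensorProduct.comm ℂ A A) this
    simp only [CoveredCoproduct.mirror, LinearEquiv.trans_apply, LinearMap.comp_apply,
      LinearEquiv.coe_coe, TensorProduct.comm_comm, RegularMultiplierHopf.covered_T₄,
      LinearEquiv.apply_symm_apply, H.covered.DR_tmul₄] at this
    exact this.symm
  rw [CoveredCoproduct.mirror_T₁, sliceSnd_comm, RegularMultiplierHopf.covered_T₄, h2,
    sliceFst_rTensor] at h1
  have h3 : Dual.functional h (h.dualEquivRight c) = h.ψ ∘ₗ LinearMap.mulLeft ℂ c :=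
    LinearMap.ext fun z => by simp
  rw [mul_ract, universalRight_tmul, evalAt, sliceSnd_lTensor, sliceSnd_comm, h3]
  refine Eq.trans ?_ h1.symm
  rw [sliceFst_rTensor]
  congr 2
  exact LinearMap.ext fun z => by simp

/-- The universal corepresentation `U ∈ M(A ⊙ Â)`. -/
noncomputable def universalCorepresentation : Multiplier (A ⊗[ℂ] h.Dual) :=
  Multiplier.mk (universalLeft h).toLinearMap (universalRight h).toLinearMap
    (tensor_induction₂ (fun x ω x' ω' => evalAt_ext fun y => by
        change evalAt h y _ = evalAt h y _
        simp only [LinearEquiv.coe_coe, evalAt_mul_tmul, Algebra.TensorProduct.tmul_mul_tmul,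
          evalAt_universalLeft, act_dualMul, mul_assoc])
      (by simp) (by simp) (by intro x y z hx hy; simp only [add_mul, map_add, hx, hy])
      (by intro x y z hx hy; simp only [mul_add, map_add, hx, hy]))
    (tensor_induction₂ (fun x ω x' ω' => evalAt_ext fun y => by
        change evalAt h y _ = evalAt h y _
        simp only [LinearEquiv.coe_coe, evalAt_tmul_mul, Algebra.TensorProduct.tmul_mul_tmul,
          evalAt_universalRight, ract_mul, mul_assoc])
      (by simp) (by simp) (by intro x y z hx hy; simp only [add_mul, map_add, hx, hy])
      (by intro x y z hx hy; simp only [mul_add, map_add, hx, hy]))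
    (tensor_induction₂ (fun x ω x' ω' => evalAt_ext fun y => by
        change evalAt h y _ = evalAt h y _
        simp only [LinearEquiv.coe_coe, evalAt_mul_tmul, evalAt_tmul_mul, evalAt_universalLeft,
          evalAt_universalRight, act_ract, mul_assoc])
      (by simp) (by simp) (by intro x y z hx hy; simp only [add_mul, map_add, hx, hy])
      (by intro x y z hx hy; simp only [mul_add, map_add, hx, hy]))

lemma universalCorepresentation_left (z : A ⊗[ℂ] h.Dual) :
    (universalCorepresentation h).left z = universalLeft h z := rfl

lemma universalCorepresentation_right (z : A ⊗[ℂ] h.Dual) :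
    (universalCorepresentation h).right z = universalRight h z := rfl

lemma isUniversalCorepresentation_universalCorepresentation :
    IsUniversalCorepresentation h (universalCorepresentation h) :=
  ⟨fun x y ω => by rw [universalCorepresentation_left, evalAt_universalLeft, act_mul],
    fun x y ω => by rw [universalCorepresentation_right, evalAt_universalRight, mul_ract]⟩

variable {h} in
lemma IsUniversalCorepresentation.unique {U U' : Multiplier (A ⊗[ℂ] h.Dual)}
    (hU : IsUniversalCorepresentation h U) (hU' : IsUniversalCorepresentation h U') : U = U' :=
  ext_both
    (TensorProduct.ext' fun x ω => evalAt_ext fun y => (hU.1 x y ω).trans (hU'.1 x y ω).symm)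
    (TensorProduct.ext' fun x ω => evalAt_ext fun y => (hU.2 x y ω).trans (hU'.2 x y ω).symm)

lemma isUnit_universalCorepresentation : IsUnit (universalCorepresentation h) :=
  isUnit_of_bijective _ (universalLeft h) (universalRight h) (fun _ => rfl) (fun _ => rfl)

end

/-! ### Corepresentations from homomorphisms -/

namespace NondegHom

variable {A B C : Type*}
  [NonUnitalRing A] [Module ℂ A] [IsScalarTower ℂ A A] [SMulCommClass ℂ A A]
  [NonUnitalRing B] [Module ℂ B] [IsScalarTower ℂ B B] [SMulCommClass ℂ B B]
  [NonUnitalRing C] [Module ℂ C] [IsScalarTower ℂ C C] [SMulCommClass ℂ C C]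
  (π : NondegHom A B)

/-- `B` is spanned by the elements `π(a) e`. -/
lemma actLeft_induction {p : B → Prop} (hp : ∀ a e, p ((π a).left e)) (h0 : p 0)
    (hadd : ∀ x y, p x → p y → p (x + y)) (hsmul : ∀ (c : ℂ) x, p x → p (c • x)) (b : B) :
    p b := by
  have hb : b ∈ Submodule.span ℂ {x : B | ∃ a b, x = (π a).left b} := by
    rw [π.span_left]
    trivial
  induction hb using Submodule.span_induction with
  | mem x hx =>
    obtain ⟨a, e, rfl⟩ := hx
    exact hp a e
  | zero => exact h0
  | add x y _ _ hx hy => exact hadd _ _ hx hy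
  | smul t x _ hx => exact hsmul _ _ hx

lemma lTensor_actLeft_induction {p : C ⊗[ℂ] B → Prop} (h0 : p 0)
    (hadd : ∀ x y, p x → p y → p (x + y)) (hp : ∀ e c a, p ((π.actLeft e).lTensor C (c ⊗ₜ a)))
    (w : C ⊗[ℂ] B) : p w := by
  induction w with
  | zero => exact h0
  | add x y hx hy => exact hadd _ _ hx hy
  | tmul c b =>
    have : ∀ c, p (c ⊗ₜ b) := by
      refine π.actLeft_induction (p := fun b => ∀ c, p (c ⊗ₜ b)) (fun a e c => hp e c a)
        (fun c => by simpa using h0)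
        (fun x y hx hy c => by rw [TensorProduct.tmul_add]; exact hadd _ _ (hx c) (hy c))
        (fun t x hx c => by rw [← TensorProduct.smul_tmul]; exact hx _) b
    exact this c

variable [NondegenerateAlgebra B] [NondegenerateAlgebra C]

lemma coamplify_left (V : Multiplier (C ⊗[ℂ] A)) (e : B) (z : C ⊗[ℂ] A) :
    (π.coamplify C V).left ((π.actLeft e).lTensor C z) = (π.actLeft e).lTensor C (V.left z) := by
  have hc : (TensorProduct.comm ℂ B C).symm ((π.actLeft e).lTensor C z) =
      (π.actLeft e).rTensor C (TensorProduct.comm ℂ C A z) := by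
    rw [LinearEquiv.symm_apply_eq, comm_rTensor]
    exact congrArg _ (TensorProduct.comm_comm ..).symm
  rw [coamplify, transport_left, hc, amplify_left, transport_left, LinearEquiv.symm_apply_apply,
    comm_rTensor]
  congr 1
  exact TensorProduct.comm_comm ..

lemma coamplify_one : π.coamplify C 1 = 1 := by
  refine ext_left fun w => ?_
  refine π.lTensor_actLeft_induction (p := fun w =>
    (π.coamplify C 1).left w = (1 : Multiplier _).left w)
    (by simp) (fun x y hx hy => by rw [map_add, map_add, hx, hy]) (fun e c a => ?_) w
  rw [coamplify_left]
  rfl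

lemma coamplify_mul (V W : Multiplier (C ⊗[ℂ] A)) :
    π.coamplify C (V * W) = π.coamplify C V * π.coamplify C W := by
  refine ext_left fun w => ?_
  refine π.lTensor_actLeft_induction (p := fun w => (π.coamplify C (V * W)).left w =
    (π.coamplify C V * π.coamplify C W).left w)
    (by simp) (fun x y hx hy => by rw [map_add, map_add, hx, hy]) (fun e c a => ?_) w
  rw [coamplify_left, mul_left_apply, mul_left_apply, coamplify_left, coamplify_left]

lemma isUnit_coamplify {V : Multiplier (C ⊗[ℂ] A)} (hV : IsUnit V) :
    IsUnit (π.coamplify C V) := by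
  obtain ⟨⟨V, W, h1, h2⟩, rfl⟩ := hV
  exact ⟨⟨π.coamplify C V, π.coamplify C W, by rw [← coamplify_mul, h1, coamplify_one],
    by rw [← coamplify_mul, h2, coamplify_one]⟩, rfl⟩

end NondegHom

section

variable {A B : Type*}
  [NonUnitalRing A] [Module ℂ A] [IsScalarTower ℂ A A] [SMulCommClass ℂ A A]
  [NondegenerateAlgebra A]
  [NonUnitalRing B] [Module ℂ B] [IsScalarTower ℂ B B] [SMulCommClass ℂ B B]
  {H : RegularMultiplierHopf A} (h : LeftHaar H)

open LeftHaar

lemma leg23_left (V : Multiplier (A ⊗[ℂ] B)) : (leg23 V).left = V.left.lTensor A := rfl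

lemma leg13_left (V : Multiplier (A ⊗[ℂ] B)) (w : A ⊗[ℂ] (A ⊗[ℂ] B)) : (leg13 V).left w =
    TensorProduct.leftComm ℂ A A B (V.left.lTensor A ((TensorProduct.leftComm ℂ A A B).symm w)) :=
  rfl

lemma leftComm_symm_lTensor {M : Type*} [AddCommGroup M] [Module ℂ M] (f : M →ₗ[ℂ] B)
    (w : A ⊗[ℂ] (A ⊗[ℂ] M)) :
    (TensorProduct.leftComm ℂ A A B).symm ((f.lTensor A).lTensor A w) =
      (f.lTensor A).lTensor A ((TensorProduct.leftComm ℂ A A M).symm w) := by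
  rw [LinearEquiv.symm_apply_eq]
  obtain ⟨w, rfl⟩ := (TensorProduct.leftComm ℂ A A M).surjective w
  rw [LinearEquiv.symm_apply_apply]
  induction w with
  | zero => simp
  | add x y hx hy => simp only [map_add, hx, hy]
  | tmul a z =>
    induction z with
    | zero => simp
    | add x y hx hy => simp only [TensorProduct.tmul_add, map_add, hx, hy]
    | tmul a b => simp

lemma assoc_lTensor {M : Type*} [AddCommGroup M] [Module ℂ M] (f : M →ₗ[ℂ] B)
    (w : (A ⊗[ℂ] A) ⊗[ℂ] M) :
    TensorProduct.assoc ℂ A A B (f.lTensor (A ⊗[ℂ] A) w) =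
      (f.lTensor A).lTensor A (TensorProduct.assoc ℂ A A M w) := by
  induction w with
  | zero => simp
  | add x y hx hy => simp only [map_add, hx, hy]
  | tmul z b =>
    induction z with
    | zero => simp
    | add x y hx hy => simp only [TensorProduct.add_tmul, map_add, hx, hy]
    | tmul a b => simp

/-- If `f` intertwines the left actions of `W` and `V`, it intertwines those of `W₁₃W₂₃` and
`V₁₃V₂₃`. -/
lemma leg13_leg23_intertwine {M : Type*} [NonUnitalRing M] [Module ℂ M] [IsScalarTower ℂ M M]
    [SMulCommClass ℂ M M] {V : Multiplier (A ⊗[ℂ] B)} {W : Multiplier (A ⊗[ℂ] M)}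
    (f : M →ₗ[ℂ] B) (hf : ∀ z, V.left (f.lTensor A z) = f.lTensor A (W.left z))
    (w : A ⊗[ℂ] (A ⊗[ℂ] M)) :
    (leg13 V * leg23 V).left ((f.lTensor A).lTensor A w) =
      (f.lTensor A).lTensor A ((leg13 W * leg23 W).left w) := by
  have hf' : V.left ∘ₗ f.lTensor A = f.lTensor A ∘ₗ W.left := LinearMap.ext hf
  have h1 : ∀ w, V.left.lTensor A ((f.lTensor A).lTensor A w) =
      (f.lTensor A).lTensor A (W.left.lTensor A w) := fun w => by
    rw [← LinearMap.lTensor_comp_apply, hf', LinearMap.lTensor_comp_apply]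
  rw [mul_left_apply, mul_left_apply, leg23_left, leg23_left, h1, leg13_left, leg13_left,
    leftComm_symm_lTensor, h1, ← LinearEquiv.eq_symm_apply, leftComm_symm_lTensor,
    LinearEquiv.symm_apply_apply]

/-- `Δ(act ω y)(x ⊗ 1) = (ι ⊙ act ω)(Δ(y)(x ⊗ 1))`. -/
lemma LeftHaar.T₁_act (ω : h.Dual) (x y : A) :
    H.T₁ (act ω y ⊗ₜ x) = (act ω).lTensor A (H.T₁ (y ⊗ₜ x)) := by
  obtain ⟨a, rfl⟩ := dualMk_surjective ω
  have hact : act (h.dualMk a) = H.covered.convL h.φ a := LinearMap.ext fun y => act_dualMk a y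
  rw [← sub_eq_zero]
  refine eq_zero_of_rTensor_eq_zero (fun c : A => LinearMap.mulLeft ℂ c)
    (fun b hb => NondegenerateAlgebra.right_faithful b hb) _ fun c => ?_
  rw [map_sub, sub_eq_zero, ← H.T₃_T₁, rTensor_lTensor_comm, ← H.T₃_T₁, hact,
    ← rTensor_lTensor_comm]
  exact congrArg _ (H.covered.T₃_convL h.φ a y c)

/-- The operator `y ↦ z(y)` on `A` given by `z ∈ A ⊙ Â`. -/
noncomputable def toOperator : A ⊗[ℂ] h.Dual →ₗ[ℂ] A →ₗ[ℂ] A :=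
  TensorProduct.lift (LinearMap.mk₂ ℂ (fun x ω => (Dual.functional h ω).smulRight x)
    (fun x x' ω => by ext; simp) (fun c x ω => by ext; exact smul_comm _ _ _)
    (fun x ω ω' => by ext; simp [add_smul]) (fun c x ω => by ext; simp [mul_smul]))

lemma toOperator_apply (z : A ⊗[ℂ] h.Dual) (y : A) : toOperator h z y = evalAt h y z := by
  induction z with
  | zero => simp
  | add u v hu hv => simp only [map_add, LinearMap.add_apply, hu, hv]
  | tmul x ω => rw [evalAt_tmul]; rfl

/-- The universal corepresentation satisfies `(Δ ⊙ ι)(U) = U₁₃U₂₃`: on `Z ⊗ ω` the operator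
`U₁₃U₂₃` takes the value `Δ(act ω y) Z` at `y`. -/
lemma evalAt_leg13_leg23 (y : A) (Z : A ⊗[ℂ] A) (ω : h.Dual) :
    sliceSnd (LinearMap.applyₗ y ∘ₗ Dual.functional h) ((TensorProduct.assoc ℂ A A h.Dual).symm
      ((leg13 (universalCorepresentation h) * leg23 (universalCorepresentation h)).left
        (TensorProduct.assoc ℂ A A h.Dual (Z ⊗ₜ ω)))) = (H.Δ (act ω y)).left Z := by
  -- `U₁₃` alone: `[U₁₃(x ⊗ w)](y) = (ι ⊙ w)(Δ(y)(x ⊗ 1))`, with `w` regarded as an operator on `A`.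
  have h13 : ∀ x (w : A ⊗[ℂ] h.Dual), sliceSnd (LinearMap.applyₗ y ∘ₗ Dual.functional h)
      ((TensorProduct.assoc ℂ A A h.Dual).symm
        ((leg13 (universalCorepresentation h)).left (x ⊗ₜ w))) =
      (toOperator h w).lTensor A (H.T₁ (y ⊗ₜ x)) := by
    intro x w
    induction w with
    | zero => simp
    | add u v hu hv =>
      simp only [TensorProduct.tmul_add, map_add, LinearMap.lTensor_add, LinearMap.add_apply,
        hu, hv]
    | tmul x' χ =>
      have h1 : ∀ z : A ⊗[ℂ] h.Dual, sliceSnd (LinearMap.applyₗ y ∘ₗ Dual.functional h)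
          ((TensorProduct.assoc ℂ A A h.Dual).symm (TensorProduct.leftComm ℂ A A h.Dual
            (x' ⊗ₜ z))) = evalAt h y z ⊗ₜ x' := by
        intro z
        induction z with
        | zero => simp
        | add u v hu hv =>
          simp only [TensorProduct.tmul_add, map_add, TensorProduct.add_tmul, hu, hv]
        | tmul p ξ => simp [TensorProduct.smul_tmul']
      rw [leg13_left, TensorProduct.leftComm_symm_tmul, LinearMap.lTensor_tmul, h1,
        universalCorepresentation_left, evalAt_universalLeft, act_mul]
      generalize H.T₁ (y ⊗ₜ x) = z
      induction z with
      | zero => simp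
      | add u v hu hv => simp only [map_add, TensorProduct.add_tmul, hu, hv]
      | tmul r s => simp [toOperator, TensorProduct.smul_tmul]
  induction Z with
  | zero => simp
  | add u v hu hv => simp only [TensorProduct.add_tmul, map_add, hu, hv]
  | tmul x x' =>
    have h2 : toOperator h (universalLeft h (x' ⊗ₜ ω)) = LinearMap.mulRight ℂ x' ∘ₗ act ω :=
      LinearMap.ext fun s => by rw [toOperator_apply, evalAt_universalLeft]; rfl
    rw [TensorProduct.assoc_tmul, mul_left_apply, leg23_left, LinearMap.lTensor_tmul, h13,
      universalCorepresentation_left, h2, LinearMap.lTensor_comp_apply, ← T₁_act]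
    exact (H.covered.DL_tmul₁ _ _ _).symm

lemma universalCorepresentation_corep (e : A ⊗[ℂ] A) (z : A ⊗[ℂ] h.Dual) :
    TensorProduct.assoc ℂ A A h.Dual ((H.Δ.actLeft e).rTensor h.Dual
      ((universalCorepresentation h).left z)) =
    (leg13 (universalCorepresentation h) * leg23 (universalCorepresentation h)).left
      (TensorProduct.assoc ℂ A A h.Dual ((H.Δ.actLeft e).rTensor h.Dual z)) := by
  rw [← LinearEquiv.eq_symm_apply]
  induction z with
  | zero => simp
  | add u v hu hv => simp only [map_add, hu, hv]
  | tmul a ω =>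
    refine evalAt_ext fun y => ?_
    rw [LinearMap.rTensor_tmul, evalAt_leg13_leg23, sliceSnd_rTensor]
    change H.Δ.actLeft e (evalAt h y _) = _
    rw [universalCorepresentation_left, evalAt_universalLeft, NondegHom.actLeft_apply,
      NondegHom.actLeft_apply, map_mul, mul_left_apply]

variable [NondegenerateAlgebra B] (θ : NondegHom h.Dual B)

lemma isCorepresentation_coamplify :
    IsCorepresentation H (θ.coamplify A (universalCorepresentation h)) := by
  refine ext_left fun w => ?_
  obtain ⟨w, rfl⟩ := (TensorProduct.assoc ℂ A A B).surjective w
  rw [transport_left, LinearEquiv.symm_apply_apply]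
  obtain ⟨w, rfl⟩ := H.Δ.mulMap_surjective B w
  induction w with
  | zero => simp
  | add u v hu hv => simp only [map_add, hu, hv]
  | tmul z e =>
    rw [NondegHom.mulMap_tmul, NondegHom.amplify_left]
    refine θ.lTensor_actLeft_induction (p := fun z =>
      TensorProduct.assoc ℂ A A B ((H.Δ.actLeft e).rTensor B
        ((θ.coamplify A (universalCorepresentation h)).left z)) =
      (leg13 (θ.coamplify A (universalCorepresentation h)) *
        leg23 (θ.coamplify A (universalCorepresentation h))).left
        (TensorProduct.assoc ℂ A A B ((H.Δ.actLeft e).rTensor B z))) (by simp)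
      (fun x y hx hy => by simp only [map_add, hx, hy]) (fun b x ω => ?_) z
    rw [NondegHom.coamplify_left, rTensor_lTensor_comm, rTensor_lTensor_comm, assoc_lTensor,
      assoc_lTensor, universalCorepresentation_corep,
      leg13_leg23_intertwine _ (θ.coamplify_left _ b)]

/-- `(φ ⊙ ι)(U(a ⊗ ω)) = (a φ) ω`. -/
lemma sliceFst_universalLeft (a : A) (ω : h.Dual) :
    sliceFst h.φ (universalLeft h (a ⊗ₜ ω)) = h.dualMk a * ω := by
  refine Dual.functional_injective (LinearMap.ext fun y => ?_)
  rw [LeftHaar.mul_apply, functional_dualMk, toDual_apply, ← evalAt_universalLeft]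
  exact apply_sliceFst h.φ (LinearMap.applyₗ y ∘ₗ Dual.functional h) _

lemma isInducedHom_coamplify :
    IsInducedHom h (θ.coamplify A (universalCorepresentation h)) θ.toHom := by
  intro ω
  obtain ⟨a, rfl⟩ := dualMk_surjective ω
  refine LinearMap.ext fun b => ?_
  refine θ.actLeft_induction (p := fun b => (θ (h.dualMk a)).left b =
    slice h (θ.coamplify A (universalCorepresentation h)) (h.dualMk a) b) (fun ω' e => ?_)
    (by simp) (fun x y hx hy => by rw [map_add, map_add, hx, hy])
    (fun c x hx => by rw [map_smul, map_smul, hx]) b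
  have h1 := θ.coamplify_left (universalCorepresentation h) e (a ⊗ₜ ω')
  rw [LinearMap.lTensor_tmul, NondegHom.actLeft_apply] at h1
  rw [slice_dualMk, h1, sliceFst_lTensor, universalCorepresentation_left, sliceFst_universalLeft,
    NondegHom.actLeft_apply, map_mul, mul_left_apply]

end

/-! ### Homomorphisms from corepresentations -/

open LeftHaar

lemma eq_of_forall_mul_eq {A : Type*} [NonUnitalRing A] [NondegenerateAlgebra A] {x y : A}
    (hxy : ∀ z, x * z = y * z) : x = y :=
  sub_eq_zero.1 (NondegenerateAlgebra.left_faithful _ fun z => by rw [sub_mul, hxy, sub_self])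

section

variable {A B : Type*}
  [NonUnitalRing A] [Module ℂ A] [IsScalarTower ℂ A A] [SMulCommClass ℂ A A]
  [NondegenerateAlgebra A]
  [NonUnitalRing B] [Module ℂ B] [IsScalarTower ℂ B B] [SMulCommClass ℂ B B]

lemma mul_rTensor_mulRight (a : A) (w z : A ⊗[ℂ] B) : w * (LinearMap.mulRight ℂ a).rTensor B z =
    (LinearMap.mulRight ℂ a).rTensor B (w * z) := by
  revert w z
  exact tensor_induction₂ (by intro a b a' b'; simp [mul_assoc]) (by simp) (by simp)
    (by intro x y z hx hy; simp only [add_mul, map_add, hx, hy])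
    (by intro x y z hx hy; simp only [mul_add, map_add, hx, hy])

lemma rTensor_mulLeft_mul (a : A) (w z : A ⊗[ℂ] B) : (LinearMap.mulLeft ℂ a).rTensor B w * z =
    (LinearMap.mulLeft ℂ a).rTensor B (w * z) := by
  revert w z
  exact tensor_induction₂ (by intro a b a' b'; simp [mul_assoc]) (by simp) (by simp)
    (by intro x y z hx hy; simp only [add_mul, map_add, hx, hy])
    (by intro x y z hx hy; simp only [mul_add, map_add, hx, hy])

variable [NondegenerateAlgebra B]

lemma left_rTensor_mulRight (V : Multiplier (A ⊗[ℂ] B)) (a : A) (z : A ⊗[ℂ] B) :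
    V.left ((LinearMap.mulRight ℂ a).rTensor B z) =
      (LinearMap.mulRight ℂ a).rTensor B (V.left z) := by
  refine sub_eq_zero.1 (NondegenerateAlgebra.right_faithful _ fun w => ?_)
  rw [mul_sub, V.mul_left_eq, mul_rTensor_mulRight, mul_rTensor_mulRight, V.mul_left_eq, sub_self]

lemma right_rTensor_mulLeft (V : Multiplier (A ⊗[ℂ] B)) (a : A) (z : A ⊗[ℂ] B) :
    V.right ((LinearMap.mulLeft ℂ a).rTensor B z) =
      (LinearMap.mulLeft ℂ a).rTensor B (V.right z) := by
  refine sub_eq_zero.1 (NondegenerateAlgebra.left_faithful _ fun w => ?_)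
  rw [sub_mul, ← V.mul_left_eq, rTensor_mulLeft_mul, rTensor_mulLeft_mul, V.mul_left_eq, sub_self]

variable {H : RegularMultiplierHopf A}

/-- `(Δ ⊙ ι)(V)(Δ(p)(q ⊗ 1) ⊗ b) = (Δ ⊙ ι)(V(p ⊗ b))(q ⊗ 1 ⊗ 1)`. -/
lemma amplify_left_T₁ (V : Multiplier (A ⊗[ℂ] B)) (p q : A) (b : B) :
    (H.Δ.amplify B V).left (H.T₁ (p ⊗ₜ q) ⊗ₜ b) =
      (H.T₁.toLinearMap ∘ₗ (TensorProduct.mk ℂ A A).flip q).rTensor B (V.left (p ⊗ₜ b)) := by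
  have h1 : ∀ (Z : A ⊗[ℂ] A) (b' : B) (v : A ⊗[ℂ] B),
      (H.T₁.toLinearMap ∘ₗ (TensorProduct.mk ℂ A A).flip q).rTensor B v * (Z ⊗ₜ b') =
        (LinearMap.mulRight ℂ b').lTensor (A ⊗[ℂ] A)
          ((H.Δ.actLeft ((LinearMap.mulLeft ℂ q).rTensor A Z)).rTensor B v) := by
    intro Z b' v
    induction v with
    | zero => simp
    | add x y hx hy => simp only [add_mul, map_add, hx, hy]
    | tmul r s => simp [RegularMultiplierHopf.T₁_mul]
  have h2 : ∀ (b' : B) (v : A ⊗[ℂ] B), V.left ((LinearMap.mulRight ℂ b').lTensor A v) =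
      (LinearMap.mulRight ℂ b').lTensor A (V.left v) := by
    intro b' v
    have h3 : ∀ w z : A ⊗[ℂ] B, w * (LinearMap.mulRight ℂ b').lTensor A z =
        (LinearMap.mulRight ℂ b').lTensor A (w * z) :=
      tensor_induction₂ (by intro a b a' b'; simp [mul_assoc]) (by simp) (by simp)
        (by intro x y z hx hy; simp only [add_mul, map_add, hx, hy])
        (by intro x y z hx hy; simp only [mul_add, map_add, hx, hy])
    refine sub_eq_zero.1 (NondegenerateAlgebra.right_faithful _ fun w => ?_)
    rw [mul_sub, V.mul_left_eq, h3, h3, V.mul_left_eq, sub_self]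
  refine eq_of_forall_mul_eq (A := (A ⊗[ℂ] A) ⊗[ℂ] B) fun w => ?_
  induction w with
  | zero => simp
  | add x y hx hy => rw [mul_add, mul_add, hx, hy]
  | tmul Z b' =>
    have h4 := NondegHom.amplify_left H.Δ V ((LinearMap.mulLeft ℂ q).rTensor A Z)
      ((LinearMap.mulRight ℂ b').lTensor A (p ⊗ₜ b))
    rw [h2, LinearMap.lTensor_tmul, LinearMap.rTensor_tmul, rTensor_lTensor_comm, ← h1] at h4
    rw [← h4, ← left_mul', Algebra.TensorProduct.tmul_mul_tmul, H.T₁_mul]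
    rfl

variable (h : LeftHaar H)

/-- If `V` is a corepresentation, then `V(x ⊗ (ω ⊙ ι)(V)b) = (ι ⊙ π_V(·)b)(U(x ⊗ ω))`. -/
lemma IsCorepresentation.left_slice {V : Multiplier (A ⊗[ℂ] B)} (hV : IsCorepresentation H V)
    (x : A) (ω : h.Dual) (b : B) : V.left (x ⊗ₜ slice h V ω b) =
      ((slice h V).flip b).lTensor A (universalLeft h (x ⊗ₜ ω)) := by
  obtain ⟨a, rfl⟩ := dualMk_surjective ω
  have h1 : ∀ v : A ⊗[ℂ] B, (sliceFst h.φ).lTensor A ((leg13 V).left (x ⊗ₜ v)) =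
      V.left (x ⊗ₜ sliceFst h.φ v) := by
    intro v
    induction v with
    | zero => simp
    | add u v hu hv => simp only [TensorProduct.tmul_add, map_add, hu, hv]
    | tmul a' b' =>
      rw [leg13_left, TensorProduct.leftComm_symm_tmul, LinearMap.lTensor_tmul, sliceFst_tmul,
        TensorProduct.tmul_smul, map_smul]
      generalize V.left (x ⊗ₜ b') = z
      induction z with
      | zero => simp
      | add u v hu hv => simp only [TensorProduct.tmul_add, map_add, smul_add, hu, hv]
      | tmul p q => simp
  have h2 : ∀ w : A ⊗[ℂ] A, (sliceFst h.φ).lTensor A (TensorProduct.assoc ℂ A A B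
      ((H.Δ.amplify B V).left (H.T₁ w ⊗ₜ b))) =
      ((slice h V).flip b).lTensor A (h.dualMk.lTensor A (TensorProduct.comm ℂ A A w)) := by
    intro w
    induction w with
    | zero => simp
    | add u v hu hv => simp only [TensorProduct.add_tmul, map_add, hu, hv]
    | tmul p q =>
      rw [amplify_left_T₁, TensorProduct.comm_tmul, LinearMap.lTensor_tmul,
        LinearMap.lTensor_tmul, LinearMap.flip_apply, slice_dualMk]
      generalize V.left (p ⊗ₜ b) = z
      induction z with
      | zero => simp
      | add u v hu hv => simp only [TensorProduct.tmul_add, map_add, hu, hv]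
      | tmul r s =>
        have h3 : ∀ Z : A ⊗[ℂ] A, (sliceFst h.φ).lTensor A
            (TensorProduct.assoc ℂ A A B (Z ⊗ₜ s)) = sliceSnd h.φ Z ⊗ₜ s := by
          intro Z
          induction Z with
          | zero => simp
          | add u v hu hv => simp only [TensorProduct.add_tmul, map_add, hu, hv]
          | tmul u v => simp [TensorProduct.smul_tmul]
        rw [LinearMap.rTensor_tmul, h3, sliceFst_tmul]
        have h4 : sliceSnd h.φ (H.T₁ (r ⊗ₜ q)) = h.φ r • q := h.isLeftInvariant.T₁ r q
        simp [h4, TensorProduct.smul_tmul]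
  have h5 := congrArg (fun T => (sliceFst h.φ).lTensor A (Multiplier.left T
    (TensorProduct.assoc ℂ A A B ((x ⊗ₜ a) ⊗ₜ b)))) hV
  simp only [transport_left, LinearEquiv.symm_apply_apply, mul_left_apply] at h5
  rw [← H.T₁.apply_symm_apply (x ⊗ₜ a), h2, LinearEquiv.apply_symm_apply,
    TensorProduct.assoc_tmul, leg23_left, LinearMap.lTensor_tmul, h1, ← slice_dualMk,
    ← universalLeft_tmul] at h5
  exact h5.symm

/-- `(ω, b) ↦ b (ω ⊙ ι)(V)` for `ω = ψ(c ·)`, which is `(ψ ⊙ ι)((c ⊗ b)V)`. -/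
noncomputable def sliceRight (V : Multiplier (A ⊗[ℂ] B)) : h.Dual →ₗ[ℂ] B →ₗ[ℂ] B :=
  LinearMap.mk₂ ℂ (fun ω b => sliceFst h.ψ (V.right (h.dualEquivRight.symm ω ⊗ₜ b)))
    (fun ω ω' b => by simp [TensorProduct.add_tmul])
    (fun c ω b => by simp [← TensorProduct.smul_tmul'])
    (fun ω b b' => by simp [TensorProduct.tmul_add])
    (fun c ω b => by simp)

lemma sliceRight_apply (V : Multiplier (A ⊗[ℂ] B)) (c : A) (b : B) :
    sliceRight h V (h.dualEquivRight c) b = sliceFst h.ψ (V.right (c ⊗ₜ b)) := by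
  simp [sliceRight]

/-- The left multiplier `(ω ⊙ ι)(V)` has a right companion: both are `(ω ⊙ ι)` of `V` cut down by
local units for `ω`. -/
lemma mul_slice (V : Multiplier (A ⊗[ℂ] B)) (ω : h.Dual) (b' b : B) :
    b' * slice h V ω b = sliceRight h V ω b' * b := by
  obtain ⟨a, ha⟩ := dualMk_surjective ω
  obtain ⟨c, hc⟩ := h.dualEquivRight.surjective ω
  obtain ⟨e, he⟩ := exists_left_unit h a
  obtain ⟨f, hf⟩ := h.exists_right_unit c
  set ξ := Dual.functional h ω with hξ
  have hξa : h.φ ∘ₗ LinearMap.mulRight ℂ a = ξ := by rw [hξ, ← ha]; rfl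
  have hξc : h.ψ ∘ₗ LinearMap.mulLeft ℂ c = ξ := by
    rw [hξ, ← hc]
    exact LinearMap.ext fun z => by simp
  have hξe : ξ ∘ₗ LinearMap.mulRight ℂ e = ξ := by
    rw [← hξa]
    exact LinearMap.ext fun z => by simp [mul_assoc, he]
  have hξf : ξ ∘ₗ LinearMap.mulLeft ℂ f = ξ := by
    rw [← hξc]
    exact LinearMap.ext fun z => by simp [← mul_assoc, hf]
  have h1 : slice h V ω b = sliceFst ξ (V.left (e ⊗ₜ b)) := by
    have : (a ⊗ₜ b : A ⊗[ℂ] B) = (LinearMap.mulRight ℂ a).rTensor B (e ⊗ₜ b) := by simp [he]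
    rw [← ha, slice_dualMk, this, left_rTensor_mulRight, sliceFst_rTensor, hξa]
  have h2 : sliceRight h V ω b' = sliceFst ξ (V.right (f ⊗ₜ b')) := by
    have : (c ⊗ₜ b' : A ⊗[ℂ] B) = (LinearMap.mulLeft ℂ c).rTensor B (f ⊗ₜ b') := by simp [hf]
    rw [← hc, sliceRight_apply, this, right_rTensor_mulLeft, sliceFst_rTensor, hξc]
  have h3 := congrArg (sliceFst ξ) (V.mul_left_eq (f ⊗ₜ b') (e ⊗ₜ b))
  rw [tmul_mul_eq_map, mul_tmul_eq_map, sliceFst_lTensor, sliceFst_lTensor, sliceFst_rTensor,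
    sliceFst_rTensor, hξe, hξf] at h3
  rw [h1, h2]
  exact h3

/-- The homomorphism `π_V` of a corepresentation `V`. -/
noncomputable def inducedHom (V : Multiplier (A ⊗[ℂ] B)) (hV : IsCorepresentation H V) :
    h.Dual →ₙₐ[ℂ] Multiplier B where
  toFun ω := ofCompat (slice h V ω) (sliceRight h V ω) (mul_slice h V ω)
  map_smul' c ω := ext_left fun b => by
    change slice h V (c • ω) b = c • slice h V ω b
    rw [map_smul, LinearMap.smul_apply]
  map_zero' := ext_left fun b => by
    change slice h V 0 b = 0
    rw [map_zero, LinearMap.zero_apply]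
  map_add' ω ω' := ext_left fun b => by
    change slice h V (ω + ω') b = slice h V ω b + slice h V ω' b
    rw [map_add, LinearMap.add_apply]
  map_mul' ω ω' := ext_left fun b => by
    change slice h V (ω * ω') b = slice h V ω (slice h V ω' b)
    obtain ⟨a, rfl⟩ := dualMk_surjective ω
    rw [slice_dualMk, hV.left_slice, sliceFst_lTensor, sliceFst_universalLeft,
      LinearMap.flip_apply]

lemma inducedHom_left (V : Multiplier (A ⊗[ℂ] B)) (hV : IsCorepresentation H V) (ω : h.Dual) :
    (inducedHom h V hV ω).left = slice h V ω := rfl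

lemma inducedHom_right (V : Multiplier (A ⊗[ℂ] B)) (hV : IsCorepresentation H V) (ω : h.Dual) :
    (inducedHom h V hV ω).right = sliceRight h V ω := rfl

/-- For an invertible corepresentation `V`, the homomorphism `π_V` is non-degenerate. -/
noncomputable def inducedNondegHom (V : Multiplier (A ⊗[ℂ] B))
    (hV : IsNondegenerateCorepresentation H V) : NondegHom h.Dual B where
  toHom := inducedHom h V hV.1
  span_left := by
    obtain ⟨V', hV', -⟩ := isUnit_iff_exists.1 hV.2
    refine eq_top_iff.2 fun b _ => ?_
    obtain ⟨z, rfl⟩ := sliceFst_surjective h.ne_zero b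
    have hz : V.left (V'.left z) = z := by rw [← mul_left_apply, hV']; rfl
    rw [← hz]
    generalize V'.left z = w
    induction w with
    | zero => simp
    | add u v hu hv => rw [map_add, map_add]; exact Submodule.add_mem _ hu hv
    | tmul a b =>
      exact Submodule.subset_span ⟨h.dualMk a, b, by rw [inducedHom_left, slice_dualMk]⟩
  span_right := by
    obtain ⟨V', -, hV'⟩ := isUnit_iff_exists.1 hV.2
    refine eq_top_iff.2 fun b _ => ?_
    obtain ⟨z, rfl⟩ := sliceFst_surjective h.isRightInvariant.ne_zero b
    have hz : V.right (V'.right z) = z := by rw [← mul_right_apply, hV']; rfl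
    rw [← hz]
    generalize V'.right z = w
    induction w with
    | zero => simp
    | add u v hu hv => rw [map_add, map_add]; exact Submodule.add_mem _ hu hv
    | tmul c b =>
      exact Submodule.subset_span
        ⟨h.dualEquivRight c, b, by rw [inducedHom_right, sliceRight_apply]⟩

lemma coamplify_inducedNondegHom (V : Multiplier (A ⊗[ℂ] B))
    (hV : IsNondegenerateCorepresentation H V) :
    (inducedNondegHom h V hV).coamplify A (universalCorepresentation h) = V := by
  refine ext_left fun w => ?_
  refine (inducedNondegHom h V hV).lTensor_actLeft_induction (p := fun w =>
    ((inducedNondegHom h V hV).coamplify A (universalCorepresentation h)).left w = V.left w)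
    (by simp) (fun x y hx hy => by rw [map_add, map_add, hx, hy]) (fun e x ω => ?_) w
  rw [NondegHom.coamplify_left]
  exact (hV.1.left_slice h x ω e).symm

lemma isNondegenerateCorepresentation_coamplify (θ : NondegHom h.Dual B) :
    IsNondegenerateCorepresentation H (θ.coamplify A (universalCorepresentation h)) :=
  ⟨isCorepresentation_coamplify h θ, θ.isUnit_coamplify (isUnit_universalCorepresentation h)⟩

lemma coamplify_universalCorepresentation_injective : Function.Injective
    fun θ : NondegHom h.Dual B => θ.coamplify A (universalCorepresentation h) := by
  intro θ θ' hθ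
  have h1 := isInducedHom_coamplify h θ
  have h2 := isInducedHom_coamplify h θ'
  have h3 : θ.toHom = θ'.toHom := NonUnitalAlgHom.ext fun ω => ext_left fun b => by
    rw [h1 ω, h2 ω]
    exact congrArg (fun V => slice h V ω b) hθ
  cases θ
  cases θ'
  cases h3
  rfl

end

end AQG

theorem mainTheorem6 {A : Type*} [NonUnitalRing A] [Module ℂ A] [IsScalarTower ℂ A A]
    [SMulCommClass ℂ A A] [AQG.NondegenerateAlgebra A]
    (H : AQG.RegularMultiplierHopf A) (h : AQG.LeftHaar H) :
    (∃! U : AQG.Multiplier (A ⊗[ℂ] h.Dual), AQG.IsUniversalCorepresentation h U) ∧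
    ∀ U : AQG.Multiplier (A ⊗[ℂ] h.Dual), AQG.IsUniversalCorepresentation h U →
      ∀ (B : Type*) [NonUnitalRing B] [Module ℂ B] [IsScalarTower ℂ B B] [SMulCommClass ℂ B B]
        [AQG.NondegenerateAlgebra B],
        (∀ V : AQG.Multiplier (A ⊗[ℂ] B), AQG.IsNondegenerateCorepresentation H V →
          ∃! θ : AQG.NondegHom h.Dual B, θ.coamplify A U = V) ∧
        (∀ θ : AQG.NondegHom h.Dual B,
          AQG.IsNondegenerateCorepresentation H (θ.coamplify A U) ∧
          AQG.IsInducedHom h (θ.coamplify A U) θ.toHom) ∧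
        Set.BijOn (fun θ : AQG.NondegHom h.Dual B => θ.coamplify A U) Set.univ
          {V | AQG.IsNondegenerateCorepresentation H V} := by
  have hU₀ := AQG.isUniversalCorepresentation_universalCorepresentation h
  refine ⟨⟨_, hU₀, fun U hU => hU.unique hU₀⟩, fun U hU B _ _ _ _ _ => ?_⟩
  obtain rfl := hU.unique hU₀
  have hinj := AQG.coamplify_universalCorepresentation_injective (B := B) h
  refine ⟨fun V hV => ⟨_, AQG.coamplify_inducedNondegHom h V hV, fun θ hθ =>
    hinj (hθ.trans (AQG.coamplify_inducedNondegHom h V hV).symm)⟩,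
    fun θ => ⟨AQG.isNondegenerateCorepresentation_coamplify h θ,
      AQG.isInducedHom_coamplify h θ⟩,
    fun θ _ => AQG.isNondegenerateCorepresentation_coamplify h θ, hinj.injOn,
    fun V hV => ⟨_, trivial, AQG.coamplify_inducedNondegHom h V hV⟩⟩
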